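/- Algorithms are deterministic programs of a random access machine with logarithmic cost: a program uses finitely many registers and finitely many arrays of natural numbers, its elementary steps are constant assignment, $+$, truncated $-$, $\times$, integer division, indirect load and store, and test for zero (in conditionals and loops), and each step costs one plus the bit lengths of the numbers (including addresses) that it handles. A 3-SAT instance is a 3-CNF formula $\phi$; its primal graph has the variables of $\phi$ as vertices, two distinct variables being adjacent when they appear together in a clause. A path decomposition of a graph is a sequence of vertex sets (bags) $B_1,\dots,B_t$ such that every vertex lies in a bag, both ends of every edge lie in a common bag, and the bags containing any given vertex are consecutive; its width is the maximum size of a bag minus one. The PP-SETH is the following hypothesis: for no $\varepsilon\in(0,2)$ is there an algorithm which takes as input a 3-SAT instance $\phi$ and a path decomposition of its primal graph, of width $\mathrm{pw}$, and correctly decides whether $\phi$ is satisfiable in time $(2-\varepsilon)^{\mathrm{pw}}\,N^{O(1)}$, where $N$ is one plus the total number of variables, clauses and bags of the input. In Short-$k$-Independent-Set Reconfiguration one is given a graph $G$ on $n$ vertices (by its adjacency matrix), two independent sets $S,T$ of $G$ of size $k$, and an integer $\ell\ge 0$, and is asked whether $S$ can be transformed into $T$ by at most $\ell$ token jumping moves;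 a token jumping move replaces a vertex of the current set with a vertex outside the current set, and every set in the sequence must be independent. Below, time $f(n)\,\ell^{O(1)}$ means that there are constants $C,c$ such that the running time is at most $C\,f(n)\,(\ell+1)^c$ on every instance. Theorem. The following statements are equivalent: 1. The PP-SETH is false. 2. There exist $\varepsilon>0$, an integer $k\ge 4$ and an algorithm that solves Short-$k$-Independent-Set Reconfiguration in time $n^{k-1-\varepsilon}\,\ell^{O(1)}$. 3. There exist $\varepsilon>0$, an integer $k_0\ge 4$ and a single algorithm, which receives $k$ as part of its input, that for all $k\ge k_0$ solves Short-$k$-Independent-Set Reconfiguration in time $n^{(1-\varepsilon)k}\,\ell^{O(1)}$, the constants $C,c$ being independent of $k$. -/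

import Mathlib

/-! ## Model of computation: random access machines with logarithmic cost -/

namespace RAM

/-- A memory configuration: registers and arrays, all holding natural numbers. A program mentions
only finitely many registers and finitely many arrays. -/
structure State where
  reg : ℕ → ℕ
  arr : ℕ → ℕ → ℕ

/-- Arithmetic operations (subtraction is truncated, division is rounded down). -/
inductive Op where
  | add
  | sub
  | mul
  | div

/-- The value of an arithmetic operation. -/
def Op.eval : Op → ℕ → ℕ → ℕ
  | .add, a, b => a + b
  | .sub, a, b => a - b
  | .mul, a, b => a * b
  | .div, a, b => a / b

/-- Programs of the random access machine. Registers and arrays are named by fixed numbers;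
`x`, `y`, `z`, `i` stand for register names and `a` for an array name. -/
inductive Prog where
  /-- do nothing -/
  | skip
  /-- `x := c` -/
  | const (x c : ℕ)
  /-- `x := y o z` -/
  | op (o : Op) (x y z : ℕ)
  /-- `x := a[i]` -/
  | load (x a i : ℕ)
  /-- `a[i] := x` -/
  | store (a i x : ℕ)
  /-- `p; q` -/
  | seq (p q : Prog)
  /-- `if x ≠ 0 then p else q` -/
  | ite (x : ℕ) (p q : Prog)
  /-- `while x ≠ 0 do p` -/
  | loop (x : ℕ) (p : Prog)

/-- Overwrite a register. -/
def State.setReg (s : State) (x v : ℕ) : State :=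
  { s with reg := Function.update s.reg x v }

/-- Overwrite an array cell. -/
def State.setArr (s : State) (a i v : ℕ) : State :=
  { s with arr := Function.update s.arr a (Function.update (s.arr a) i v) }

/-- `Exec p s t s'`: started in `s`, the program `p` halts in `s'` and its run has cost `t`.
Every elementary step costs one plus the bit lengths (`Nat.size`) of the numbers it handles,
addresses of array cells included. -/
inductive Exec : Prog → State → ℕ → State → Prop where
  | skip (s : State) : Exec .skip s 1 s
  | const (s : State) (x c : ℕ) :
      Exec (.const x c) s (1 + c.size) (s.setReg x c)
  | op (s : State) (o : Op) (x y z : ℕ) :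
      Exec (.op o x y z) s (1 + (s.reg y).size + (s.reg z).size)
        (s.setReg x (o.eval (s.reg y) (s.reg z)))
  | load (s : State) (x a i : ℕ) :
      Exec (.load x a i) s (1 + (s.reg i).size + (s.arr a (s.reg i)).size)
        (s.setReg x (s.arr a (s.reg i)))
  | store (s : State) (a i x : ℕ) :
      Exec (.store a i x) s (1 + (s.reg i).size + (s.reg x).size)
        (s.setArr a (s.reg i) (s.reg x))
  | seq {p q : Prog} {s s' s'' : State} {t t' : ℕ} :
      Exec p s t s' → Exec q s' t' s'' → Exec (.seq p q) s (t + t') s''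
  | ite_true {x : ℕ} {p q : Prog} {s s' : State} {t : ℕ} :
      s.reg x ≠ 0 → Exec p s t s' → Exec (.ite x p q) s (1 + (s.reg x).size + t) s'
  | ite_false {x : ℕ} {p q : Prog} {s s' : State} {t : ℕ} :
      s.reg x = 0 → Exec q s t s' → Exec (.ite x p q) s (1 + (s.reg x).size + t) s'
  | loop_done {x : ℕ} {p : Prog} {s : State} :
      s.reg x = 0 → Exec (.loop x p) s (1 + (s.reg x).size) s
  | loop_step {x : ℕ} {p : Prog} {s s' s'' : State} {t t' : ℕ} :
      s.reg x ≠ 0 → Exec p s t s' → Exec (.loop x p) s' t' s'' →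
      Exec (.loop x p) s (1 + (s.reg x).size + t + t') s''

/-- The initial configuration: the input is a list of lists, the `a`-th of which is the initial
content of array `a`; everything else is zero. -/
def initState (input : List (List ℕ)) : State where
  reg := fun _ => 0
  arr := fun a i => (input.getD a []).getD i 0

/-- On the given input, `p` halts after time at most `bound`, and it accepts (register `0` is then
nonzero) if and only if `answer` holds. -/
def Decides (p : Prog) (input : List (List ℕ)) (answer : Prop) (bound : ℝ) : Prop :=
  ∃ (t : ℕ) (s : State),
    Exec p (initState input) t s ∧ (t : ℝ) ≤ bound ∧ (s.reg 0 ≠ 0 ↔ answer)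

end RAM

/-! ## 3-SAT with a path decomposition of the primal graph -/

namespace PathSat

/-- `B` is a path decomposition of `G`. -/
structure IsPathDecomposition {V : Type*} {t : ℕ} (G : SimpleGraph V) (B : Fin t → Finset V) :
    Prop where
  vertex_mem : ∀ x : V, ∃ j, x ∈ B j
  edge_mem : ∀ x y : V, G.Adj x y → ∃ j, x ∈ B j ∧ y ∈ B j
  interval : ∀ (x : V) (j₁ j j₂ : Fin t), j₁ ≤ j → j ≤ j₂ → x ∈ B j₁ → x ∈ B j₂ → x ∈ B j

/-- The width of a sequence of bags: the maximum size of a bag minus one. -/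
def width {V : Type*} {t : ℕ} (B : Fin t → Finset V) : ℕ :=
  (Finset.univ.sup fun j => (B j).card) - 1

/-- A 3-CNF formula on the variables `Fin n` with `m` clauses. A clause consists of three, not
necessarily distinct, literals; the literal `(v, true)` is the variable `v`, and `(v, false)` is
its negation. -/
abbrev Formula (n m : ℕ) := Fin m → Fin 3 → Fin n × Bool

/-- Some assignment satisfies at least one literal of every clause. -/
def Formula.Satisfiable {n m : ℕ} (φ : Formula n m) : Prop :=
  ∃ σ : Fin n → Bool, ∀ c, ∃ i, σ (φ c i).1 = (φ c i).2

/-- The primal graph: distinct variables are adjacent when they appear together in a clause. -/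
def Formula.primalGraph {n m : ℕ} (φ : Formula n m) : SimpleGraph (Fin n) where
  Adj x y := x ≠ y ∧ ∃ c, (∃ i, (φ c i).1 = x) ∧ ∃ j, (φ c j).1 = y
  symm := ⟨fun _ _ h => ⟨h.1.symm, h.2.imp fun _ h' => ⟨h'.2, h'.1⟩⟩⟩
  loopless := ⟨fun _ h => h.1 rfl⟩

/-- A 3-CNF formula together with a path decomposition of its primal graph. -/
structure Instance where
  numVars : ℕ
  numClauses : ℕ
  numBags : ℕ
  formula : Formula numVars numClauses
  bag : Fin numBags → Finset (Fin numVars)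
  isPathDecomposition : IsPathDecomposition formula.primalGraph bag

/-- The size of an instance: number of variables, of clauses and of bags. -/
def Instance.size (I : Instance) : ℕ := I.numVars + I.numClauses + I.numBags

/-- Input format. Array `0`: the numbers `n` of variables, `m` of clauses and `t` of bags.
Array `1`: the literals of the clauses, three cells per clause, variable `v` as `2 * v + 1` and
its negation as `2 * v`. Array `2`: the `t × n` incidence matrix of bags and variables, row by
row. -/
def Instance.encode (I : Instance) : List (List ℕ) :=
  [[I.numVars, I.numClauses, I.numBags],
   List.ofFn fun q : Fin (I.numClauses * 3) =>
     2 * ((I.formula q.divNat q.modNat).1 : ℕ) + (I.formula q.divNat q.modNat).2.toNat,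
   List.ofFn fun q : Fin (I.numBags * I.numVars) =>
     if q.modNat ∈ I.bag q.divNat then 1 else 0]

/-- The Primal Pathwidth Strong Exponential Time Hypothesis: for no `ε > 0` is there an algorithm
that decides 3-SAT, given a path decomposition of width `pw` of the primal graph, in time
`(2 - ε) ^ pw` times a polynomial in the size of the input. -/
def PPSETH : Prop :=
  ∀ ε : ℝ, 0 < ε → ε < 2 →
    ¬ ∃ (p : RAM.Prog) (C : ℝ) (c : ℕ), ∀ I : Instance,
      RAM.Decides p I.encode I.formula.Satisfiable
        (C * (2 - ε) ^ width I.bag * ((I.size : ℝ) + 1) ^ c)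

end PathSat

/-! ## Independent set reconfiguration by token jumping -/

namespace Reconf

/-- `B` is an independent set that arises from `A` by replacing one vertex of `A` with a vertex
outside `A`. -/
def TokenJump {V : Type*} [DecidableEq V] (G : SimpleGraph V) (A B : Finset V) : Prop :=
  G.IsIndepSet (B : Set V) ∧ ∃ u ∈ A, ∃ v ∉ A, B = insert v (A.erase u)

/-- `S` can be transformed into `T` by at most `l` token jumping moves. -/
def Reachable {V : Type*} [DecidableEq V] (G : SimpleGraph V) (S T : Finset V) (l : ℕ) : Prop :=
  ∃ r ≤ l, ∃ A : ℕ → Finset V, A 0 = S ∧ A r = T ∧ ∀ i < r, TokenJump G (A i) (A (i + 1))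

/-- A graph on `n` vertices, two independent sets of size `k`, and a length bound. -/
structure Instance (k : ℕ) where
  n : ℕ
  graph : SimpleGraph (Fin n)
  source : Finset (Fin n)
  target : Finset (Fin n)
  card_source : source.card = k
  card_target : target.card = k
  indep_source : graph.IsIndepSet (source : Set (Fin n))
  indep_target : graph.IsIndepSet (target : Set (Fin n))
  len : ℕ

/-- The question asked about an instance. -/
def Instance.Answer {k : ℕ} (I : Instance k) : Prop :=
  Reachable I.graph I.source I.target I.len

open Classical in
/-- Input format. Array `0`: the number of vertices, `k`, and the length bound. Arrays `1` and `2`: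
the characteristic vectors of the two sets. Array `3`: the adjacency matrix, row by row. -/
noncomputable def Instance.encode {k : ℕ} (I : Instance k) : List (List ℕ) :=
  [[I.n, k, I.len],
   List.ofFn fun v : Fin I.n => if v ∈ I.source then 1 else 0,
   List.ofFn fun v : Fin I.n => if v ∈ I.target then 1 else 0,
   List.ofFn fun q : Fin (I.n * I.n) => if I.graph.Adj q.divNat q.modNat then 1 else 0]

end Reconf

/-! Two reductions link path-decomposed 3-SAT and token jumping. In both of them the number of
vertices raised to the number of tokens matches two to the pathwidth, up to about one token.

From satisfiability to reconfiguration. Walk along the path decomposition and keep an assignment to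
the current bag, at most `pw + 1` bits. Cut it into `K = k - 1` pieces of about `pw / K` bits; each
piece is the position of one data token, so the graph has `2 ^ (pw / K)` vertices up to a polynomial
factor. The vertices are arranged in layers, one for each pair of a bag and a clause, and the data
tokens advance cyclically, one layer at a time. The last token is a helper: it holds a copy of the
piece that moves next, so the data token can only jump to a value agreeing with that copy. At the
beginning of a round it also names a literal of the current clause, which the state has to satisfy.
The length bound equals the number of moves needed, so no detour is possible and the moves alternate
between data and helper (`Layered.positions_of_answer`, `Layered.answer_iff_run`). Variables keep a
fixed slot while they are alive (`slot_old`, `slot_inj`), so an assignment has a well-defined place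
in the pieces. A running time with exponent `k - 1 - ε = K - ε` becomes `2 ^ ((1 - ε / K) * pw)`,
and writing the adjacency matrix costs `2 ^ (2 * pw / K)`, which is harmless because `K ≥ 3`.

From reconfiguration to satisfiability. Turn the token set into a queue: in `k` steps the queue
rotates once, each step removing the first token and appending one, and at most one appended token
per rotation differs from the removed one. A formula describing the queue has to remember only the
`k + 1` tokens of the current step, about `(k + 1) * log n` bits; every other test is spread over
polynomially many bags with a bounded number of auxiliary variables alive. Independence is tested
pair by pair, comparing digits with each forbidden pair of vertices (`satisfiable_timed_iff`,
`width_timed_le`). A base `2 - ε = 2 ^ β` with `β < 1` gives `n ^ (β * (k + 1) + O(1))`, and for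
large `k` the slack `(1 - β) * k` absorbs the additive terms. The exponents of all polynomial
factors are independent of `k` because `k ≤ n`.

The third statement gives the second by taking `k` so large that `ε * k > 1`.

Both reductions must be programs of the machine. `Comp` collects the functions computable in
polynomial time on known memory; it is closed under arithmetic and bounded sums, hence under bounded
quantifiers. `fill_all` writes tables of such functions, and `decides_of_fill` runs a given
algorithm on the result. -/

namespace RAM

/-! ### Renaming of registers and arrays -/

/-- Shift all register names by `R` and all array names by `A`. -/
def Prog.shift (R A : ℕ) : Prog → Prog
  | .skip => .skip
  | .const x c => .const (R + x) c
  | .op o x y z => .op o (R + x) (R + y) (R + z)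
  | .load x a i => .load (R + x) (A + a) (R + i)
  | .store a i x => .store (A + a) (R + i) (R + x)
  | .seq p q => .seq (p.shift R A) (q.shift R A)
  | .ite x p q => .ite (R + x) (p.shift R A) (q.shift R A)
  | .loop x p => .loop (R + x) (p.shift R A)

/-- The state `u` looks like `s` through the renaming of `Prog.shift`. -/
def State.ShiftRel (R A : ℕ) (s u : State) : Prop :=
  (∀ x, u.reg (R + x) = s.reg x) ∧ ∀ a, u.arr (A + a) = s.arr a

theorem State.ShiftRel.setReg {R A : ℕ} {s u : State} (h : s.ShiftRel R A u) (x v : ℕ) :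
    (s.setReg x v).ShiftRel R A (u.setReg (R + x) v) := by
  refine ⟨fun y => ?_, h.2⟩
  by_cases hy : y = x
  · subst hy; simp [State.setReg]
  · have : R + y ≠ R + x := by omega
    simp [State.setReg, Function.update_of_ne hy, Function.update_of_ne this, h.1]

theorem State.ShiftRel.setArr {R A : ℕ} {s u : State} (h : s.ShiftRel R A u) (a i v : ℕ) :
    (s.setArr a i v).ShiftRel R A (u.setArr (A + a) i v) := by
  refine ⟨h.1, fun b => ?_⟩
  by_cases hb : b = a
  · subst hb; simp [State.setArr, h.2]
  · have : A + b ≠ A + a := by omega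
    simp [State.setArr, Function.update_of_ne hb, Function.update_of_ne this, h.2]

/-- A step depends on the names of registers and arrays only through the values found there, and its
cost is the length of these values, so renaming changes neither the run nor its cost. -/
theorem Exec.shift {R A : ℕ} {p : Prog} {s s' : State} {t : ℕ} (h : Exec p s t s') :
    ∀ u, s.ShiftRel R A u → ∃ u', Exec (p.shift R A) u t u' ∧ s'.ShiftRel R A u' := by
  induction h with
  | skip s => exact fun u hu => ⟨u, .skip u, hu⟩
  | const s x c => exact fun u hu => ⟨_, .const u _ c, hu.setReg x c⟩
  | op s o x y z =>
    intro u hu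
    refine ⟨_, ?_, hu.setReg x _⟩
    have := Exec.op u o (R + x) (R + y) (R + z)
    rwa [hu.1, hu.1] at this
  | load s x a i =>
    intro u hu
    refine ⟨_, ?_, hu.setReg x _⟩
    have := Exec.load u (R + x) (A + a) (R + i)
    rwa [hu.1, hu.2] at this
  | store s a i x =>
    intro u hu
    refine ⟨_, ?_, hu.setArr a _ _⟩
    have := Exec.store u (A + a) (R + i) (R + x)
    rwa [hu.1, hu.1] at this
  | seq _ _ ih₁ ih₂ =>
    intro u hu
    obtain ⟨v, hv, hsv⟩ := ih₁ u hu
    obtain ⟨w, hw, hsw⟩ := ih₂ v hsv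
    exact ⟨w, .seq hv hw, hsw⟩
  | ite_true hx _ ih =>
    intro u hu
    obtain ⟨v, hv, hsv⟩ := ih u hu
    refine ⟨v, ?_, hsv⟩
    rw [← hu.1] at hx ⊢
    exact .ite_true hx hv
  | ite_false hx _ ih =>
    intro u hu
    obtain ⟨v, hv, hsv⟩ := ih u hu
    refine ⟨v, ?_, hsv⟩
    rw [← hu.1] at hx ⊢
    exact .ite_false hx hv
  | loop_done hx =>
    intro u hu
    refine ⟨u, ?_, hu⟩
    rw [← hu.1] at hx ⊢
    exact .loop_done hx
  | loop_step hx _ _ ih₁ ih₂ =>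
    intro u hu
    obtain ⟨v, hv, hsv⟩ := ih₁ u hu
    obtain ⟨w, hw, hsw⟩ := ih₂ v hsv
    refine ⟨w, ?_, hsw⟩
    rw [← hu.1] at hx ⊢
    exact .loop_step hx hv hw

/-! ### Polynomially bounded functions -/

/-- `f` is bounded by a polynomial in `size`. -/
def PolyBdd {Γ : Type} (size f : Γ → ℕ) : Prop := ∃ K, ∀ γ, f γ ≤ (size γ + 2) ^ K

namespace PolyBdd

variable {Γ Δ : Type} {size f g : Γ → ℕ}

theorem mono (hg : PolyBdd size g) (h : ∀ γ, f γ ≤ g γ) : PolyBdd size f :=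
  hg.imp fun _ hK γ => (h γ).trans (hK γ)

/-- The base `size γ + 2` is at least two, so constants, and factors of two in sums, are absorbed by
a larger exponent. -/
theorem const (size : Γ → ℕ) (c : ℕ) : PolyBdd size fun _ => c :=
  ⟨c, fun γ => (Nat.lt_two_pow_self).le.trans (Nat.pow_le_pow_left (by omega) c)⟩

theorem self (size : Γ → ℕ) : PolyBdd size size := ⟨1, fun γ => by rw [pow_one]; omega⟩

theorem mul (hf : PolyBdd size f) (hg : PolyBdd size g) : PolyBdd size fun γ => f γ * g γ := by
  obtain ⟨K, hK⟩ := hf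
  obtain ⟨L, hL⟩ := hg
  exact ⟨K + L, fun γ => by rw [pow_add]; exact Nat.mul_le_mul (hK γ) (hL γ)⟩

theorem add (hf : PolyBdd size f) (hg : PolyBdd size g) : PolyBdd size fun γ => f γ + g γ := by
  obtain ⟨K, hK⟩ := hf
  obtain ⟨L, hL⟩ := hg
  refine ⟨K + L + 1, fun γ => ?_⟩
  have h1 : f γ ≤ (size γ + 2) ^ (K + L) :=
    (hK γ).trans (Nat.pow_le_pow_right (by omega) (by omega))
  have h2 : g γ ≤ (size γ + 2) ^ (K + L) :=
    (hL γ).trans (Nat.pow_le_pow_right (by omega) (by omega))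
  calc f γ + g γ ≤ (size γ + 2) ^ (K + L) * 2 := by omega
    _ ≤ (size γ + 2) ^ (K + L + 1) := by
      rw [pow_succ]; exact Nat.mul_le_mul_left _ (by omega)

theorem comp (hf : PolyBdd size f) {size' : Δ → ℕ} (π : Δ → Γ)
    (h : ∀ δ, size (π δ) ≤ size' δ) : PolyBdd size' fun δ => f (π δ) :=
  hf.imp fun K hK δ => (hK (π δ)).trans (Nat.pow_le_pow_left (by have := h δ; omega) K)

theorem natSize (hf : PolyBdd size f) : PolyBdd size fun γ => (f γ).size :=
  hf.mono fun γ => by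
    rw [Nat.size_le]; exact Nat.lt_two_pow_self

end PolyBdd

theorem size_add_le (a b : ℕ) : (a + b).size ≤ a.size + b.size + 1 := by
  rw [Nat.size_le]
  have ha := Nat.lt_size_self a
  have hb := Nat.lt_size_self b
  have h1 : 2 ^ a.size ≤ 2 ^ (a.size + b.size) := Nat.pow_le_pow_right (by omega) (by omega)
  have h2 : 2 ^ b.size ≤ 2 ^ (a.size + b.size) := Nat.pow_le_pow_right (by omega) (by omega)
  rw [pow_succ]; omega

theorem size_mul_le (a b : ℕ) : (a * b).size ≤ a.size + b.size + 1 := by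
  rw [Nat.size_le, pow_succ, pow_add]
  have ha := Nat.lt_size_self a
  have hb := Nat.lt_size_self b
  have := Nat.mul_le_mul ha.le hb.le
  have h3 : 0 < 2 ^ a.size * 2 ^ b.size := by positivity
  omega

theorem Op.size_eval_le (o : Op) (a b : ℕ) : (o.eval a b).size ≤ a.size + b.size + 1 := by
  cases o
  · exact size_add_le a b
  · exact (Nat.size_le_size (Nat.sub_le a b)).trans (by omega)
  · exact size_mul_le a b
  · exact (Nat.size_le_size (Nat.div_le_self a b)).trans (by omega)

/-! ### Counting loops -/

/-- Run `body` with register `r` counting upwards from zero, as often as register `r + 1` says. -/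
def forLoop (r : ℕ) (body : Prog) : Prog :=
  .seq (.const r 0) (.seq (.const (r + 2) 1) (.loop (r + 1)
    (.seq body (.seq (.op .add r r (r + 2)) (.op .sub (r + 1) (r + 1) (r + 2))))))

/-- The hypothesis `hinv` makes the invariant blind to the three bookkeeping registers, so the
counter updates between two rounds preserve it. -/
theorem forLoop_exec {body : Prog} {r N T : ℕ} {Inv : ℕ → State → Prop}
    (hinv : ∀ i s x v, r ≤ x → x < r + 3 → Inv i s → Inv i (s.setReg x v))
    (hbody : ∀ i < N, ∀ s, Inv i s → s.reg r = i → ∃ t s', Exec body s t s' ∧ Inv (i + 1) s' ∧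
      (∀ x, r ≤ x → x < r + 3 → s'.reg x = s.reg x) ∧ t ≤ T)
    {s : State} (hs : Inv 0 s) (hN : s.reg (r + 1) = N) :
    ∃ t s', Exec (forLoop r body) s t s' ∧ Inv N s' ∧ t ≤ (N + 1) * (T + 3 * N.size + 5) := by
  -- Induction on the number `m` of remaining rounds, with the count `i` of finished rounds as its
  -- complement.
  have key : ∀ m i s, i + m = N → Inv i s → s.reg r = i → s.reg (r + 1) = m →
      s.reg (r + 2) = 1 → ∃ t s', Exec (.loop (r + 1) (.seq body (.seq (.op .add r r (r + 2))
        (.op .sub (r + 1) (r + 1) (r + 2))))) s t s' ∧ Inv N s' ∧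
        t ≤ 1 + m * (T + 3 * N.size + 5) := by
    intro m
    induction m with
    | zero =>
      intro i s him hs _ h1 _
      refine ⟨_, s, .loop_done h1, ?_, ?_⟩
      · obtain rfl : i = N := by omega
        exact hs
      · simp [h1]
    | succ m ih =>
      intro i s him hs h0 h1 h2
      obtain ⟨t, s₁, he, hs₁, hr, ht⟩ := hbody i (by omega) s hs h0
      have e0 : s₁.reg r = i := by rw [hr r (by omega) (by omega), h0]
      have e1 : s₁.reg (r + 1) = m + 1 := by rw [hr (r + 1) (by omega) (by omega), h1]
      have e2 : s₁.reg (r + 2) = 1 := by rw [hr (r + 2) (by omega) (by omega), h2]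
      have x1 := Exec.op s₁ .add r r (r + 2)
      rw [e0, e2] at x1
      set s₂ := s₁.setReg r (Op.add.eval i 1) with hs₂
      have x2 := Exec.op s₂ .sub (r + 1) (r + 1) (r + 2)
      have f1 : s₂.reg (r + 1) = m + 1 := by simp [hs₂, State.setReg, e1]
      have f2 : s₂.reg (r + 2) = 1 := by simp [hs₂, State.setReg, e2]
      have f0 : s₂.reg r = i + 1 := by simp [hs₂, State.setReg, Op.eval]
      rw [f1, f2] at x2
      set s₃ := s₂.setReg (r + 1) (Op.sub.eval (m + 1) 1) with hs₃
      obtain ⟨t', s', he', hs', ht'⟩ := ih (i + 1) s₃ (by omega)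
        (hinv _ _ _ _ (by omega) (by omega) (hinv _ _ _ _ (by omega) (by omega) hs₁))
        (by simp [hs₃, State.setReg, f0]) (by simp [hs₃, State.setReg, Op.eval])
        (by simp [hs₃, State.setReg, f2])
      refine ⟨_, s', .loop_step (by omega) (.seq he (.seq x1 x2)) he', hs', ?_⟩
      have z1 : (m + 1).size ≤ N.size := Nat.size_le_size (by omega)
      have z2 : i.size ≤ N.size := Nat.size_le_size (by omega)
      have z3 : Nat.size 1 = 1 := Nat.size_one
      rw [h1, z3, add_mul]
      omega
  have i1 := hinv 0 s r 0 le_rfl (by omega) hs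
  have i2 := hinv 0 _ (r + 2) 1 (by omega) (by omega) i1
  obtain ⟨t, s', he, hs', ht⟩ := key N 0 ((s.setReg r 0).setReg (r + 2) 1) (by omega) i2
    (by simp [State.setReg]) (by simp [State.setReg, hN]) (by simp [State.setReg])
  refine ⟨_, s', .seq (.const _ _ _) (.seq (.const _ _ _) he), hs', ?_⟩
  have z3 : Nat.size 1 = 1 := Nat.size_one
  rw [z3, Nat.size_zero, add_mul]
  omega

/-! ### Expressions that are cheap to evaluate -/

/-- What a program may assume about the memory and the registers below `top`, for every value of
some parameter; `size` is what running times are compared to. -/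
structure Ctx (Γ : Type) where
  size : Γ → ℕ
  mem : Γ → ℕ → ℕ → ℕ
  top : ℕ
  Reg : Γ → (ℕ → ℕ) → Prop
  reg_congr : ∀ {γ ρ ρ'}, Reg γ ρ → (∀ x < top, ρ' x = ρ x) → Reg γ ρ'

/-- The context inside a loop whose counter is kept in register `v`. -/
def Ctx.ext {Γ : Type} (c : Ctx Γ) (g : Γ → ℕ) (v : ℕ) (hv : c.top ≤ v) :
    Ctx (Σ γ, Fin (g γ)) where
  size δ := c.size δ.1
  mem δ := c.mem δ.1
  top := v + 1
  Reg δ ρ := c.Reg δ.1 ρ ∧ ρ v = δ.2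
  reg_congr h h' := ⟨c.reg_congr h.1 fun x hx => h' x (by omega), by rw [h' v (by omega), h.2]⟩

/-- In the context `c` there is, for every base register, a program which computes `f` into the
base register, in polynomial time and without touching lower registers and arrays. -/
structure Comp {Γ : Type} (c : Ctx Γ) (f : Γ → ℕ) : Prop where
  bits : PolyBdd c.size fun γ => (f γ).size
  prog : ∀ r, c.top ≤ r → ∃ (p : Prog) (R : ℕ) (T : Γ → ℕ), PolyBdd c.size T ∧
    ∀ γ s, s.arr = c.mem γ → c.Reg γ s.reg → ∃ t s', Exec p s t s' ∧ s'.arr = s.arr ∧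
      (∀ x < r, s'.reg x = s.reg x) ∧ (∀ x ≥ R, s'.reg x = s.reg x) ∧ s'.reg r = f γ ∧ t ≤ T γ

namespace Comp

variable {Γ : Type} {c : Ctx Γ} {f g : Γ → ℕ}

theorem congr (hf : Comp c f) (h : ∀ γ, f γ = g γ) : Comp c g := by
  obtain rfl : f = g := funext h
  exact hf

theorem const (c : Ctx Γ) (n : ℕ) : Comp c fun _ => n where
  bits := PolyBdd.const _ _
  prog r _ := by
    refine ⟨.const r n, r + 1, fun _ => 1 + n.size, PolyBdd.const _ _, fun γ s _ _ =>
      ⟨_, _, .const s r n, rfl, fun x hx => ?_, fun x hx => ?_, ?_, le_rfl⟩⟩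
    · simp [State.setReg, hx.ne]
    · have : x ≠ r := by omega
      simp [State.setReg, this]
    · simp [State.setReg]

theorem op (o : Op) (hf : Comp c f) (hg : Comp c g) : Comp c fun γ => o.eval (f γ) (g γ) where
  bits := ((hf.bits.add hg.bits).add (PolyBdd.const _ 1)).mono fun γ => o.size_eval_le _ _
  prog r hr := by
    obtain ⟨p₁, R₁, T₁, hT₁, h₁⟩ := hf.prog r hr
    -- The first value waits in register `r` while the second is computed strictly above it; this is
    -- why `Comp` offers a program for every base register.
    obtain ⟨p₂, R₂, T₂, hT₂, h₂⟩ := hg.prog (r + 1) (by omega)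
    refine ⟨.seq p₁ (.seq p₂ (.op o r r (r + 1))), r + R₁ + R₂ + 1,
      fun γ => T₁ γ + (T₂ γ + (1 + (f γ).size + (g γ).size)),
      hT₁.add (hT₂.add (((PolyBdd.const _ 1).add hf.bits).add hg.bits)), fun γ s hs hρ => ?_⟩
    obtain ⟨t₁, s₁, e₁, a₁, l₁, u₁, v₁, b₁⟩ := h₁ γ s hs hρ
    obtain ⟨t₂, s₂, e₂, a₂, l₂, u₂, v₂, b₂⟩ := h₂ γ s₁ (a₁.trans hs)
      (c.reg_congr hρ fun x hx => l₁ x (by omega))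
    have v₁' : s₂.reg r = f γ := by rw [l₂ r (by omega), v₁]
    have e₃ := Exec.op s₂ o r r (r + 1)
    rw [v₁', v₂] at e₃
    refine ⟨_, _, .seq e₁ (.seq e₂ e₃), a₂.trans a₁, fun x hx => ?_, fun x hx => ?_, ?_, ?_⟩
    · simp only [State.setReg, Function.update_of_ne hx.ne]
      rw [l₂ x (by omega), l₁ x hx]
    · have : x ≠ r := by omega
      simp only [State.setReg, Function.update_of_ne this]
      rw [u₂ x (by omega), u₁ x (by omega)]
    · simp [State.setReg]
    · beta_reduce; omega

/-- A uniform bound on the lengths of the cells is needed because reading a cell costs its length.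
-/
theorem load {a : ℕ} {m : Γ → ℕ → ℕ} (hm : ∀ γ i, c.mem γ a i = m γ i)
    (hb : ∃ K, ∀ γ i, (m γ i).size ≤ (c.size γ + 2) ^ K) (hf : Comp c f) :
    Comp c fun γ => m γ (f γ) where
  bits := hb.imp fun _ hK γ => hK γ _
  prog r hr := by
    obtain ⟨p, R, T, hT, h⟩ := hf.prog r hr
    have hbits : PolyBdd c.size fun γ => (m γ (f γ)).size := hb.imp fun _ hK γ => hK γ _
    refine ⟨.seq p (.load r a r), r + R + 1, fun γ => T γ + (1 + (f γ).size + (m γ (f γ)).size),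
      hT.add (((PolyBdd.const _ 1).add hf.bits).add hbits), fun γ s hs hρ => ?_⟩
    obtain ⟨t, s₁, e, ar, l, u, v, b⟩ := h γ s hs hρ
    have e₂ := Exec.load s₁ r a r
    have hv : s₁.arr a (f γ) = m γ (f γ) := by rw [ar, hs, hm]
    rw [v, hv] at e₂
    refine ⟨_, _, .seq e e₂, ar, fun x hx => ?_, fun x hx => ?_, ?_, ?_⟩
    · simp only [State.setReg, Function.update_of_ne hx.ne]
      exact l x hx
    · have : x ≠ r := by omega
      simp only [State.setReg, Function.update_of_ne this]
      exact u x (by omega)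
    · simp [State.setReg]
    · beta_reduce; omega

/-- Transport along a map between parameters. -/
theorem pull {Δ : Type} {d : Ctx Δ} (π : Δ → Γ) (hf : Comp c f)
    (hsize : ∀ δ, c.size (π δ) ≤ d.size δ) (hmem : ∀ δ, d.mem δ = c.mem (π δ))
    (htop : c.top ≤ d.top) (hreg : ∀ δ ρ, d.Reg δ ρ → c.Reg (π δ) ρ) :
    Comp d fun δ => f (π δ) where
  bits := hf.bits.comp π hsize
  prog r hr := by
    obtain ⟨p, R, T, hT, h⟩ := hf.prog r (by omega)
    exact ⟨p, R, fun δ => T (π δ), hT.comp π hsize, fun δ s hs hρ =>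
      h (π δ) s (by rw [hs, hmem]) (hreg _ _ hρ)⟩

theorem lift {h : Γ → ℕ} (hf : Comp c f) {v : ℕ} {hv : c.top ≤ v} :
    Comp (c.ext h v hv) fun δ => f δ.1 :=
  hf.pull (d := c.ext h v hv) Sigma.fst (fun _ => le_rfl) (fun _ => rfl)
    (by simp only [Ctx.ext]; omega) fun _ _ h => h.1

/-- Reading a register. -/
theorem register {x : ℕ} (hx : x < c.top) (h : ∀ γ ρ, c.Reg γ ρ → ρ x = f γ)
    (hb : PolyBdd c.size fun γ => (f γ).size) : Comp c f where
  bits := hb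
  prog r hr := by
    -- The machine has no copy instruction; adding zero replaces it.
    refine ⟨.seq (.const r 0) (.op .add r x r), r + 1,
      fun γ => 1 + (1 + (f γ).size), (PolyBdd.const _ 1).add ((PolyBdd.const _ 1).add hb),
      fun γ s _ hρ => ?_⟩
    have e := Exec.op (s.setReg r 0) .add r x r
    have hxr : x ≠ r := by omega
    have e1 : (s.setReg r 0).reg x = f γ := by
      simp only [State.setReg, Function.update_of_ne hxr]; exact h γ _ hρ
    have e2 : (s.setReg r 0).reg r = 0 := by simp [State.setReg]
    rw [e1, e2] at e
    refine ⟨_, _, .seq (.const s r 0) e, rfl, fun y hy => ?_, fun y hy => ?_, ?_, ?_⟩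
    · simp [State.setReg, hy.ne]
    · have : y ≠ r := by omega
      simp [State.setReg, this]
    · simp [State.setReg, Op.eval]
    · simp

theorem index {h : Γ → ℕ} (hh : PolyBdd c.size h) {v : ℕ} {hv : c.top ≤ v} :
    Comp (c.ext h v hv) fun δ => (δ.2 : ℕ) :=
  register (x := v) (by simp [Ctx.ext]) (fun _ _ h => h.2)
    ((hh.comp Sigma.fst fun _ => le_rfl).natSize.mono fun δ =>
      Nat.size_le_size δ.2.isLt.le)

/-- Register `r` accumulates, registers `r + 1` to `r + 3` run the loop, and the summand is
evaluated from `r + 4` upwards in the context extended by the counter. The total has polynomial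
length because it is at most the number of summands times a common bound. All bounded quantifiers
come from this lemma. -/
theorem sum {h : Γ → ℕ → ℕ} (hg : Comp c g) (hgp : PolyBdd c.size g)
    (hh : ∀ v (hv : c.top ≤ v), Comp (c.ext g v hv) fun δ => h δ.1 δ.2) :
    Comp c fun γ => ∑ i ∈ Finset.range (g γ), h γ i := by
  have hbits : PolyBdd c.size fun γ => (∑ i ∈ Finset.range (g γ), h γ i).size := by
    obtain ⟨K, hK⟩ := (hh c.top le_rfl).bits
    refine (hgp.add (⟨K, fun γ => le_rfl⟩ : PolyBdd c.size fun γ => (c.size γ + 2) ^ K)).mono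
      fun γ => ?_
    rw [Nat.size_le, pow_add]
    have hle : ∑ i ∈ Finset.range (g γ), h γ i ≤ g γ * 2 ^ (c.size γ + 2) ^ K := by
      refine (Finset.sum_le_card_nsmul _ _ (2 ^ (c.size γ + 2) ^ K) fun i hi => ?_).trans
        (by simp)
      have := hK ⟨γ, i, Finset.mem_range.1 hi⟩
      exact (Nat.size_le.1 this).le
    exact hle.trans_lt (Nat.mul_lt_mul_of_pos_right Nat.lt_two_pow_self (by positivity))
  refine ⟨hbits, fun r hr => ?_⟩
  obtain ⟨p, R₁, T₁, hT₁, h₁⟩ := hg.prog (r + 2) (by omega)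
  obtain ⟨q, R₂, T₂, ⟨K, hK⟩, h₂⟩ := (hh (r + 1) (by omega)).prog (r + 4) (by simp [Ctx.ext])
  obtain ⟨L, hL⟩ := (hh c.top le_rfl).bits
  refine ⟨.seq p (.seq (.const r 0) (forLoop (r + 1) (.seq q (.op .add r r (r + 4))))),
    r + R₁ + R₂ + 4, fun γ => T₁ γ + (1 + (g γ + 1) * (((c.size γ + 2) ^ K +
      (1 + (∑ i ∈ Finset.range (g γ), h γ i).size + (c.size γ + 2) ^ L)) + 3 * (g γ).size + 5)),
    hT₁.add ((PolyBdd.const _ 1).add ((hgp.add (PolyBdd.const _ 1)).mul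
      (((PolyBdd.add ⟨K, fun γ => le_rfl⟩ (((PolyBdd.const _ 1).add hbits).add
        ⟨L, fun γ => le_rfl⟩)).add ((PolyBdd.const _ 3).mul hgp.natSize)).add
          (PolyBdd.const _ 5)))), fun γ s hs hρ => ?_⟩
  obtain ⟨t₁, s₁, e₁, a₁, l₁, u₁, v₁, b₁⟩ := h₁ γ s hs hρ
  let Inv : ℕ → State → Prop := fun i s' => s'.arr = s.arr ∧ (∀ x < r, s'.reg x = s.reg x) ∧
    (∀ x ≥ r + R₁ + R₂ + 4, s'.reg x = s.reg x) ∧ s'.reg r = ∑ j ∈ Finset.range i, h γ j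
  have hInv : ∀ i s x v, r + 1 ≤ x → x < r + 1 + 3 → Inv i s → Inv i (s.setReg x v) := by
    rintro i s' x v hx hx' ⟨i1, i2, i3, i4⟩
    refine ⟨i1, fun y hy => ?_, fun y hy => ?_, ?_⟩
    · have : y ≠ x := by omega
      simp only [State.setReg, Function.update_of_ne this, i2 y hy]
    · have : y ≠ x := by omega
      simp only [State.setReg, Function.update_of_ne this, i3 y hy]
    · have : r ≠ x := by omega
      simp only [State.setReg, Function.update_of_ne this, i4]
  obtain ⟨t₂, s₂, e₂, i₂, b₂⟩ := forLoop_exec (body := .seq q (.op .add r r (r + 4)))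
    (N := g γ) (T := (c.size γ + 2) ^ K +
      (1 + (∑ i ∈ Finset.range (g γ), h γ i).size + (c.size γ + 2) ^ L)) hInv (by
      rintro i hi s' ⟨i1, i2, i3, i4⟩ hri
      obtain ⟨t, s₂, e, a, l, u, v, b⟩ := h₂ ⟨γ, i, hi⟩ s' (i1.trans hs)
        ⟨c.reg_congr hρ fun x hx => i2 x (by omega), hri⟩
      have hv : s₂.reg r = ∑ j ∈ Finset.range i, h γ j := by rw [l r (by omega), i4]
      have e₃ := Exec.op s₂ .add r r (r + 4)
      rw [hv, v] at e₃
      refine ⟨_, _, .seq e e₃, ⟨a.trans i1, fun x hx => ?_, fun x hx => ?_, ?_⟩, ?_, ?_⟩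
      · have : x ≠ r := by omega
        simp only [State.setReg, Function.update_of_ne this]
        rw [l x (by omega), i2 x hx]
      · have : x ≠ r := by omega
        simp only [State.setReg, Function.update_of_ne this]
        rw [u x (by omega), i3 x hx]
      · simp [State.setReg, Op.eval, Finset.sum_range_succ]
      · intro x hx hx'
        have : x ≠ r := by omega
        simp only [State.setReg, Function.update_of_ne this]
        exact l x (by omega)
      · have z1 := hK ⟨γ, i, hi⟩
        have z2 := hL ⟨γ, i, hi⟩
        have z3 : (∑ j ∈ Finset.range i, h γ j).size ≤ (∑ j ∈ Finset.range (g γ), h γ j).size :=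
          Nat.size_le_size (Finset.sum_le_sum_of_subset (Finset.range_mono hi.le))
        simp only [Ctx.ext] at z1 z2 b ⊢
        omega)
    (s := s₁.setReg r 0)
    ⟨a₁, fun x hx => by
        simp only [State.setReg, Function.update_of_ne hx.ne]; exact l₁ x (by omega),
      fun x hx => by
        have : x ≠ r := by omega
        simp only [State.setReg, Function.update_of_ne this]; exact u₁ x (by omega),
      by simp [State.setReg]⟩
    (by
      have : r + 1 + 1 ≠ r := by omega
      simpa only [State.setReg, Function.update_of_ne this] using v₁)
  refine ⟨_, s₂, .seq e₁ (.seq (.const _ _ _) e₂), i₂.1, i₂.2.1, i₂.2.2.1, i₂.2.2.2, ?_⟩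
  rw [Nat.size_zero]
  beta_reduce; omega

end Comp

end RAM

/-! ### Predicates as indicators, and bounded quantification. -/

namespace RAM

/-- The indicator of a proposition. -/
noncomputable def ind (P : Prop) : ℕ := open Classical in if P then 1 else 0

theorem ind_of {P : Prop} (h : P) : ind P = 1 := by simp [ind, h]

theorem ind_of_not {P : Prop} (h : ¬ P) : ind P = 0 := by simp [ind, h]

theorem ind_le (P : Prop) : ind P ≤ 1 := by
  by_cases h : P <;> simp [ind, h]

theorem ite_eq_ind (P : Prop) [Decidable P] : (if P then 1 else 0) = ind P := by
  by_cases h : P <;> simp [ind, h]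

theorem ind_eq_one {P : Prop} : ind P = 1 ↔ P := by
  by_cases h : P <;> simp [ind, h]

/-- In the context `c` the predicate `P` can be evaluated in polynomial time. -/
def CompP {Γ : Type} (c : Ctx Γ) (P : Γ → Prop) : Prop := Comp c fun γ => ind (P γ)

section

variable {Γ : Type} {c : Ctx Γ} {f g : Γ → ℕ} {P Q : Γ → Prop}

namespace Comp

theorem add (hf : Comp c f) (hg : Comp c g) : Comp c fun γ => f γ + g γ := hf.op .add hg

theorem sub (hf : Comp c f) (hg : Comp c g) : Comp c fun γ => f γ - g γ := hf.op .sub hg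

theorem mul (hf : Comp c f) (hg : Comp c g) : Comp c fun γ => f γ * g γ := hf.op .mul hg

theorem div (hf : Comp c f) (hg : Comp c g) : Comp c fun γ => f γ / g γ := hf.op .div hg

theorem mod (hf : Comp c f) (hg : Comp c g) : Comp c fun γ => f γ % g γ :=
  (hf.sub ((hf.div hg).mul hg)).congr fun γ => by
    have := Nat.div_add_mod' (f γ) (g γ)
    omega

/-- Both branches are evaluated and weighted by the indicator of the condition and of its negation,
so no jump in the program is needed. -/
theorem ite [∀ γ, Decidable (P γ)] (hP : CompP c P) (hf : Comp c f) (hg : Comp c g) :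
    Comp c fun γ => if P γ then f γ else g γ :=
  ((Comp.mul hP hf).add (((const c 1).sub hP).mul hg)).congr fun γ => by
    by_cases h : P γ <;> simp [ind, h]

end Comp

namespace CompP

theorem congr (hP : CompP c P) (h : ∀ γ, P γ ↔ Q γ) : CompP c Q := by
  obtain rfl : P = Q := funext fun γ => propext (h γ)
  exact hP

theorem lt (hf : Comp c f) (hg : Comp c g) : CompP c fun γ => f γ < g γ :=
  ((Comp.const c 1).sub ((Comp.const c 1).sub (hg.sub hf))).congr fun γ => by
    by_cases h : f γ < g γ
    · rw [ind_of h]; omega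
    · rw [ind_of_not h]; omega

theorem le (hf : Comp c f) (hg : Comp c g) : CompP c fun γ => f γ ≤ g γ :=
  (lt hf (hg.add (Comp.const c 1))).congr fun γ => by omega

theorem not (hP : CompP c P) : CompP c fun γ => ¬ P γ :=
  ((Comp.const c 1).sub hP).congr fun γ => by
    by_cases h : P γ <;> simp [ind, h]

theorem and (hP : CompP c P) (hQ : CompP c Q) : CompP c fun γ => P γ ∧ Q γ :=
  (Comp.mul hP hQ).congr fun γ => by
    by_cases h : P γ <;> by_cases h' : Q γ <;> simp [ind, h, h']

theorem or (hP : CompP c P) (hQ : CompP c Q) : CompP c fun γ => P γ ∨ Q γ :=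
  (hP.not.and hQ.not).not.congr fun γ => by tauto

theorem imp (hP : CompP c P) (hQ : CompP c Q) : CompP c fun γ => P γ → Q γ :=
  (hP.not.or hQ).congr fun γ => by tauto

theorem eq (hf : Comp c f) (hg : Comp c g) : CompP c fun γ => f γ = g γ :=
  ((le hf hg).and (le hg hf)).congr fun γ => by omega

/-- A witness exists exactly when the sum of the indicators is positive. -/
theorem exists_lt {R : Γ → ℕ → Prop} (hg : Comp c g) (hgp : PolyBdd c.size g)
    (hR : ∀ v (hv : c.top ≤ v), CompP (c.ext g v hv) fun δ => R δ.1 δ.2) :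
    CompP c fun γ => ∃ i < g γ, R γ i :=
  (lt (Comp.const c 0) (Comp.sum (h := fun γ i => ind (R γ i)) hg hgp hR)).congr fun γ => by
    rw [Finset.sum_pos_iff]
    refine exists_congr fun i => ?_
    by_cases h : R γ i <;> simp [ind, h]

theorem forall_lt {R : Γ → ℕ → Prop} (hg : Comp c g) (hgp : PolyBdd c.size g)
    (hR : ∀ v (hv : c.top ≤ v), CompP (c.ext g v hv) fun δ => R δ.1 δ.2) :
    CompP c fun γ => ∀ i < g γ, R γ i :=
  (exists_lt (R := fun γ i => ¬ R γ i) hg hgp fun v hv => (hR v hv).not).not.congr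
    fun γ => by simp

end CompP

end

/-! ### Filling arrays -/

/-- The initial segment of length `n`, continued by zero. -/
def trunc (f : ℕ → ℕ) (n : ℕ) : ℕ → ℕ := fun i => if i < n then f i else 0

theorem trunc_succ (f : ℕ → ℕ) (n : ℕ) :
    Function.update (trunc f n) n (f n) = trunc f (n + 1) := by
  funext i
  by_cases h : i = n
  · subst h; simp [trunc]
  · rw [Function.update_of_ne h]
    have : i < n ↔ i < n + 1 := by omega
    simp only [trunc, this]

theorem trunc_zero (f : ℕ → ℕ) : trunc f 0 = 0 := by
  funext i; simp [trunc]

/-- Nothing is known about the registers. -/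
def Ctx.base {Γ : Type} (size : Γ → ℕ) (mem : Γ → ℕ → ℕ → ℕ) : Ctx Γ where
  size := size
  mem := mem
  top := 0
  Reg _ _ := True
  reg_congr _ _ := trivial

/-- The context while array `a` is being filled, from left to right, with `val`. -/
def Ctx.fill {Γ : Type} (size : Γ → ℕ) (mem : Γ → ℕ → ℕ → ℕ) (a : ℕ) (len : Γ → ℕ)
    (val : Γ → ℕ → ℕ) : Ctx (Σ γ, Fin (len γ)) where
  size δ := size δ.1
  mem δ := Function.update (mem δ.1) a (trunc (val δ.1) δ.2)
  top := 1
  Reg δ ρ := ρ 0 = δ.2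
  reg_congr h h' := by rw [h' 0 (by omega), h]

/-- Each entry takes polynomial time, while the number of entries may be exponential: the
superpolynomial part of the length is kept apart as `cnt` and enters the time only as a factor. The
bound `R` on the registers used is recorded so that a second program can be placed above them. -/
theorem fill_exec {Γ : Type} {size cnt : Γ → ℕ} {mem : Γ → ℕ → ℕ → ℕ} {a : ℕ} {len : Γ → ℕ}
    {val : Γ → ℕ → ℕ} (hmem : ∀ γ, mem γ a = 0) (hlen : Comp (Ctx.base size mem) len)
    (hval : Comp (Ctx.fill size mem a len val) fun δ => val δ.1 δ.2)
    (hcnt : ∃ K, ∀ γ, len γ ≤ (cnt γ + 1) * (size γ + 2) ^ K) :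
    ∃ (p : Prog) (R : ℕ) (T : Γ → ℕ), PolyBdd size T ∧ ∀ γ s, s.arr = mem γ → ∃ t s',
      Exec p s t s' ∧ s'.arr = Function.update (mem γ) a (trunc (val γ) (len γ)) ∧
      (∀ x ≥ R, s'.reg x = s.reg x) ∧ t ≤ (cnt γ + 1) * T γ := by
  obtain ⟨p, R₁, T₁, hT₁, h₁⟩ := hlen.prog 1 (by simp [Ctx.base])
  obtain ⟨q, R₂, T₂, ⟨K, hK⟩, h₂⟩ := hval.prog 3 (by simp [Ctx.fill])
  obtain ⟨L, hL⟩ := hval.bits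
  obtain ⟨M, hM⟩ := hcnt
  have hbits := hlen.bits
  simp only [Ctx.base, Ctx.fill] at hT₁ h₁ h₂ hK hL hbits
  refine ⟨.seq p (forLoop 0 (.seq q (.store a 0 3))), R₁ + R₂ + 3,
    fun γ => T₁ γ + ((size γ + 2) ^ M + 1) * (((size γ + 2) ^ K + (1 + (len γ).size +
      (size γ + 2) ^ L)) + 3 * (len γ).size + 5), ?_, fun γ s hs => ?_⟩
  · have hp : ∀ K, PolyBdd size fun γ => (size γ + 2) ^ K := fun K => ⟨K, fun _ => le_rfl⟩
    have hc := PolyBdd.const size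
    exact hT₁.add (((hp M).add (hc 1)).mul ((((hp K).add (((hc 1).add hbits).add (hp L))).add
      ((hc 3).mul hbits)).add (hc 5)))
  obtain ⟨t₁, s₁, e₁, a₁, l₁, u₁, v₁, b₁⟩ := h₁ γ s hs trivial
  let Inv : ℕ → State → Prop := fun i s' =>
    s'.arr = Function.update (mem γ) a (trunc (val γ) i) ∧
    (∀ x ≥ R₁ + R₂ + 3, s'.reg x = s.reg x)
  have hInv : ∀ i s x v, 0 ≤ x → x < 0 + 3 → Inv i s → Inv i (s.setReg x v) := by
    rintro i s' x v hx hx' ⟨i1, i2⟩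
    refine ⟨i1, fun y hy => ?_⟩
    have : y ≠ x := by omega
    simp only [State.setReg, Function.update_of_ne this, i2 y hy]
  obtain ⟨t₂, s₂, e₂, i₂, b₂⟩ := forLoop_exec (body := .seq q (.store a 0 3)) (r := 0)
    (N := len γ) (T := (size γ + 2) ^ K + (1 + (len γ).size + (size γ + 2) ^ L)) hInv (by
      rintro i hi s' ⟨i1, i2⟩ hri
      obtain ⟨t, s₂, e, a', l, u, v, b⟩ := h₂ ⟨γ, i, hi⟩ s' i1 hri
      have e₃ := Exec.store s₂ a 0 3
      rw [l 0 (by omega), hri, v] at e₃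
      refine ⟨_, _, .seq e e₃, ⟨?_, fun x hx => ?_⟩, ?_, ?_⟩
      · simp only [State.setArr]
        rw [a', i1, Function.update_self, trunc_succ, Function.update_idem]
      · simp only [State.setArr]
        rw [u x (by omega), i2 x hx]
      · intro x hx hx'
        exact l x (by omega)
      · have z1 := hK ⟨γ, i, hi⟩
        have z2 := hL ⟨γ, i, hi⟩
        have z3 : i.size ≤ (len γ).size := Nat.size_le_size hi.le
        simp only at z1 z2 b ⊢
        omega)
    (s := s₁)
    ⟨by rw [a₁, hs, trunc_zero, ← hmem γ, Function.update_eq_self],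
      fun x hx => u₁ x (by omega)⟩ v₁
  refine ⟨_, s₂, .seq e₁ e₂, i₂.1, i₂.2, ?_⟩
  have hle : len γ + 1 ≤ (cnt γ + 1) * ((size γ + 2) ^ M + 1) := by
    have := hM γ
    rw [mul_add]; omega
  calc t₁ + t₂ ≤ (cnt γ + 1) * T₁ γ + (cnt γ + 1) * ((size γ + 2) ^ M + 1) *
        ((size γ + 2) ^ K + (1 + (len γ).size + (size γ + 2) ^ L) + 3 * (len γ).size + 5) :=
      Nat.add_le_add (b₁.trans (Nat.le_mul_of_pos_left _ (by omega)))
        (b₂.trans (Nat.mul_le_mul_right _ hle))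
    _ = _ := by ring

/-- The memory after the first `i` arrays have received their contents `F`. -/
def stage {Γ : Type} (F : Γ → ℕ → ℕ → ℕ) (i : ℕ) (γ : Γ) (a : ℕ) : ℕ → ℕ :=
  if a < i then F γ a else 0

/-- In the context `c` the first `i` arrays have the contents `F`. -/
structure Knows {Γ Δ : Type} (c : Ctx Δ) (π : Δ → Γ) (F : Γ → ℕ → ℕ → ℕ) (i : ℕ) : Prop where
  mem_eq : ∀ a < i, ∀ δ, c.mem δ a = F (π δ) a
  bits : ∀ a < i, ∃ K, ∀ δ j, (F (π δ) a j).size ≤ (c.size δ + 2) ^ K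

namespace Knows

variable {Γ Δ : Type} {c : Ctx Δ} {π : Δ → Γ} {F : Γ → ℕ → ℕ → ℕ} {i : ℕ} {g : Δ → ℕ}

theorem load (h : Knows c π F i) (a : ℕ) (ha : a < i) (hg : Comp c g) :
    Comp c fun δ => F (π δ) a (g δ) :=
  hg.load (a := a) (m := fun δ => F (π δ) a) (fun δ j => by rw [h.mem_eq a ha]) (h.bits a ha)

theorem lift (h : Knows c π F i) {v : ℕ} {hv : c.top ≤ v} :
    Knows (c.ext g v hv) (fun δ => π δ.1) F i where
  mem_eq a ha δ := h.mem_eq a ha δ.1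
  bits a ha := (h.bits a ha).imp fun _ hK δ j => hK δ.1 j

end Knows

/-- A table of arrays can be computed one array after the other, each of them from left to right,
if every entry is cheap to compute from what is there already. -/
theorem fill_all {Γ : Type} {size cnt : Γ → ℕ} {F : Γ → ℕ → ℕ → ℕ} {i₀ N : ℕ}
    {len : ℕ → Γ → ℕ}
    (hbits : ∀ a < i₀, ∃ K, ∀ γ j, (F γ a j).size ≤ (size γ + 2) ^ K)
    (hzero : ∀ a, i₀ ≤ a → a < N → ∀ γ j, len a γ ≤ j → F γ a j = 0)
    (hcnt : ∀ a, i₀ ≤ a → a < N → ∃ K, ∀ γ, len a γ ≤ (cnt γ + 1) * (size γ + 2) ^ K)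
    (hlen : ∀ a, i₀ ≤ a → a < N → ∀ c : Ctx Γ, c.size = size → Knows c id F a → Comp c (len a))
    (hval : ∀ a, i₀ ≤ a → a < N → ∀ c : Ctx (Σ γ, Fin (len a γ)),
      (c.size = fun δ => size δ.1) → Knows c Sigma.fst F a →
      (∀ δ, c.mem δ a = trunc (F δ.1 a) δ.2) →
      (Comp c fun δ => (δ.2 : ℕ)) → Comp c fun δ => F δ.1 a δ.2) :
    ∀ i, i₀ ≤ i → i ≤ N → (∀ a < i, ∃ K, ∀ γ j, (F γ a j).size ≤ (size γ + 2) ^ K) ∧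
      ∃ (p : Prog) (R : ℕ) (T : Γ → ℕ), PolyBdd size T ∧ ∀ γ s, s.arr = stage F i₀ γ → ∃ t s',
        Exec p s t s' ∧ s'.arr = stage F i γ ∧
        (∀ x ≥ R, s'.reg x = s.reg x) ∧ t ≤ (cnt γ + 1) * T γ := by
  intro i hi
  induction i, hi using Nat.le_induction with
  | base =>
    intro _
    exact ⟨hbits, .skip, 0, fun _ => 1, PolyBdd.const _ _, fun γ s hs =>
      ⟨1, s, .skip s, hs, fun _ _ => rfl, by simp⟩⟩
  | succ i hi ih =>
    intro hiN
    obtain ⟨hb, p, R, T, hT, h⟩ := ih (by omega)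
    have hk : Knows (Ctx.base size (stage F i)) id F i :=
      ⟨fun a ha γ => by simp [Ctx.base, stage, ha], hb⟩
    have hl := hlen i hi (by omega) (Ctx.base size (stage F i)) rfl hk
    have hlb : PolyBdd size fun γ => (len i γ).size := hl.bits
    let c := Ctx.fill size (stage F i) i (len i) (fun γ => F γ i)
    have hv : Comp c fun δ => F δ.1 i δ.2 := by
      refine hval i hi (by omega) c rfl ⟨fun a ha δ => ?_, fun a ha => ?_⟩
        (fun δ => by simp [c, Ctx.fill]) (Comp.register (x := 0) (by simp [c, Ctx.fill])
          (fun _ _ h => h) ?_)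
      · simp [c, Ctx.fill, stage, Function.update_of_ne ha.ne, ha]
      · exact (hb a ha).imp fun K hK δ j => hK δ.1 j
      · exact (hlb.comp Sigma.fst fun _ => le_rfl).mono fun δ => Nat.size_le_size δ.2.isLt.le
    -- Inside the array the bound comes with `Comp`; beyond its length the entries vanish.
    have hbi : ∃ K, ∀ γ j, (F γ i j).size ≤ (size γ + 2) ^ K := by
      refine hv.bits.imp fun K hK γ j => ?_
      by_cases hj : j < len i γ
      · exact hK ⟨γ, j, hj⟩
      · rw [hzero i hi (by omega) γ j (not_lt.1 hj)]; simp
    obtain ⟨q, R', T', hT', h'⟩ := fill_exec (cnt := cnt) (fun γ => by simp [stage]) hl hv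
      (hcnt i hi (by omega))
    refine ⟨fun a ha => ?_, .seq p q, R + R', fun γ => T γ + T' γ, hT.add hT', fun γ s hs => ?_⟩
    · rcases Nat.lt_succ_iff_lt_or_eq.1 ha with ha | rfl
      · exact hb a ha
      · exact hbi
    · obtain ⟨t, s₁, e, a₁, u, b⟩ := h γ s hs
      obtain ⟨t', s₂, e', a₂, u', b'⟩ := h' γ s₁ a₁
      refine ⟨_, s₂, .seq e e', ?_, fun x hx => ?_, ?_⟩
      · rw [a₂]
        funext a
        by_cases ha : a = i
        · subst ha
          funext j
          simp only [Function.update_self, trunc, stage, Nat.lt_succ_self, if_true]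
          split_ifs with hj
          · rfl
          · exact (hzero a hi (by omega) γ j (by omega)).symm
        · rw [Function.update_of_ne ha]
          have : a < i ↔ a < i + 1 := by omega
          simp only [stage, this]
      · rw [u' x (by omega), u x (by omega)]
      · rw [mul_add]; omega

/-- A register holds its old value or one whose length has been paid for. -/
theorem Exec.size_reg_le {p : Prog} {s s' : State} {t : ℕ} (h : Exec p s t s') (x : ℕ) :
    (s'.reg x).size ≤ max (s.reg x).size t := by
  have hset : ∀ (s : State) (y v t : ℕ), v.size ≤ t →
      ((s.setReg y v).reg x).size ≤ max (s.reg x).size t := by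
    intro s y v t hv
    by_cases hx : x = y
    · subst hx; simp [State.setReg, hv]
    · simp [State.setReg, Function.update_of_ne hx]
  induction h with
  | skip s => simp
  | const s y c => exact hset _ _ _ _ (by omega)
  | op s o y z w => exact hset _ _ _ _ ((o.size_eval_le _ _).trans (by omega))
  | load s y a i => exact hset _ _ _ _ (by omega)
  | store s a i y => simp [State.setArr]
  | seq _ _ ih₁ ih₂ => omega
  | ite_true _ _ ih => omega
  | ite_false _ _ ih => omega
  | loop_done _ => simp
  | loop_step _ _ _ ih₁ ih₂ => omega

/-- Running an algorithm on an instance that has been computed from the input. -/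
theorem decides_of_fill {Γ : Type} {size cnt : Γ → ℕ} {F : Γ → ℕ → ℕ → ℕ} {i₀ N A : ℕ}
    {input enc : Γ → List (List ℕ)} (hinput : ∀ γ, (input γ).length ≤ i₀)
    (hF : ∀ γ, ∀ a < i₀, ∀ j, F γ a j = ((input γ).getD a []).getD j 0)
    (henc : ∀ γ, (enc γ).length + A ≤ N)
    (hFe : ∀ γ, ∀ a, A + a < N → ∀ j, F γ (A + a) j = ((enc γ).getD a []).getD j 0)
    (hfill : ∃ (p : Prog) (R : ℕ) (T : Γ → ℕ), PolyBdd size T ∧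
      ∀ γ s, s.arr = stage F i₀ γ → ∃ t s', Exec p s t s' ∧ s'.arr = stage F N γ ∧
        (∀ x ≥ R, s'.reg x = s.reg x) ∧ t ≤ (cnt γ + 1) * T γ) (q : Prog) :
    ∃ (p : Prog) (K : ℕ), ∀ γ ans (bound : ℝ), Decides q (enc γ) ans bound →
      Decides p (input γ) ans
        (((cnt γ : ℝ) + 1) * ((size γ : ℝ) + 2) ^ K + 2 * bound + 3) := by
  obtain ⟨p, R, T, ⟨K, hK⟩, h⟩ := hfill
  -- The given algorithm is moved above the registers used by `p`, where everything is still zero,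
  -- and onto the arrays that hold its computed input. The conditional transfers its verdict to
  -- register `0`.
  refine ⟨.seq p (.seq (q.shift (R + 1) A) (.ite (R + 1) (.const 0 1) (.const 0 0))), K,
    fun γ ans bound hq => ?_⟩
  obtain ⟨t₂, s₂, e₂, b₂, ans₂⟩ := hq
  obtain ⟨t₁, s₁, e₁, a₁, u₁, b₁⟩ := h γ (initState (input γ)) (by
    funext a j
    simp only [initState, stage]
    split_ifs with ha
    · exact (hF γ a ha j).symm
    · rw [List.getD_eq_default _ _ ((hinput γ).trans (by omega))]; simp)
  obtain ⟨u, eu, hu⟩ := e₂.shift s₁ (R := R + 1) (A := A) ⟨fun x => by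
      rw [u₁ _ (by omega)]; rfl, fun a => by
      rw [a₁]
      funext j
      simp only [initState, stage]
      split_ifs with ha
      · exact hFe γ a ha j
      · have := henc γ
        rw [List.getD_eq_default (enc γ) _ (by omega)]; simp⟩
  -- Testing the verdict costs its length, which the run that produced it has already paid for;
  -- hence the factor two in the bound.
  have hsz : (u.reg (R + 1)).size ≤ t₂ := by
    have h1 := e₂.size_reg_le 0
    have h2 := hu.1 0
    rw [add_zero] at h2
    rw [h2]
    simpa [initState] using h1
  have hreg : u.reg (R + 1) = s₂.reg 0 := hu.1 0
  have hbound : (t₁ : ℝ) ≤ ((cnt γ : ℝ) + 1) * ((size γ : ℝ) + 2) ^ K := by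
    have : t₁ ≤ (cnt γ + 1) * (size γ + 2) ^ K := b₁.trans (Nat.mul_le_mul_left _ (hK γ))
    exact_mod_cast this
  have hsz' : ((u.reg (R + 1)).size : ℝ) ≤ t₂ := by exact_mod_cast hsz
  by_cases h0 : u.reg (R + 1) = 0
  · refine ⟨_, _, .seq e₁ (.seq eu (.ite_false h0 (.const u 0 0))), ?_, ?_⟩
    · push_cast [Nat.size_zero]
      linarith
    · rw [← ans₂, ← hreg, h0]; simp [State.setReg]
  · refine ⟨_, _, .seq e₁ (.seq eu (.ite_true h0 (.const u 0 1))), ?_, ?_⟩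
    · push_cast [Nat.size_one]
      linarith
    · rw [← ans₂, ← hreg]; simp [State.setReg, h0]

end RAM

namespace Reconf

section Reachable

variable {V : Type*} [DecidableEq V] {G : SimpleGraph V} {A B C : Finset V}

theorem TokenJump.card_eq (h : TokenJump G A B) : B.card = A.card := by
  obtain ⟨-, u, hu, v, hv, rfl⟩ := h
  rw [Finset.card_insert_of_notMem fun h => hv (Finset.mem_of_mem_erase h),
    Finset.card_erase_add_one hu]

end Reachable

/-! ### A graph that runs through a sequence of states

`K` data tokens hold the pieces of a state of a layered system; a helper token holds a copy of the
piece that moves next. -/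

/-- The parameters of a layered system: `K` pieces with values below `W`, and layers `0, …, Q`. -/
structure Layered where
  K : ℕ
  W : ℕ
  Q : ℕ
  K_pos : 0 < K
  W_pos : 0 < W
  /-- `keep q g b q' a`: the copy `b` of piece `g` in layer `q` agrees with the value `a` of that
  piece in layer `q'`. -/
  keep : ℕ → ℕ → ℕ → ℕ → ℕ → Prop
  /-- `check q z g a`: the value `a` of piece `g` in layer `q` is compatible with the choice `z`. -/
  check : ℕ → ℕ → ℕ → ℕ → Prop
  keep_zero : ∀ g b q a, keep 0 g b q a
  keep_last : ∀ g b q a, keep Q g b q a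
  check_zero : ∀ z g a, check 0 z g a
  check_last : ∀ z g a, check Q z g a

namespace Layered

variable (L : Layered)

/-- The number of vertices. -/
def N : ℕ := (L.Q + 1) * L.K * L.W * 4

/-- The number of a vertex has mixed-radix digits: layer `vq`, piece `vg`, value `va` and kind `vz`.
Kind `3` marks data vertices; kinds `0`, `1`, `2` are helper vertices carrying a choice of a
literal. -/
def vz (u : ℕ) : ℕ := u % 4
def va (u : ℕ) : ℕ := u / 4 % L.W
def vg (u : ℕ) : ℕ := u / 4 / L.W % L.K
def vq (u : ℕ) : ℕ := u / 4 / L.W / L.K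

def enc (q g a z : ℕ) : ℕ := ((q * L.K + g) * L.W + a) * 4 + z

/-- The helper at `u` tolerates the data token at `v`. -/
def compat (u v : ℕ) : Prop :=
  (L.vg v < L.vg u → L.vq v = L.vq u + 1) ∧ (L.vg u < L.vg v → L.vq v = L.vq u) ∧
  (L.vg v = L.vg u → (L.vq v = L.vq u ∨ L.vq v = L.vq u + 1) ∧
    L.keep (L.vq u) (L.vg u) (L.va u) (L.vq v) (L.va v)) ∧
  (L.vg u = 0 → L.vq v = L.vq u → L.check (L.vq u) (vz u) (L.vg v) (L.va v))

/-- The helper vertices form a clique, and so do the data vertices of each piece. These `K + 1`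
cliques cover the graph, so an independent set of `K + 1` tokens meets each of them once. The last
case encodes the tolerance of the helper; `graph` symmetrizes the relation. -/
def conf (u v : ℕ) : Prop :=
  (vz u < 3 ∧ vz v < 3) ∨ (¬ vz u < 3 ∧ ¬ vz v < 3 ∧ L.vg u = L.vg v) ∨
    (vz u < 3 ∧ ¬ vz v < 3 ∧ ¬ L.compat u v)

def graph : SimpleGraph (Fin L.N) where
  Adj u v := u ≠ v ∧ (L.conf u v ∨ L.conf v u)
  symm := ⟨fun _ _ h => ⟨h.1.symm, h.2.symm⟩⟩
  loopless := ⟨fun _ h => h.1 rfl⟩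

variable {L}

theorem vz_enc {q g a z : ℕ} (hz : z < 4) : vz (L.enc q g a z) = z := by
  simp only [vz, enc]; omega

theorem enc_div {q g a z : ℕ} (hz : z < 4) : L.enc q g a z / 4 = (q * L.K + g) * L.W + a := by
  simp only [enc]; omega

theorem va_enc {q g a z : ℕ} (hz : z < 4) (ha : a < L.W) : L.va (L.enc q g a z) = a := by
  simp only [va, enc_div hz]
  rw [Nat.mul_add_mod', Nat.mod_eq_of_lt ha]

theorem enc_div_div {q g a z : ℕ} (hz : z < 4) (ha : a < L.W) :
    L.enc q g a z / 4 / L.W = q * L.K + g := by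
  rw [enc_div hz, Nat.add_comm, Nat.add_mul_div_right _ _ L.W_pos, Nat.div_eq_of_lt ha, zero_add]

theorem vg_enc {q g a z : ℕ} (hz : z < 4) (ha : a < L.W) (hg : g < L.K) :
    L.vg (L.enc q g a z) = g := by
  simp only [vg, enc_div_div hz ha]
  rw [Nat.mul_add_mod', Nat.mod_eq_of_lt hg]

theorem vq_enc {q g a z : ℕ} (hz : z < 4) (ha : a < L.W) (hg : g < L.K) :
    L.vq (L.enc q g a z) = q := by
  simp only [vq, enc_div_div hz ha]
  rw [Nat.add_comm, Nat.add_mul_div_right _ _ L.K_pos, Nat.div_eq_of_lt hg, zero_add]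

theorem enc_lt {q g a z : ℕ} (hz : z < 4) (ha : a < L.W) (hg : g < L.K) (hq : q ≤ L.Q) :
    L.enc q g a z < L.N := by
  have h1 : q * L.K + g + 1 ≤ (L.Q + 1) * L.K := by
    have := Nat.mul_le_mul_right L.K hq
    rw [add_mul]; omega
  have h2 := Nat.mul_le_mul_right L.W h1
  rw [add_mul] at h2
  simp only [enc, N]
  omega

theorem va_lt (u : ℕ) : L.va u < L.W := Nat.mod_lt _ L.W_pos

theorem vg_lt (u : ℕ) : L.vg u < L.K := Nat.mod_lt _ L.K_pos

theorem N_pos : 0 < L.N := by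
  have := L.K_pos
  have := L.W_pos
  simp only [N]; positivity

variable (L)

/-- The vertex with a given number. -/
def vtx (u : ℕ) : Fin L.N := ⟨u % L.N, Nat.mod_lt _ L.N_pos⟩

/-- The positions of all tokens: data tokens `0, …, K - 1`, and the helper as token `K`. -/
def confSet (f : ℕ → ℕ) : Finset (Fin L.N) :=
  (Finset.range (L.K + 1)).image fun c => L.vtx (f c)

/-- `f` places all tokens on vertices of the right kinds, and the helper tolerates the rest. -/
structure Good (f : ℕ → ℕ) : Prop where
  lt : ∀ c ≤ L.K, f c < L.N
  data : ∀ c < L.K, vz (f c) = 3 ∧ L.vg (f c) = c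
  helper : vz (f L.K) < 3
  compat : ∀ c < L.K, L.compat (f L.K) (f c)

variable {L}

theorem vtx_val {u : ℕ} (hu : u < L.N) : (L.vtx u : ℕ) = u := Nat.mod_eq_of_lt hu

theorem Good.ne {f f' : ℕ → ℕ} (h : L.Good f) (h' : L.Good f') {c c' : ℕ} (hc : c ≤ L.K)
    (hc' : c' ≤ L.K) (hne : c ≠ c') : f c ≠ f' c' := by
  intro he
  rcases hc.lt_or_eq with h1 | rfl
  · have d := h.data c h1
    rcases hc'.lt_or_eq with h2 | rfl
    · have d' := h'.data c' h2
      rw [he] at d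
      exact hne (d.2.symm.trans d'.2)
    · have := h'.helper
      rw [he] at d; omega
  · have d' := h'.data c' (by omega)
    have := h.helper
    rw [← he] at d'; omega

theorem Good.vtx_inj {f f' : ℕ → ℕ} (h : L.Good f) (h' : L.Good f') {c c' : ℕ} (hc : c ≤ L.K)
    (hc' : c' ≤ L.K) (he : L.vtx (f c) = L.vtx (f' c')) : f c = f' c' := by
  have := congrArg Fin.val he
  rwa [vtx_val (h.lt c hc), vtx_val (h'.lt c' hc')] at this

theorem Good.card {f : ℕ → ℕ} (h : L.Good f) : (L.confSet f).card = L.K + 1 := by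
  rw [confSet, Finset.card_image_of_injOn, Finset.card_range]
  intro c hc c' hc' he
  have hc := Finset.mem_range.1 (Finset.mem_coe.1 hc)
  have hc' := Finset.mem_range.1 (Finset.mem_coe.1 hc')
  by_contra hne
  exact h.ne h (by omega) (by omega) hne (h.vtx_inj h (by omega) (by omega) he)

theorem Good.indep {f : ℕ → ℕ} (h : L.Good f) :
    L.graph.IsIndepSet (L.confSet f : Set (Fin L.N)) := by
  have key : ∀ c c', c ≤ L.K → c' ≤ L.K → c ≠ c' → ¬ L.conf (f c) (f c') := by
    intro c c' hc hc' hne hconf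
    rcases hconf with ⟨h1, h2⟩ | ⟨h1, h2, h3⟩ | ⟨h1, h2, h3⟩
    · rcases hc.lt_or_eq with hlt | rfl
      · have := (h.data c hlt).1; omega
      · have := (h.data c' (by omega)).1; omega
    · rcases hc.lt_or_eq with hlt | rfl
      · rcases hc'.lt_or_eq with hlt' | rfl
        · rw [(h.data c hlt).2, (h.data c' hlt').2] at h3; exact hne h3
        · exact h2 h.helper
      · exact h1 h.helper
    · rcases hc.lt_or_eq with hlt | rfl
      · have := (h.data c hlt).1; omega
      · exact h3 (h.compat c' (by omega))
  intro u hu v hv huv hadj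
  obtain ⟨c, hc, rfl⟩ := Finset.mem_image.1 (Finset.mem_coe.1 hu)
  obtain ⟨c', hc', rfl⟩ := Finset.mem_image.1 (Finset.mem_coe.1 hv)
  have hc := Finset.mem_range.1 hc
  have hc' := Finset.mem_range.1 hc'
  have hne : c ≠ c' := by rintro rfl; exact huv rfl
  obtain ⟨-, hadj⟩ := hadj
  rw [vtx_val (h.lt c (by omega)), vtx_val (h.lt c' (by omega))] at hadj
  exact hadj.elim (key c c' (by omega) (by omega) hne) (key c' c (by omega) (by omega) hne.symm)

theorem Good.tokenJump {f f' : ℕ → ℕ} (h : L.Good f) (h' : L.Good f') {c₀ : ℕ} (hc₀ : c₀ ≤ L.K)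
    (hne : f c₀ ≠ f' c₀) (heq : ∀ c ≤ L.K, c ≠ c₀ → f' c = f c) :
    TokenJump L.graph (L.confSet f) (L.confSet f') := by
  have hmem : ∀ f c, c ≤ L.K → L.vtx (f c) ∈ L.confSet f := fun f c hc =>
    Finset.mem_image.2 ⟨c, Finset.mem_range.2 (by omega), rfl⟩
  refine ⟨h'.indep, L.vtx (f c₀), hmem f c₀ hc₀, L.vtx (f' c₀), fun hm => ?_, ?_⟩
  · obtain ⟨c, hc, he⟩ := Finset.mem_image.1 hm
    have hc := Finset.mem_range.1 hc
    have he := h.vtx_inj h' (by omega) hc₀ he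
    by_cases hcc : c = c₀
    · subst hcc; exact hne he
    · exact h.ne h' (by omega) hc₀ hcc he
  · ext u
    simp only [Finset.mem_insert, Finset.mem_erase]
    constructor
    · intro hu
      obtain ⟨c, hc, rfl⟩ := Finset.mem_image.1 hu
      have hc := Finset.mem_range.1 hc
      by_cases hcc : c = c₀
      · subst hcc; exact Or.inl rfl
      · rw [heq c (by omega) hcc]
        exact Or.inr ⟨fun he => h.ne h (by omega) hc₀ hcc (h.vtx_inj h (by omega) hc₀ he),
          hmem f c (by omega)⟩
    · rintro (rfl | ⟨hu, hm⟩)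
      · exact hmem f' c₀ hc₀
      · obtain ⟨c, hc, rfl⟩ := Finset.mem_image.1 hm
        have hc := Finset.mem_range.1 hc
        have hcc : c ≠ c₀ := by rintro rfl; exact hu rfl
        rw [← heq c (by omega) hcc]
        exact hmem f' c (by omega)

/-- The level of piece `g` after `D` moves of data tokens. -/
def level (L : Layered) (D g : ℕ) : ℕ := (D + L.K - 1 - g) / L.K

theorem level_eq {D g q : ℕ} (h₁ : q * L.K ≤ D + L.K - 1 - g)
    (h₂ : D + L.K - 1 - g < q * L.K + L.K) : L.level D g = q :=
  Nat.div_eq_of_lt_le h₁ (by rw [add_mul]; omega)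

/-- After `q` full rounds and `y` further moves, exactly the first `y` pieces are one layer ahead.
-/
theorem level_mul_add {q y g : ℕ} (hy : y ≤ L.K) (hg : g < L.K) :
    L.level (q * L.K + y) g = if g < y then q + 1 else q := by
  split_ifs with h
  · exact level_eq (by rw [add_mul]; omega) (by rw [add_mul]; omega)
  · exact level_eq (by omega) (by omega)

/-- Both end points of the reconfiguration sequence. -/
def restConf (L : Layered) (q c : ℕ) : ℕ := if c < L.K then L.enc q c 0 3 else L.enc q 0 0 0

theorem restConf_good {q : ℕ} (hq : q = 0 ∨ q = L.Q) : L.Good (L.restConf q) := by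
  have hW := L.W_pos
  have hK := L.K_pos
  have hle : q ≤ L.Q := by omega
  refine ⟨fun c _ => ?_, fun c hc => ?_, ?_, fun c hc => ?_⟩
  · by_cases hc : c < L.K
    · simp only [restConf, hc, if_true]; exact enc_lt (by omega) hW hc hle
    · simp only [restConf, hc, if_false]; exact enc_lt (by omega) hW hK hle
  · simp only [restConf, hc, if_true]
    exact ⟨vz_enc (by omega), vg_enc (by omega) hW hc⟩
  · simp only [restConf, lt_irrefl, if_false]
    rw [vz_enc (by omega)]; omega
  · simp only [restConf, lt_irrefl, if_false, hc, if_true, Layered.compat]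
    rw [vg_enc (by omega) hW hc, vg_enc (by omega) hW hK, vq_enc (by omega) hW hc,
      vq_enc (by omega) hW hK, va_enc (by omega) hW, va_enc (by omega) hW, vz_enc (by omega)]
    refine ⟨fun h => by omega, fun _ => rfl, fun _ => ⟨Or.inl rfl, ?_⟩, fun _ _ => ?_⟩
    · rcases hq with rfl | rfl
      · exact L.keep_zero _ _ _ _
      · exact L.keep_last _ _ _ _
    · rcases hq with rfl | rfl
      · exact L.check_zero _ _ _
      · exact L.check_last _ _ _

/-- The reconfiguration instance of a layered system. -/
def inst (L : Layered) : Instance (L.K + 1) where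
  n := L.N
  graph := L.graph
  source := L.confSet (L.restConf 0)
  target := L.confSet (L.restConf L.Q)
  card_source := (restConf_good (Or.inl rfl)).card
  card_target := (restConf_good (Or.inr rfl)).card
  indep_source := (restConf_good (Or.inl rfl)).indep
  indep_target := (restConf_good (Or.inr rfl)).indep
  len := 2 * (L.Q * L.K)

/-- A run of the layered system from the zero state to the zero state. -/
def Run (L : Layered) : Prop :=
  ∃ α b : ℕ → ℕ → ℕ, ∃ z : ℕ → ℕ, (∀ q g, α q g < L.W) ∧ (∀ q g, b q g < L.W) ∧
    (∀ q, z q < 3) ∧ (∀ g, α 0 g = 0) ∧ (∀ g, α L.Q g = 0) ∧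
    (∀ q < L.Q, ∀ g < L.K, L.keep q g (b q g) q (α q g) ∧
      L.keep q g (b q g) (q + 1) (α (q + 1) g)) ∧
    ∀ q < L.Q, ∀ g < L.K, L.check q (z q) g (α q g)

/-- With the helper at layer `q` and piece `g`, data token `g` may pass to layer `q + 1`, since the
copy agrees with its old and its new value; then the helper proceeds to the next piece, or to piece
`0` of the next layer. This takes two moves per layer and piece. -/
theorem answer_of_run (h : L.Run) : L.inst.Answer := by
  obtain ⟨α, b₀, z₀, hα, hb₀, hz₀, hα0, hαQ, hkeep₀, hcheck₀⟩ := h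
  have hW := L.W_pos
  have hK := L.K_pos
  -- The rest positions have a zero helper, so copies and choices in layers `0` and `Q` are
  -- overwritten by zero; all conditions are void there. This also supplies the conditions in layer
  -- `Q`, about which a run says nothing.
  obtain ⟨b, z, hb, hz, hb0, hbQ, hz0, hzQ, hkeep, hcheck⟩ : ∃ b : ℕ → ℕ → ℕ, ∃ z : ℕ → ℕ,
      (∀ q g, b q g < L.W) ∧ (∀ q, z q < 3) ∧ (∀ g, b 0 g = 0) ∧ (∀ g, b L.Q g = 0) ∧
      z 0 = 0 ∧ z L.Q = 0 ∧ (∀ q ≤ L.Q, ∀ g < L.K, L.keep q g (b q g) q (α q g) ∧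
      L.keep q g (b q g) (q + 1) (α (q + 1) g)) ∧
      ∀ q ≤ L.Q, ∀ g < L.K, L.check q (z q) g (α q g) := by
    refine ⟨fun q g => if q = 0 ∨ q = L.Q then 0 else b₀ q g,
      fun q => if q = 0 ∨ q = L.Q then 0 else z₀ q, fun q g => ?_, fun q => ?_, fun g => by simp,
      fun g => by simp, by simp, by simp, fun q hq g hg => ?_, fun q hq g hg => ?_⟩
    · beta_reduce
      split_ifs
      exacts [hW, hb₀ q g]
    · beta_reduce
      split_ifs
      exacts [by omega, hz₀ q]
    · by_cases h : q = 0 ∨ q = L.Q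
      · rcases h with rfl | rfl
        · exact ⟨L.keep_zero _ _ _ _, L.keep_zero _ _ _ _⟩
        · exact ⟨L.keep_last _ _ _ _, L.keep_last _ _ _ _⟩
      · simp only [h, if_false]
        exact hkeep₀ q (by omega) g hg
    · by_cases h : q = 0 ∨ q = L.Q
      · rcases h with rfl | rfl
        · exact L.check_zero _ _ _
        · exact L.check_last _ _ _
      · simp only [h, if_false]
        exact hcheck₀ q (by omega) g hg
  -- Data tokens move first: after `i` moves there have been `(i + 1) / 2` data moves and `i / 2`
  -- helper moves.
  let hv : ℕ → ℕ := fun x => L.enc (x / L.K) (x % L.K) (b (x / L.K) (x % L.K)) (z (x / L.K))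
  let dv : ℕ → ℕ → ℕ := fun D g => L.enc (L.level D g) g (α (L.level D g) g) 3
  let pos : ℕ → ℕ → ℕ := fun i c => if c < L.K then dv ((i + 1) / 2) c else hv (i / 2)
  have hgood : ∀ i ≤ 2 * (L.Q * L.K), L.Good (pos i) := by
    intro i hi
    have hlev : ∀ c < L.K, L.level ((i + 1) / 2) c ≤ L.Q := by
      intro c hc
      refine Nat.le_of_lt_succ ((Nat.div_lt_iff_lt_mul hK).2 ?_)
      rw [Nat.succ_mul]; omega
    have hdiv : i / 2 / L.K ≤ L.Q := by
      refine Nat.div_le_of_le_mul ?_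
      rw [mul_comm]; omega
    have hmod := Nat.mod_lt (i / 2) hK
    have hz' := hz (i / 2 / L.K)
    refine ⟨fun c _ => ?_, fun c hc => ?_, ?_, fun c hc => ?_⟩
    · by_cases hc : c < L.K
      · simp only [pos, hc, if_true]; exact enc_lt (by omega) (hα _ _) hc (hlev c hc)
      · simp only [pos, hc, if_false]; exact enc_lt (by omega) (hb _ _) hmod hdiv
    · simp only [pos, hc, if_true]
      exact ⟨vz_enc (by omega), vg_enc (by omega) (hα _ _) hc⟩
    · simp only [pos, lt_irrefl, if_false, hv]
      rw [vz_enc (by omega)]; exact hz'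
    · simp only [pos, lt_irrefl, if_false, hc, if_true, Layered.compat, dv, hv]
      rw [vg_enc (by omega) (hα _ _) hc, vg_enc (by omega) (hb _ _) hmod,
        vq_enc (by omega) (hα _ _) hc, vq_enc (by omega) (hb _ _) hmod,
        va_enc (by omega) (hα _ _), va_enc (by omega) (hb _ _), vz_enc (by omega)]
      have hx := Nat.div_add_mod' (i / 2) L.K
      -- The number `e` tells whether the piece at the helper has already moved.
      obtain ⟨e, he, he'⟩ : ∃ e ≤ 1, (i + 1) / 2 = i / 2 / L.K * L.K + (i / 2 % L.K + e) :=
        ⟨(i + 1) / 2 - i / 2, by omega, by omega⟩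
      rw [he', level_mul_add (by omega) hc]
      generalize i / 2 / L.K = q at *
      generalize i / 2 % L.K = g at *
      have hk := hkeep q hdiv g hmod
      refine ⟨fun h => if_pos (by omega), fun h => if_neg (by omega), fun h => ?_, fun h h' => ?_⟩
      · subst h
        split_ifs
        · exact ⟨Or.inr rfl, hk.2⟩
        · exact ⟨Or.inl rfl, hk.1⟩
      · rw [h']
        exact hcheck q hdiv c hc
  have hset : ∀ f f' : ℕ → ℕ, (∀ c ≤ L.K, f c = f' c) → L.confSet f = L.confSet f' := by
    intro f f' h
    refine Finset.image_congr fun c hc => ?_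
    have := Finset.mem_range.1 (Finset.mem_coe.1 hc)
    simp only [h c (by omega)]
  refine ⟨2 * (L.Q * L.K), le_rfl, fun i => L.confSet (pos i), ?_, ?_, fun i hi => ?_⟩
  · refine hset _ _ fun c _ => ?_
    by_cases hc : c < L.K
    · have : L.level 0 c = 0 := level_eq (by omega) (by omega)
      simp [pos, dv, restConf, hc, this, hα0]
    · simp [pos, hv, restConf, hc, hb0, hz0]
  · refine hset _ _ fun c _ => ?_
    have e1 : (2 * (L.Q * L.K) + 1) / 2 = L.Q * L.K := by omega
    have e2 : 2 * (L.Q * L.K) / 2 = L.Q * L.K := by omega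
    by_cases hc : c < L.K
    · have : L.level (L.Q * L.K) c = L.Q := level_eq (by omega) (by omega)
      simp [pos, dv, restConf, hc, this, hαQ, e1]
    · simp [pos, hv, restConf, hc, hbQ, hzQ, e2, Nat.mul_div_cancel _ hK]
  · have g₁ := hgood i (by omega)
    have g₂ := hgood (i + 1) (by omega)
    rcases Nat.even_or_odd' i with ⟨x, rfl | rfl⟩
    · have e1 : (2 * x + 1) / 2 = x := by omega
      have e2 : (2 * x + 1 + 1) / 2 = x + 1 := by omega
      have e3 : 2 * x / 2 = x := by omega
      have hmod := Nat.mod_lt x hK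
      have hx := Nat.div_add_mod' x L.K
      refine g₁.tokenJump g₂ (c₀ := x % L.K) hmod.le ?_ fun c hc hne => ?_
      · simp only [pos, hmod, if_true, e1, e2, dv]
        intro he
        have := congrArg L.vq he
        rw [vq_enc (by omega) (hα _ _) hmod, vq_enc (by omega) (hα _ _) hmod] at this
        have l1 := level_mul_add (L := L) (q := x / L.K) (y := x % L.K) (g := x % L.K) (by omega)
          hmod
        have l2 := level_mul_add (L := L) (q := x / L.K) (y := x % L.K + 1) (g := x % L.K)
          (by omega) hmod
        rw [← add_assoc, hx] at l2
        rw [hx] at l1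
        rw [l1, l2] at this
        simp at this
      · by_cases hcK : c < L.K
        · have l1 := level_mul_add (L := L) (q := x / L.K) (y := x % L.K) (g := c) (by omega)
            hcK
          have l2 := level_mul_add (L := L) (q := x / L.K) (y := x % L.K + 1) (g := c)
            (by omega) hcK
          rw [← add_assoc, hx] at l2
          rw [hx] at l1
          have : L.level (x + 1) c = L.level x c := by
            rw [l1, l2]
            have : c < x % L.K + 1 ↔ c < x % L.K := by omega
            simp only [this]
          simp only [pos, hcK, if_true, e1, e2, dv, this]
        · simp only [pos, hcK, if_false, e1, e3]
    · have e1 : (2 * x + 1 + 1) / 2 = x + 1 := by omega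
      have e2 : (2 * x + 1 + 1 + 1) / 2 = x + 1 := by omega
      have e3 : (2 * x + 1) / 2 = x := by omega
      refine g₁.tokenJump g₂ (c₀ := L.K) le_rfl ?_ fun c hc hne => ?_
      · simp only [pos, lt_irrefl, if_false, e1, e3, hv]
        intro he
        have z1 := hz (x / L.K)
        have z2 := hz ((x + 1) / L.K)
        have h1 := congrArg L.vq he
        have h2 := congrArg L.vg he
        rw [vq_enc (by omega) (hb _ _) (Nat.mod_lt _ hK),
          vq_enc (by omega) (hb _ _) (Nat.mod_lt _ hK)] at h1
        rw [vg_enc (by omega) (hb _ _) (Nat.mod_lt _ hK),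
          vg_enc (by omega) (hb _ _) (Nat.mod_lt _ hK)] at h2
        have h3 := Nat.div_add_mod' x L.K
        have h4 := Nat.div_add_mod' (x + 1) L.K
        rw [← h1, ← h2] at h4
        omega
      · have hcK : c < L.K := by omega
        simp only [pos, hcK, if_true, e1, e2]

end Layered

end Reconf

/-! ### From a reconfiguration sequence back to a run. -/

namespace Reconf

namespace Layered

variable {L : Layered}

/-- The token that a vertex belongs to. -/
def tok (L : Layered) (u : ℕ) : ℕ := if vz u < 3 then L.K else L.vg u

theorem tok_le (u : ℕ) : L.tok u ≤ L.K := by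
  have := L.vg_lt u
  simp only [tok]; split_ifs <;> omega

theorem conf_of_tok_eq {u v : ℕ} (h : L.tok u = L.tok v) : L.conf u v := by
  have h1 := L.vg_lt u
  have h2 := L.vg_lt v
  simp only [tok] at h
  split_ifs at h with hu hv hv
  · exact Or.inl ⟨hu, hv⟩
  · omega
  · omega
  · exact Or.inr (Or.inl ⟨hu, hv, h⟩)

/-- Pigeonhole: `tok` is injective on an independent set, because vertices with equal `tok` are in
conflict, and there are as many tokens as classes. -/
theorem exists_token {A : Finset (Fin L.N)} (hA : L.graph.IsIndepSet (A : Set (Fin L.N)))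
    (hcard : A.card = L.K + 1) {c : ℕ} (hc : c ≤ L.K) : ∃ u ∈ A, L.tok u = c := by
  have hinj : Set.InjOn (fun u : Fin L.N => L.tok u) A := by
    intro u hu v hv h
    by_contra hne
    exact hA hu hv hne ⟨hne, Or.inl (conf_of_tok_eq h)⟩
  have himg : A.image (fun u : Fin L.N => L.tok u) = Finset.range (L.K + 1) := by
    refine Finset.eq_of_subset_of_card_le (fun x hx => ?_) ?_
    · obtain ⟨u, -, rfl⟩ := Finset.mem_image.1 hx
      exact Finset.mem_range.2 (Nat.lt_succ_of_le (L.tok_le u))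
    · rw [Finset.card_image_of_injOn hinj, hcard, Finset.card_range]
  have : c ∈ A.image (fun u : Fin L.N => L.tok u) := by
    rw [himg]; exact Finset.mem_range.2 (by omega)
  exact Finset.mem_image.1 this

/-- In a sequence of `2 * Q * K` moves between the rest positions the moves alternate between the
data tokens, which move cyclically from layer to layer, and the helper. -/
theorem positions_of_answer (h : L.inst.Answer) : ∃ d : ℕ → ℕ → ℕ,
    (∀ c < L.K, d 0 c = L.restConf 0 c) ∧
    (∀ c < L.K, d (2 * (L.Q * L.K)) c = L.restConf L.Q c) ∧
    (∀ i ≤ 2 * (L.Q * L.K), vz (d i L.K) < 3 ∧ (∀ c < L.K, L.vg (d i c) = c) ∧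
      (∀ c < L.K, L.compat (d i L.K) (d i c)) ∧
      L.vq (d i L.K) * L.K + L.vg (d i L.K) = i / 2 ∧
      ∀ c < L.K, L.vq (d i c) = L.level ((i + 1) / 2) c) ∧
    ∀ x < L.Q * L.K, d (2 * x + 1) L.K = d (2 * x) L.K ∧
      (∀ c < L.K, c ≠ x % L.K → d (2 * x + 1) c = d (2 * x) c) ∧
      ∀ c < L.K, d (2 * x + 2) c = d (2 * x + 1) c := by
  have hK := L.K_pos
  have hW := L.W_pos
  have hreach : Reachable L.graph (L.confSet (L.restConf 0)) (L.confSet (L.restConf L.Q))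
    (2 * (L.Q * L.K)) := h
  obtain ⟨r, hr, A, hA0, hAr, hstep⟩ := hreach
  have hprop : ∀ i ≤ r, L.graph.IsIndepSet (A i : Set (Fin L.N)) ∧ (A i).card = L.K + 1 := by
    intro i hi
    induction i with
    | zero =>
      rw [hA0]
      exact ⟨(restConf_good (Or.inl rfl)).indep, (restConf_good (Or.inl rfl)).card⟩
    | succ i ih =>
      exact ⟨(hstep i (by omega)).1, by rw [(hstep i (by omega)).card_eq, (ih (by omega)).2]⟩
  have hex : ∀ i c, ∃ u : Fin L.N, i ≤ r → c ≤ L.K → u ∈ A i ∧ L.tok u = c := by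
    intro i c
    by_cases h : i ≤ r ∧ c ≤ L.K
    · obtain ⟨u, hu, hc⟩ := exists_token (hprop i h.1).1 (hprop i h.1).2 h.2
      exact ⟨u, fun _ _ => ⟨hu, hc⟩⟩
    · exact ⟨⟨0, L.N_pos⟩, fun h1 h2 => absurd ⟨h1, h2⟩ h⟩
  choose e he using hex
  have huniq : ∀ i ≤ r, ∀ u ∈ A i, u = e i (L.tok u) := by
    intro i hi u hu
    obtain ⟨h1, h2⟩ := he i (L.tok u) hi (L.tok_le u)
    by_contra hne
    exact (hprop i hi).1 hu h1 hne ⟨hne, Or.inl (conf_of_tok_eq h2.symm)⟩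
  have htok_data : ∀ u c, c < L.K → L.tok u = c → ¬ vz u < 3 ∧ L.vg u = c := by
    intro u c hc ht
    simp only [tok] at ht
    split_ifs at ht with h
    · omega
    · exact ⟨h, ht⟩
  have htok_helper : ∀ u, L.tok u = L.K → vz u < 3 := by
    intro u ht
    by_contra h
    have := L.vg_lt u
    simp only [tok, h, if_false] at ht
    omega
  have hcompat : ∀ i ≤ r, ∀ c < L.K, L.compat (e i L.K) (e i c) := by
    intro i hi c hc
    obtain ⟨h1, h2⟩ := he i L.K hi le_rfl
    obtain ⟨h3, h4⟩ := he i c hi hc.le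
    by_contra hnc
    have hne : e i L.K ≠ e i c := by intro h; rw [h, h4] at h2; omega
    exact (hprop i hi).1 h1 h3 hne ⟨hne, Or.inl (Or.inr (Or.inr
      ⟨htok_helper _ h2, (htok_data _ c hc h4).1, hnc⟩))⟩
  have hvg : ∀ i ≤ r, ∀ c < L.K, L.vg (e i c) = c := fun i hi c hc =>
    (htok_data _ c hc (he i c hi hc.le).2).2
  -- the numbers of moves
  let τ : ℕ → ℕ := fun i => L.vq (e i L.K) * L.K + L.vg (e i L.K)
  -- The helper dictates the layer of every data token except that of its own piece, which has two
  -- options. So the layers are those after `τ i` or `τ i + 1` cyclic moves.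
  have hD : ∀ i, ∃ D, i ≤ r → (D = τ i ∨ D = τ i + 1) ∧
      ∀ c < L.K, L.vq (e i c) = L.level D c := by
    intro i
    by_cases hi : i ≤ r
    · have hg := L.vg_lt (e i L.K)
      have hg0 := hvg i hi _ hg
      rcases ((hcompat i hi _ hg).2.2.1 hg0).1 with h | h
      · refine ⟨τ i, fun _ => ⟨Or.inl rfl, fun c hc => ?_⟩⟩
        have hc1 := hcompat i hi c hc
        simp only [τ]
        rw [level_mul_add hg.le hc]
        unfold compat at hc1
        rw [hvg i hi c hc] at hc1
        rcases lt_trichotomy c (L.vg (e i L.K)) with h1 | h1 | h1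
        · rw [if_pos h1, hc1.1 h1]
        · rw [if_neg (by omega), h1, h]
        · rw [if_neg (by omega), hc1.2.1 h1]
      · refine ⟨τ i + 1, fun _ => ⟨Or.inr rfl, fun c hc => ?_⟩⟩
        have hc1 := hcompat i hi c hc
        simp only [τ]
        rw [add_assoc, level_mul_add (by omega) hc]
        unfold compat at hc1
        rw [hvg i hi c hc] at hc1
        rcases lt_trichotomy c (L.vg (e i L.K)) with h1 | h1 | h1
        · rw [if_pos (by omega), hc1.1 h1]
        · rw [if_pos (by omega), h1, h]
        · rw [if_neg (by omega), hc1.2.1 h1]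
    · exact ⟨0, fun h => absurd h hi⟩
  choose D hD using hD
  -- For `x < y`, piece `x % K` is further ahead after `y` moves than after `x`, as it is the one
  -- that moves after the first `x` moves.
  have hlevel_inj : ∀ x y, (∀ c < L.K, L.level x c = L.level y c) → x = y := by
    have key : ∀ x y, x < y → ∃ c < L.K, L.level x c ≠ L.level y c := by
      intro x y hxy
      refine ⟨x % L.K, Nat.mod_lt x hK, ?_⟩
      have hx := Nat.div_add_mod' x L.K
      have hm := Nat.mod_lt x hK
      have l1 := level_mul_add (L := L) (q := x / L.K) (y := x % L.K) hm.le hm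
      rw [hx, if_neg (by omega)] at l1
      rw [l1]
      have : x / L.K + 1 ≤ L.level y (x % L.K) := by
        rw [level, Nat.le_div_iff_mul_le hK, add_mul]; omega
      omega
    intro x y h
    rcases lt_trichotomy x y with h1 | h1 | h1
    · obtain ⟨c, hc, hne⟩ := key x y h1
      exact absurd (h c hc) hne
    · exact h1
    · obtain ⟨c, hc, hne⟩ := key y x h1
      exact absurd (h c hc).symm hne
  have hmove : ∀ i < r, (∀ c < L.K, e (i + 1) c = e i c) ∨
      (e (i + 1) L.K = e i L.K ∧ ∃ c₀ < L.K, ∀ c < L.K, c ≠ c₀ → e (i + 1) c = e i c) := by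
    intro i hi
    obtain ⟨-, u, hu, v, hv, hB⟩ := hstep i hi
    have key : ∀ c ≤ L.K, c ≠ L.tok v → e (i + 1) c = e i c := by
      intro c hc hne
      obtain ⟨h1, h2⟩ := he (i + 1) c (by omega) hc
      rw [hB, Finset.mem_insert] at h1
      rcases h1 with h1 | h1
      · rw [h1] at h2; exact absurd h2.symm hne
      · have := huniq i hi.le _ (Finset.mem_of_mem_erase h1)
        rwa [h2] at this
    rcases (L.tok_le v).lt_or_eq with hv | hv
    · exact Or.inr ⟨key L.K le_rfl hv.ne', L.tok v, hv, fun c hc hne => key c hc.le hne⟩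
    · exact Or.inl fun c hc => key c hc.le (by omega)
  have hmove_data : ∀ i < r, (∀ c < L.K, e (i + 1) c = e i c) → D (i + 1) = D i := by
    intro i hi h
    refine hlevel_inj _ _ fun c hc => ?_
    rw [← (hD (i + 1) (by omega)).2 c hc, ← (hD i hi.le).2 c hc, h c hc]
  -- The potential `τ + D` rises by at most one per move: a move of the helper leaves `D` fixed and
  -- any other move leaves `τ` fixed, while the difference `D - τ` is always `0` or `1`.
  have hΦ : ∀ i < r, τ (i + 1) + D (i + 1) ≤ τ i + D i + 1 := by
    intro i hi
    have h1 := (hD i hi.le).1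
    have h2 := (hD (i + 1) (by omega)).1
    rcases hmove i hi with h | ⟨h, -⟩
    · have := hmove_data i hi h
      omega
    · have : τ (i + 1) = τ i := by simp only [τ, h]
      omega
  have hrest : ∀ i ≤ r, ∀ q, (q = 0 ∨ q = L.Q) → A i = L.confSet (L.restConf q) →
      (∀ c ≤ L.K, (e i c : ℕ) = L.restConf q c) ∧ τ i = q * L.K ∧ D i = q * L.K := by
    intro i hi q hq hAi
    have hg := restConf_good (L := L) hq
    have key : ∀ c ≤ L.K, (e i c : ℕ) = L.restConf q c := by
      intro c hc
      have hm : L.vtx (L.restConf q c) ∈ A i := by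
        rw [hAi]
        exact Finset.mem_image.2 ⟨c, Finset.mem_range.2 (by omega), rfl⟩
      have h1 := huniq i hi _ hm
      rw [vtx_val (hg.lt c hc)] at h1
      have h2 : L.tok (L.restConf q c) = c := by
        simp only [tok]
        rcases hc.lt_or_eq with hlt | rfl
        · rw [if_neg (by have := (hg.data c hlt).1; omega), (hg.data c hlt).2]
        · rw [if_pos hg.helper]
      rw [h2] at h1
      rw [← h1, vtx_val (hg.lt c hc)]
    have hτ : τ i = q * L.K := by
      simp only [τ]
      rw [key L.K le_rfl]
      simp only [restConf, lt_irrefl, if_false]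
      rw [vq_enc (by omega) hW hK, vg_enc (by omega) hW hK, add_zero]
    refine ⟨key, hτ, hlevel_inj _ _ fun c hc => ?_⟩
    rw [← (hD i hi).2 c hc, key c hc.le]
    simp only [restConf, hc, if_true]
    rw [vq_enc (by omega) hW hc]
    exact (level_eq (by omega) (by omega)).symm
  have h0 := hrest 0 (by omega) 0 (Or.inl rfl) hA0
  have hlast := hrest r le_rfl L.Q (Or.inr rfl) hAr
  have hup : ∀ i ≤ r, τ i + D i ≤ i := by
    intro i hi
    induction i with
    | zero => rw [h0.2.1, h0.2.2]; simp
    | succ i ih =>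
      have := hΦ i (by omega)
      have := ih (by omega)
      omega
  have hdown : ∀ j ≤ r, τ r + D r ≤ τ (r - j) + D (r - j) + j := by
    intro j hj
    induction j with
    | zero => simp
    | succ j ih =>
      have h1 := hΦ (r - (j + 1)) (by omega)
      have h2 := ih (by omega)
      have h3 : r - (j + 1) + 1 = r - j := by omega
      rw [h3] at h1
      omega
  -- The potential has to climb from `0` to `2 * Q * K` within as many moves, so there is no slack.
  have hreq : r = 2 * (L.Q * L.K) := by
    have := hup r le_rfl
    omega
  -- The bounds from both ends give `τ i + D i = i`, and the parity of `i` decides between the two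
  -- options for `D i`.
  have hval : ∀ i ≤ r, τ i = i / 2 ∧ D i = (i + 1) / 2 := by
    intro i hi
    have h1 := hup i hi
    have h2 := hdown (r - i) (by omega)
    have h3 : r - (r - i) = i := by omega
    rw [h3] at h2
    have h4 := (hD i hi).1
    omega
  subst hreq
  refine ⟨fun i c => e i c, fun c hc => h0.1 c hc.le, fun c hc => hlast.1 c hc.le,
    fun i hi => ⟨htok_helper _ (he i L.K hi le_rfl).2, hvg i hi, hcompat i hi, (hval i hi).1,
      fun c hc => ?_⟩, fun x hx => ⟨?_, ?_, ?_⟩⟩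
  · rw [(hD i hi).2 c hc, (hval i hi).2]
  · have v1 := hval (2 * x) (by omega)
    have v2 := hval (2 * x + 1) (by omega)
    rcases hmove (2 * x) (by omega) with h | ⟨h, -⟩
    · have := hmove_data (2 * x) (by omega) h
      omega
    · exact congrArg Fin.val h
  · have v1 := hval (2 * x) (by omega)
    have v2 := hval (2 * x + 1) (by omega)
    rcases hmove (2 * x) (by omega) with h | ⟨-, c₀, hc₀, h⟩
    · have := hmove_data (2 * x) (by omega) h
      omega
    · have hc₀x : c₀ = x % L.K := by
        by_contra hne
        have hm := Nat.mod_lt x hK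
        have hx' := Nat.div_add_mod' x L.K
        have e1 := (hD (2 * x) (by omega)).2 (x % L.K) hm
        have e2 := (hD (2 * x + 1) (by omega)).2 (x % L.K) hm
        rw [h _ hm (Ne.symm hne), e1, v1.2, v2.2] at e2
        have l1 := level_mul_add (L := L) (q := x / L.K) (y := x % L.K) hm.le hm
        have l2 := level_mul_add (L := L) (q := x / L.K) (y := x % L.K + 1) (by omega) hm
        rw [hx', if_neg (by omega)] at l1
        rw [← add_assoc, hx', if_pos (by omega)] at l2
        have f1 : (2 * x + 1) / 2 = x := by omega
        have f2 : (2 * x + 1 + 1) / 2 = x + 1 := by omega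
        rw [f1, f2, l1, l2] at e2
        omega
      intro c hc hne
      exact congrArg Fin.val (h c hc (by omega))
  · have v1 := hval (2 * x + 1) (by omega)
    have v2 := hval (2 * x + 1 + 1) (by omega)
    rcases hmove (2 * x + 1) (by omega) with h | ⟨h, -⟩
    · intro c hc
      exact congrArg Fin.val (h c hc)
    · have : τ (2 * x + 1 + 1) = τ (2 * x + 1) := by simp only [τ, h]
      omega

/-- The state of layer `q` is read off at time `2 * q * K`, when all data tokens are in that layer
and the helper, at piece `0`, performs the checks. The copy of piece `g` is read off at time `2 * (q
* K + g)`; the helper tolerates the data token before and after its jump, which gives the two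
conditions on `keep`. -/
theorem run_of_answer (h : L.inst.Answer) : L.Run := by
  obtain ⟨d, hd0, hdQ, hd, hmove⟩ := positions_of_answer h
  have hK := L.K_pos
  have hW := L.W_pos
  have hlt : ∀ q < L.Q, ∀ j ≤ L.K, q * L.K + j ≤ L.Q * L.K := by
    intro q hq j hj
    have := Nat.mul_le_mul_right L.K hq
    rw [Nat.succ_mul] at this
    omega
  -- a data token stays where it is until its turn comes
  have stay₁ : ∀ q < L.Q, ∀ g < L.K, ∀ j ≤ g, d (2 * (q * L.K + j)) g = d (2 * (q * L.K)) g := by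
    intro q hq g hg j hj
    induction j with
    | zero => simp
    | succ j ih =>
      have := hlt q hq (j + 1) (by omega)
      obtain ⟨-, h2, h3⟩ := hmove (q * L.K + j) (by omega)
      have hm : (q * L.K + j) % L.K = j := by
        rw [Nat.mul_add_mod', Nat.mod_eq_of_lt (by omega)]
      have := h3 g hg
      rw [h2 g hg (by omega), ih (by omega)] at this
      exact this
  have stay₂ : ∀ q < L.Q, ∀ g < L.K, ∀ j, g + 1 + j ≤ L.K →
      d (2 * (q * L.K + (g + 1 + j))) g = d (2 * (q * L.K + g) + 1) g := by
    intro q hq g hg j hj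
    induction j with
    | zero =>
      have := hlt q hq (g + 1) (by omega)
      exact (hmove (q * L.K + g) (by omega)).2.2 g hg
    | succ j ih =>
      have := hlt q hq (g + 1 + j + 1) (by omega)
      obtain ⟨-, h2, h3⟩ := hmove (q * L.K + (g + 1 + j)) (by omega)
      have hm : (q * L.K + (g + 1 + j)) % L.K = g + 1 + j := by
        rw [Nat.mul_add_mod', Nat.mod_eq_of_lt (by omega)]
      have := h3 g hg
      rw [h2 g hg (by omega), ih (by omega)] at this
      exact this
  have hhelper : ∀ q < L.Q, ∀ g < L.K, L.vq (d (2 * (q * L.K + g)) L.K) = q ∧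
      L.vg (d (2 * (q * L.K + g)) L.K) = g := by
    intro q hq g hg
    have := hlt q hq g (by omega)
    have h1 := (hd (2 * (q * L.K + g)) (by omega)).2.2.2.1
    have h2 : 2 * (q * L.K + g) / 2 = q * L.K + g := by omega
    rw [h2] at h1
    have hg' := L.vg_lt (d (2 * (q * L.K + g)) L.K)
    have e1 := congrArg (· / L.K) h1
    have e2 := congrArg (· % L.K) h1
    simp only [Nat.mul_add_mod', Nat.mod_eq_of_lt hg', Nat.mod_eq_of_lt hg] at e2
    refine ⟨?_, e2⟩
    have hdiv : ∀ x y, y < L.K → (x * L.K + y) / L.K = x := fun x y hy => by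
      rw [Nat.add_comm, Nat.add_mul_div_right _ _ hK, Nat.div_eq_of_lt hy, zero_add]
    beta_reduce at e1
    rwa [hdiv _ _ hg', hdiv _ _ hg] at e1
  -- The end states are set to zero explicitly because a run wants them to vanish for all `g`, also
  -- for `g ≥ K`, where `d` is arbitrary. The default choice in layers from `Q` on has the same
  -- reason: there nothing is known about the helper.
  refine ⟨fun q g => if q = 0 ∨ q = L.Q then 0 else L.va (d (2 * (q * L.K)) g),
    fun q g => L.va (d (2 * (q * L.K + g)) L.K),
    fun q => if q < L.Q then vz (d (2 * (q * L.K)) L.K) else 0, fun q g => ?_, fun q g => va_lt _,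
    fun q => ?_, fun g => by simp, fun g => by simp, fun q hq g hg => ?_, fun q hq g hg => ?_⟩
  · beta_reduce
    split_ifs
    exacts [hW, va_lt _]
  · beta_reduce
    split_ifs with hq
    · have := hlt q hq 0 (by omega)
      exact (hd _ (by omega)).1
    · omega
  · have hα : ∀ q ≤ L.Q, (if q = 0 ∨ q = L.Q then 0 else L.va (d (2 * (q * L.K)) g)) =
        L.va (d (2 * (q * L.K)) g) := by
      intro q hq
      split_ifs with h
      · rcases h with rfl | rfl
        · simp only [zero_mul, mul_zero]
          rw [hd0 g hg]; simp only [restConf, hg, if_true]; rw [va_enc (by omega) hW]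
        · rw [hdQ g hg]; simp only [restConf, hg, if_true]; rw [va_enc (by omega) hW]
      · rfl
    simp only
    rw [hα q hq.le, hα (q + 1) hq]
    have hle := hlt q hq (g + 1) (by omega)
    obtain ⟨hq1, hg1⟩ := hhelper q hq g hg
    constructor
    · obtain ⟨-, h2, h3, -, h5⟩ := hd (2 * (q * L.K + g)) (by omega)
      have hc := ((h3 g hg).2.2.1 (by rw [h2 g hg, hg1])).2
      have hl := h5 g hg
      have e : (2 * (q * L.K + g) + 1) / 2 = q * L.K + g := by omega
      rw [e, level_mul_add hg.le hg, if_neg (by omega)] at hl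
      rw [hq1, hg1, hl] at hc
      rwa [stay₁ q hq g hg g le_rfl] at hc
    · obtain ⟨-, h2, h3, -, h5⟩ := hd (2 * (q * L.K + g) + 1) (by omega)
      have hh := (hmove (q * L.K + g) (by omega)).1
      have hc := ((h3 g hg).2.2.1 (by rw [h2 g hg, hh, hg1])).2
      have hl := h5 g hg
      have e : (2 * (q * L.K + g) + 1 + 1) / 2 = q * L.K + (g + 1) := by omega
      rw [e, level_mul_add hg hg, if_pos (by omega)] at hl
      rw [hh, hq1, hg1, hl] at hc
      have := stay₂ q hq g hg (L.K - (g + 1)) (by omega)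
      rw [← this] at hc
      have e' : q * L.K + (g + 1 + (L.K - (g + 1))) = (q + 1) * L.K := by
        rw [add_mul]; omega
      rwa [e'] at hc
  · have hle := hlt q hq 1 (by omega)
    obtain ⟨hq1, hg1⟩ := hhelper q hq 0 hK
    rw [add_zero] at hq1 hg1
    obtain ⟨-, h2, h3, -, h5⟩ := hd (2 * (q * L.K)) (by omega)
    have hl := h5 g hg
    have e : (2 * (q * L.K) + 1) / 2 = q * L.K + 0 := by omega
    rw [e, level_mul_add (by omega) hg, if_neg (by omega)] at hl
    have hc := (h3 g hg).2.2.2 hg1 (by rw [hl, hq1])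
    rw [hq1, h2 g hg] at hc
    simp only [hq, if_true]
    split_ifs with h
    · rcases h with rfl | rfl
      · exact L.check_zero _ _ _
      · omega
    · exact hc

theorem answer_iff_run : L.inst.Answer ↔ L.Run := ⟨run_of_answer, answer_of_run⟩

end Layered

end Reconf

theorem List.getD_ofFn_zero {n : ℕ} (f : Fin n → ℕ) (i : ℕ) :
    (List.ofFn f).getD i 0 = if h : i < n then f ⟨i, h⟩ else 0 := by
  rw [List.getD_eq_getElem?_getD, List.getElem?_ofFn]
  split_ifs <;> rfl

/-! ### Binary digits -/

namespace RAM

def bit (a p : ℕ) : ℕ := a / 2 ^ p % 2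

theorem bit_lt (a p : ℕ) : bit a p < 2 := Nat.mod_lt _ (by omega)

theorem bit_eq_toNat (a p : ℕ) : bit a p = (a.testBit p).toNat := by
  rw [Nat.testBit_eq_decide_div_mod_eq, bit]
  by_cases h : a / 2 ^ p % 2 = 1
  · simp [h]
  · have : a / 2 ^ p % 2 = 0 := by omega
    simp [this]

/-- The number whose binary digits are given by a predicate. -/
noncomputable def ofDigits (w : ℕ) (ε : ℕ → Prop) : ℕ :=
  open Classical in Nat.ofBits fun p : Fin w => decide (ε p)

theorem ofDigits_lt (w : ℕ) (ε : ℕ → Prop) : ofDigits w ε < 2 ^ w := Nat.ofBits_lt_two_pow _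

theorem bit_ofDigits {w p : ℕ} (ε : ℕ → Prop) (hp : p < w) : bit (ofDigits w ε) p = ind (ε p) := by
  rw [bit_eq_toNat, ofDigits, Nat.testBit_ofBits_lt _ _ hp]
  by_cases h : ε p <;> simp [ind, h]

theorem ofDigits_eq_zero {w : ℕ} {ε : ℕ → Prop} (h : ∀ p, ¬ ε p) : ofDigits w ε = 0 := by
  refine Nat.eq_of_testBit_eq fun p => ?_
  rw [ofDigits, Nat.testBit_ofBits, Nat.zero_testBit]
  simp [h]

theorem eq_of_bit_eq {w a b : ℕ} (ha : a < 2 ^ w) (hb : b < 2 ^ w)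
    (h : ∀ p < w, bit a p = bit b p) : a = b := by
  refine Nat.eq_of_testBit_eq fun p => ?_
  by_cases hp : p < w
  · have := h p hp
    rw [bit_eq_toNat, bit_eq_toNat] at this
    cases ha' : a.testBit p <;> cases hb' : b.testBit p <;> simp_all
  · have hle : 2 ^ w ≤ 2 ^ p := Nat.pow_le_pow_right (by omega) (by omega)
    rw [Nat.testBit_eq_false_of_lt (ha.trans_le hle), Nat.testBit_eq_false_of_lt (hb.trans_le hle)]

/-! ### The least missing number -/

/-- The least number that does not satisfy `U`, or `n` if this is less. -/
noncomputable def mex (n : ℕ) (U : ℕ → Prop) : ℕ :=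
  ∑ c ∈ Finset.range n, ind (∀ c' < c + 1, U c')

theorem mex_le (n : ℕ) (U : ℕ → Prop) : mex n U ≤ n :=
  (Finset.sum_le_card_nsmul _ _ 1 fun c _ => ind_le _).trans (by simp)

theorem sum_ind_lt (n b : ℕ) : ∑ c ∈ Finset.range n, ind (c < b) = min n b := by
  induction n with
  | zero => simp
  | succ n ih =>
    rw [Finset.sum_range_succ, ih]
    by_cases h : n < b
    · rw [ind_of h]; omega
    · rw [ind_of_not h]; omega

/-- The numbers below the least missing one all lie in `s`, so it is at most `s.card`, and the cap
`n` never takes effect. -/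
theorem mex_spec {n : ℕ} {U : ℕ → Prop} {s : Finset ℕ} (hs : ∀ c, U c → c ∈ s)
    (hcard : s.card ≤ n) : ¬ U (mex n U) ∧ mex n U ≤ s.card := by
  classical
  have hex : ∃ c, ¬ U c := by
    obtain ⟨c, hc⟩ := Infinite.exists_notMem_finset s
    exact ⟨c, fun h => hc (hs c h)⟩
  have hle : Nat.find hex ≤ s.card := by
    have hsub : Finset.range (Nat.find hex) ⊆ s := fun c hc =>
      hs c (not_not.1 (Nat.find_min hex (Finset.mem_range.1 hc)))
    simpa using Finset.card_le_card hsub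
  have heq : mex n U = Nat.find hex := by
    have : ∀ c, (∀ c' < c + 1, U c') ↔ c < Nat.find hex := by
      intro c
      rw [Nat.lt_find_iff]
      exact ⟨fun h m hm => not_not.2 (h m (by omega)), fun h m hm => not_not.1 (h m (by omega))⟩
    simp only [mex, this, sum_ind_lt]
    omega
  rw [heq]
  exact ⟨Nat.find_spec hex, hle⟩

/-! ### Tables defined by recursion -/

/-- The table which is filled from left to right, where `G q` computes entry `q` from the table of
the earlier entries. -/
def table (G : ℕ → (ℕ → ℕ) → ℕ) : ℕ → ℕ → ℕ
  | 0 => 0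
  | q + 1 => Function.update (table G q) q (G q (table G q))

/-- The final entries of the table. -/
def entry (G : ℕ → (ℕ → ℕ) → ℕ) (q : ℕ) : ℕ := G q (table G q)

theorem table_eq (G : ℕ → (ℕ → ℕ) → ℕ) (q : ℕ) : table G q = trunc (entry G) q := by
  induction q with
  | zero => rw [trunc_zero]; rfl
  | succ q ih => rw [← trunc_succ, ← ih]; rfl

/-- This is the form in which a recursion meets the filling of arrays: when entry `q` is computed,
the memory holds the earlier entries and zeros. -/
theorem entry_eq (G : ℕ → (ℕ → ℕ) → ℕ) (q : ℕ) : entry G q = G q (trunc (entry G) q) := by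
  rw [← table_eq]; rfl

end RAM

/-! ### Bags, clauses and slots of a 3-SAT instance, in terms of numbers. -/

namespace PathSat

open RAM

namespace Instance

variable (I : Instance)

def inp (a i : ℕ) : ℕ := (I.encode.getD a []).getD i 0

/-- Variable `v` lies in bag `j`; the bags are numbered from `1`. -/
def memb (j v : ℕ) : Prop :=
  1 ≤ j ∧ j ≤ I.numBags ∧ v < I.numVars ∧ I.inp 2 ((j - 1) * I.numVars + v) = 1

def lvar (c i : ℕ) : ℕ := I.inp 1 (c * 3 + i) / 2

def lsgn (c i : ℕ) : ℕ := I.inp 1 (c * 3 + i) % 2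

variable {I}

theorem not_memb_zero (v : ℕ) : ¬ I.memb 0 v := fun h => by simpa using h.1

theorem memb_succ (j : Fin I.numBags) (v : Fin I.numVars) : I.memb (j + 1) v ↔ v ∈ I.bag j := by
  have hlt : (j : ℕ) * I.numVars + v < I.numBags * I.numVars := by
    have h := j.isLt
    have h2 := v.isLt
    have := Nat.mul_le_mul_right I.numVars h
    rw [Nat.succ_mul] at this
    omega
  have e1 : (⟨(j : ℕ) * I.numVars + v, hlt⟩ : Fin (I.numBags * I.numVars)).divNat = j := by
    ext
    have := v.isLt
    rw [Fin.coe_divNat]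
    simp only
    rw [Nat.add_comm, Nat.add_mul_div_right _ _ (by omega), Nat.div_eq_of_lt this, zero_add]
  have e2 : (⟨(j : ℕ) * I.numVars + v, hlt⟩ : Fin (I.numBags * I.numVars)).modNat = v := by
    ext
    rw [Fin.coe_modNat]
    simp only
    rw [Nat.mul_add_mod', Nat.mod_eq_of_lt v.isLt]
  have h : I.inp 2 ((j : ℕ) * I.numVars + v) = if v ∈ I.bag j then 1 else 0 := by
    simp only [inp, Instance.encode, List.getD_cons_succ, List.getD_cons_zero]
    rw [List.getD_ofFn_zero, dif_pos hlt, e1, e2]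
  simp only [memb, Nat.add_sub_cancel, h]
  constructor
  · rintro ⟨-, -, -, h⟩
    by_contra hn
    simp [hn] at h
  · intro h
    exact ⟨by omega, j.isLt, v.isLt, if_pos h⟩

theorem memb_iff {j v : ℕ} : I.memb j v ↔
    ∃ (j' : Fin I.numBags) (v' : Fin I.numVars), j = j' + 1 ∧ v = v' ∧ v' ∈ I.bag j' := by
  constructor
  · intro h
    obtain ⟨h1, h2, h3, -⟩ := id h
    refine ⟨⟨j - 1, by omega⟩, ⟨v, h3⟩, by simp only; omega, rfl, ?_⟩
    rw [← memb_succ]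
    simp only [Nat.sub_add_cancel h1]
    exact h
  · rintro ⟨j', v', rfl, rfl, h⟩
    exact (memb_succ j' v').2 h

theorem memb.lt {j v : ℕ} (h : I.memb j v) : v < I.numVars := h.2.2.1

theorem memb_interval {j₁ j j₂ v : ℕ} (h₁ : j₁ ≤ j) (h₂ : j ≤ j₂) (m₁ : I.memb j₁ v)
    (m₂ : I.memb j₂ v) : I.memb j v := by
  obtain ⟨a, u, rfl, rfl, ha⟩ := memb_iff.1 m₁
  obtain ⟨b, u', rfl, hu, hb⟩ := memb_iff.1 m₂
  obtain rfl : u = u' := Fin.ext hu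
  have hlt := b.isLt
  refine memb_iff.2 ⟨⟨j - 1, by omega⟩, u, by simp only; omega, rfl, ?_⟩
  exact I.isPathDecomposition.interval u a _ b (by rw [Fin.le_def]; simp only; omega)
    (by rw [Fin.le_def]; simp only; omega) ha hb

theorem exists_memb (v : Fin I.numVars) : ∃ j, I.memb j v := by
  obtain ⟨j, hj⟩ := I.isPathDecomposition.vertex_mem v
  exact ⟨_, (memb_succ j v).2 hj⟩

theorem inp_one (c : Fin I.numClauses) (i : Fin 3) : I.inp 1 ((c : ℕ) * 3 + i) =
    2 * ((I.formula c i).1 : ℕ) + (I.formula c i).2.toNat := by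
  have hlt : (c : ℕ) * 3 + i < I.numClauses * 3 := by omega
  have e1 : (⟨(c : ℕ) * 3 + i, hlt⟩ : Fin (I.numClauses * 3)).divNat = c := by
    ext; rw [Fin.coe_divNat]; simp only; omega
  have e2 : (⟨(c : ℕ) * 3 + i, hlt⟩ : Fin (I.numClauses * 3)).modNat = i := by
    ext; rw [Fin.coe_modNat]; simp only; omega
  simp only [inp, Instance.encode, List.getD_cons_succ, List.getD_cons_zero]
  rw [List.getD_ofFn_zero, dif_pos hlt, e1, e2]

theorem lvar_eq (c : Fin I.numClauses) (i : Fin 3) : I.lvar c i = (I.formula c i).1 := by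
  have := Bool.toNat_lt (I.formula c i).2
  rw [lvar, inp_one]; omega

theorem lsgn_eq (c : Fin I.numClauses) (i : Fin 3) : I.lsgn c i = (I.formula c i).2.toNat := by
  have := Bool.toNat_lt (I.formula c i).2
  rw [lsgn, inp_one]; omega

/-- All variables of a clause lie in a common bag. -/
theorem exists_bag (c : Fin I.numClauses) : ∃ j, ∀ i : Fin 3, I.memb j (I.formula c i).1 := by
  have hpair : ∀ i i' : Fin 3, ∃ j, I.memb j (I.formula c i).1 ∧ I.memb j (I.formula c i').1 := by
    intro i i'
    by_cases h : (I.formula c i).1 = (I.formula c i').1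
    · obtain ⟨j, hj⟩ := exists_memb (I.formula c i).1
      exact ⟨j, hj, h ▸ hj⟩
    · obtain ⟨j, h1, h2⟩ := I.isPathDecomposition.edge_mem _ _
        (show I.formula.primalGraph.Adj (I.formula c i).1 (I.formula c i').1 from
          ⟨h, c, ⟨i, rfl⟩, i', rfl⟩)
      exact ⟨j + 1, (memb_succ j _).2 h1, (memb_succ j _).2 h2⟩
  obtain ⟨a, a0, a1⟩ := hpair 0 1
  obtain ⟨b, b0, b2⟩ := hpair 0 2
  obtain ⟨d, d1, d2⟩ := hpair 1 2
  have med : ∀ {x y j} {v}, I.memb x v → I.memb y v → (x ≤ j ∧ j ≤ y ∨ y ≤ j ∧ j ≤ x) →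
      I.memb j v := by
    rintro x y j v hx hy (h | h)
    · exact memb_interval h.1 h.2 hx hy
    · exact memb_interval h.1 h.2 hy hx
  -- Helly property of intervals: the median of the three pairwise common bags lies between any two
  -- of them.
  have hj : ∃ j, (a ≤ j ∧ j ≤ b ∨ b ≤ j ∧ j ≤ a) ∧ (a ≤ j ∧ j ≤ d ∨ d ≤ j ∧ j ≤ a) ∧
      (b ≤ j ∧ j ≤ d ∨ d ≤ j ∧ j ≤ b) := by
    by_cases h1 : a ≤ b <;> by_cases h2 : b ≤ d <;> by_cases h3 : a ≤ d <;>
      first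
        | exact ⟨a, by omega⟩
        | exact ⟨b, by omega⟩
        | exact ⟨d, by omega⟩
  obtain ⟨j, h0, h1, h2⟩ := hj
  refine ⟨j, fun i => ?_⟩
  fin_cases i
  · exact med a0 b0 h0
  · exact med a1 d1 h1
  · exact med b2 d2 h2

/-! ### Slots for the variables of a bag -/

variable (I)

/-- Slot `s` is taken when variable `v` enters bag `j`. -/
def taken (T : ℕ → ℕ) (j v s : ℕ) : Prop :=
  ∃ u < I.numVars, I.memb j u ∧ ((I.memb (j - 1) u ∧ T ((j - 1) * I.numVars + u) = s) ∨
    (¬ I.memb (j - 1) u ∧ u < v ∧ T (j * I.numVars + u) = s))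

-- A variable that was in the previous bag keeps its slot. A new one takes the least slot that is
-- used neither by a staying variable nor by a new variable with a smaller number.
open Classical in
noncomputable def slotStep (q : ℕ) (T : ℕ → ℕ) : ℕ :=
  if I.memb (q / I.numVars - 1) (q % I.numVars) then
    T ((q / I.numVars - 1) * I.numVars + q % I.numVars)
  else mex I.numVars (I.taken T (q / I.numVars) (q % I.numVars))

noncomputable def slotTable : ℕ → ℕ := entry I.slotStep

noncomputable def slot (j v : ℕ) : ℕ := I.slotTable (j * I.numVars + v)

/-- The number of variables in bag `j`. -/
noncomputable def bagSize (j : ℕ) : ℕ := ∑ v ∈ Finset.range I.numVars, ind (I.memb j v)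

/-- The maximum size of a bag. -/
noncomputable def maxBag : ℕ :=
  ∑ s ∈ Finset.range I.numVars, ind (∃ j < I.numBags + 1, s < I.bagSize j)

variable {I}

theorem slotTable_le (q : ℕ) : I.slotTable q ≤ I.numVars := by
  induction q using Nat.strong_induction_on with
  | _ q ih =>
    rw [slotTable, entry_eq, slotStep]
    split_ifs
    · simp only [trunc]
      split_ifs with h
      · exact ih _ h
      · omega
    · exact mex_le _ _

theorem slot_old {j v : ℕ} (h : I.memb j v) : I.slot (j + 1) v = I.slot j v := by
  have hv := h.lt
  have e1 : ((j + 1) * I.numVars + v) / I.numVars = j + 1 := by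
    rw [Nat.add_comm, Nat.add_mul_div_right _ _ (by omega), Nat.div_eq_of_lt hv, zero_add]
  have e2 : ((j + 1) * I.numVars + v) % I.numVars = v := by
    rw [Nat.mul_add_mod', Nat.mod_eq_of_lt hv]
  have hlt : j * I.numVars + v < (j + 1) * I.numVars + v := by
    rw [add_mul]; omega
  rw [slot, slotTable, entry_eq, slotStep, e1, e2, Nat.add_sub_cancel, if_pos h, trunc, if_pos hlt]
  rfl

theorem slot_new {j v : ℕ} (hv : v < I.numVars) (h : ¬ I.memb (j - 1) v) :
    I.slot j v = mex I.numVars fun s => ∃ u < I.numVars, I.memb j u ∧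
      ((I.memb (j - 1) u ∧ I.slot (j - 1) u = s) ∨
        (¬ I.memb (j - 1) u ∧ u < v ∧ I.slot j u = s)) := by
  have e1 : (j * I.numVars + v) / I.numVars = j := by
    rw [Nat.add_comm, Nat.add_mul_div_right _ _ (by omega), Nat.div_eq_of_lt hv, zero_add]
  have e2 : (j * I.numVars + v) % I.numVars = v := by
    rw [Nat.mul_add_mod', Nat.mod_eq_of_lt hv]
  rw [slot, slotTable, entry_eq, slotStep, e1, e2, if_neg h]
  congr 1
  funext s
  refine propext (exists_congr fun u => and_congr_right fun hu => and_congr_right fun hm =>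
    or_congr (and_congr_right fun hm' => ?_) (and_congr_right fun _ => and_congr_right fun hlt =>
      ?_))
  · have h1 := hm'.1
    have : (j - 1) * I.numVars + u < j * I.numVars + v := by
      have : (j - 1 + 1) * I.numVars ≤ j * I.numVars := Nat.mul_le_mul_right _ (by omega)
      rw [add_mul] at this
      omega
    rw [trunc, if_pos this]; rfl
  · rw [trunc, if_pos (by omega)]; rfl

theorem bagSize_eq (j : ℕ) : I.bagSize j =
    ((Finset.range I.numVars).filter fun v => ind (I.memb j v) = 1).card := by
  rw [bagSize, Finset.card_filter]
  refine Finset.sum_congr rfl fun v _ => ?_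
  by_cases h : I.memb j v <;> simp [ind, h]

theorem bagSize_succ (j : Fin I.numBags) : I.bagSize (j + 1) = (I.bag j).card := by
  have : ((Finset.range I.numVars).filter fun v => ind (I.memb (j + 1) v) = 1) =
      (I.bag j).map Fin.valEmbedding := by
    ext v
    simp only [Finset.mem_filter, Finset.mem_range, ind_eq_one, Finset.mem_map,
      Fin.valEmbedding_apply]
    constructor
    · rintro ⟨hv, hm⟩
      exact ⟨⟨v, hv⟩, (memb_succ j ⟨v, hv⟩).1 hm, rfl⟩
    · rintro ⟨v', hv', rfl⟩
      exact ⟨v'.isLt, (memb_succ j v').2 hv'⟩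
  rw [bagSize_eq, this, Finset.card_map]

theorem bagSize_le (j : ℕ) : I.bagSize j ≤ I.numVars :=
  (Finset.sum_le_card_nsmul _ _ 1 fun _ _ => ind_le _).trans (by simp)

theorem maxBag_le : I.maxBag ≤ width I.bag + 1 := by
  have key : ∀ j < I.numBags + 1, I.bagSize j ≤ Finset.univ.sup fun j => (I.bag j).card := by
    intro j hj
    rcases j with _ | j
    · have : I.bagSize 0 = 0 :=
        Finset.sum_eq_zero fun v _ => ind_of_not (not_memb_zero v)
      omega
    · have h1 : I.bagSize (j + 1) = _ := bagSize_succ ⟨j, by omega⟩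
      rw [h1]
      exact Finset.le_sup (f := fun j => (I.bag j).card) (Finset.mem_univ _)
  have : I.maxBag ≤ Finset.univ.sup fun j => (I.bag j).card := by
    calc I.maxBag ≤ ∑ s ∈ Finset.range I.numVars,
          ind (s < Finset.univ.sup fun j => (I.bag j).card) := by
          refine Finset.sum_le_sum fun s _ => ?_
          by_cases h : ∃ j < I.numBags + 1, s < I.bagSize j
          · obtain ⟨j, hj, hs⟩ := id h
            rw [ind_of h, ind_of (hs.trans_le (key j hj))]
          · rw [ind_of_not h]; omega
      _ ≤ _ := by rw [sum_ind_lt]; omega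
  rw [width]; omega

theorem bagSize_le_maxBag {j : ℕ} (hj : j ≤ I.numBags) : I.bagSize j ≤ I.maxBag := by
  have := bagSize_le (I := I) j
  calc I.bagSize j = ∑ s ∈ Finset.range I.numVars, ind (s < I.bagSize j) := by
        rw [sum_ind_lt]; omega
    _ ≤ _ := by
      refine Finset.sum_le_sum fun s _ => ?_
      by_cases h : s < I.bagSize j
      · rw [ind_of (⟨j, by omega, h⟩ : ∃ j < I.numBags + 1, s < I.bagSize j)]
        exact ind_le _
      · rw [ind_of_not h]; omega

/-- The slots to be avoided belong to other variables of the same bag, so there are fewer of them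
than the size of the bag, and the least free slot is below that size. -/
theorem slot_new_spec {j v : ℕ} (hm : I.memb j v) (h : ¬ I.memb (j - 1) v) :
    I.slot j v < I.bagSize j ∧ ∀ u, I.memb j u → ((I.memb (j - 1) u ∧
      I.slot (j - 1) u ≠ I.slot j v) ∨ (¬ I.memb (j - 1) u ∧ (u < v → I.slot j u ≠ I.slot j v))) := by
  classical
  let B := (Finset.range I.numVars).filter fun v => ind (I.memb j v) = 1
  let s : Finset ℕ := (B.erase v).image fun u =>
    if I.memb (j - 1) u then I.slot (j - 1) u else I.slot j u
  have hvB : v ∈ B := by simp [B, ind_eq_one, hm, hm.lt]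
  have hcard : s.card + 1 ≤ I.bagSize j := by
    rw [bagSize_eq, ← Finset.card_erase_add_one hvB]
    exact Nat.add_le_add_right Finset.card_image_le 1
  obtain ⟨h1, h2⟩ := mex_spec (n := I.numVars) (U := fun s => ∃ u < I.numVars, I.memb j u ∧
      ((I.memb (j - 1) u ∧ I.slot (j - 1) u = s) ∨
        (¬ I.memb (j - 1) u ∧ u < v ∧ I.slot j u = s))) (s := s) (by
      rintro c ⟨u, hu, hmu, ⟨ho, rfl⟩ | ⟨hn, hlt, rfl⟩⟩
      · refine Finset.mem_image.2 ⟨u, ?_, if_pos ho⟩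
        have : u ≠ v := by rintro rfl; exact h ho
        simp [B, ind_eq_one, hmu, hu, this]
      · refine Finset.mem_image.2 ⟨u, ?_, if_neg hn⟩
        simp [B, ind_eq_one, hmu, hu, hlt.ne])
    (by have := bagSize_le (I := I) j; omega)
  rw [← slot_new hm.lt h] at h1 h2
  refine ⟨by omega, fun u hu => ?_⟩
  by_cases ho : I.memb (j - 1) u
  · exact Or.inl ⟨ho, fun he => h1 ⟨u, hu.lt, hu, Or.inl ⟨ho, he⟩⟩⟩
  · exact Or.inr ⟨ho, fun hlt he => h1 ⟨u, hu.lt, hu, Or.inr ⟨ho, hlt, he⟩⟩⟩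

theorem slot_lt {j v : ℕ} (h : I.memb j v) : I.slot j v < I.maxBag := by
  induction j with
  | zero => exact absurd h (not_memb_zero v)
  | succ j ih =>
    by_cases ho : I.memb j v
    · rw [slot_old ho]; exact ih ho
    · exact (slot_new_spec h ho).1.trans_le (bagSize_le_maxBag h.2.1)

/-- Induction on the bag: two staying variables are handled by the previous bag, and a new variable
avoids the staying ones as well as the new ones before it. -/
theorem slot_inj {j u v : ℕ} (hu : I.memb j u) (hv : I.memb j v)
    (h : I.slot j u = I.slot j v) : u = v := by
  induction j with
  | zero => exact absurd hu (not_memb_zero u)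
  | succ j ih =>
    by_cases ou : I.memb j u <;> by_cases ov : I.memb j v
    · exact ih ou ov (by rwa [slot_old ou, slot_old ov] at h)
    · rcases (slot_new_spec hv ov).2 u hu with ⟨-, h1⟩ | ⟨h1, -⟩
      · rw [slot_old ou] at h; exact absurd h h1
      · exact absurd ou h1
    · rcases (slot_new_spec hu ou).2 v hv with ⟨-, h1⟩ | ⟨h1, -⟩
      · rw [slot_old ov] at h; exact absurd h.symm h1
      · exact absurd ov h1
    · rcases (slot_new_spec hv ov).2 u hu with ⟨h1, -⟩ | ⟨-, h1⟩
      · exact absurd h1 ou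
      · rcases (slot_new_spec hu ou).2 v hv with ⟨h2, -⟩ | ⟨-, h2⟩
        · exact absurd h2 ov
        · by_contra hne
          rcases Nat.lt_or_gt_of_ne hne with hlt | hlt
          · exact h1 hlt h
          · exact h2 hlt h.symm

/-! ### The layered system of an instance -/

variable (I) (K : ℕ)

/-- Every bag occupies `numClauses + 1` consecutive layers, one for each clause and a spare one, so
that the divisor is positive even without clauses. -/
def bagAt (q : ℕ) : ℕ := q / (I.numClauses + 1)

def clauseAt (q : ℕ) : ℕ := q % (I.numClauses + 1)

/-- The number of slots that share a piece. -/
noncomputable def pieceLen : ℕ := I.maxBag / K + 1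

/-- It belongs to bag number `numBags + 2`, which is empty, as is bag `0`; hence all conditions are
void in the first and the last layer. -/
def lastLayer : ℕ := (I.numBags + 2) * (I.numClauses + 1)

/-- Only variables that lie in both bags are compared; the digit of a variable that has left is free
to be reused. -/
def keep (q g b q' a : ℕ) : Prop :=
  ∀ v < I.numVars, I.memb (I.bagAt q) v → I.memb (I.bagAt q') v →
    I.slot (I.bagAt q) v / I.pieceLen K = g →
      bit b (I.slot (I.bagAt q) v % I.pieceLen K) = bit a (I.slot (I.bagAt q) v % I.pieceLen K)

/-- The clause is examined only in bags that contain all its variables, and only the piece with the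
chosen literal is constrained. -/
def check (q z g a : ℕ) : Prop :=
  I.clauseAt q < I.numClauses → (∀ i < 3, I.memb (I.bagAt q) (I.lvar (I.clauseAt q) i)) →
    I.slot (I.bagAt q) (I.lvar (I.clauseAt q) z) / I.pieceLen K = g →
      bit a (I.slot (I.bagAt q) (I.lvar (I.clauseAt q) z) % I.pieceLen K) =
        I.lsgn (I.clauseAt q) z

variable {I}

theorem bagAt_zero : I.bagAt 0 = 0 := Nat.zero_div _

theorem not_memb_last (v : ℕ) : ¬ I.memb (I.bagAt I.lastLayer) v := by
  rw [bagAt, lastLayer, Nat.mul_div_cancel _ (by omega)]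
  intro h
  have := h.2.1
  omega

variable (I)

/-- The layered system whose state is the assignment to the current bag. -/
noncomputable def layered (hK : 0 < K) : Reconf.Layered where
  K := K
  W := 2 ^ I.pieceLen K
  Q := I.lastLayer
  K_pos := hK
  W_pos := by positivity
  keep := I.keep K
  check := I.check K
  keep_zero g b q a v _ h := absurd h (by rw [bagAt_zero]; exact not_memb_zero v)
  keep_last g b q a v _ h := absurd h (not_memb_last v)
  check_zero z g a _ h := absurd (h 0 (by omega)) (by rw [bagAt_zero]; exact not_memb_zero _)
  check_last z g a _ h := absurd (h 0 (by omega)) (not_memb_last _)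

variable {I K}

theorem slot_piece_lt {j v : ℕ} (hK : 0 < K) (h : I.memb j v) : I.slot j v / I.pieceLen K < K := by
  have h1 := slot_lt h
  have h2 : I.maxBag < K * I.pieceLen K := by
    have := Nat.div_add_mod I.maxBag K
    have := Nat.mod_lt I.maxBag hK
    rw [pieceLen, mul_add]; omega
  exact Nat.div_lt_of_lt_mul (by rw [mul_comm]; omega)

theorem pieceLen_pos : 0 < I.pieceLen K := Nat.succ_pos _

theorem slot_mod_lt (j v : ℕ) : I.slot j v % I.pieceLen K < I.pieceLen K :=
  Nat.mod_lt _ pieceLen_pos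

theorem bagAt_add (q : ℕ) : I.bagAt (q + 1) = I.bagAt q ∨ I.bagAt (q + 1) = I.bagAt q + 1 := by
  rw [bagAt, bagAt, Nat.succ_div]
  split_ifs <;> simp

theorem bagAt_mono {q q' : ℕ} (h : q ≤ q') : I.bagAt q ≤ I.bagAt q' := Nat.div_le_div_right h

theorem slot_bagAt_succ {q v : ℕ} (h : I.memb (I.bagAt q) v) :
    I.slot (I.bagAt (q + 1)) v = I.slot (I.bagAt q) v := by
  rcases bagAt_add (I := I) q with e | e
  · rw [e]
  · rw [e, slot_old h]

theorem bagAt_mul_add {j c : ℕ} (hc : c ≤ I.numClauses) :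
    I.bagAt (j * (I.numClauses + 1) + c) = j := by
  rw [bagAt, Nat.add_comm, Nat.add_mul_div_right _ _ (by omega), Nat.div_eq_of_lt (by omega),
    zero_add]

theorem clauseAt_mul_add {j c : ℕ} (hc : c ≤ I.numClauses) :
    I.clauseAt (j * (I.numClauses + 1) + c) = c := by
  rw [clauseAt, Nat.mul_add_mod', Nat.mod_eq_of_lt (by omega)]

theorem lt_lastLayer {q v : ℕ} (h : I.memb (I.bagAt q) v) : q < I.lastLayer := by
  by_contra hn
  have h1 := bagAt_mono (I := I) (not_lt.1 hn)
  have h2 : I.bagAt I.lastLayer = I.numBags + 2 := Nat.mul_div_cancel _ (by omega)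
  have := h.2.1
  omega

/-- A digit is handed from layer to layer through the copies while its variable is present, and the
layers in which it is present form an interval. So the run assigns one value to each variable, and
every clause is checked in a layer whose bag contains its variables. -/
theorem satisfiable_of_run (hK : 0 < K) (h : (I.layered K hK).Run) : I.formula.Satisfiable := by
  obtain ⟨α, b, z, -, -, hz, -, -, hkeep, hcheck⟩ := h
  change ∀ q < I.lastLayer, ∀ g < K, I.keep K q g (b q g) q (α q g) ∧
    I.keep K q g (b q g) (q + 1) (α (q + 1) g) at hkeep
  change ∀ q < I.lastLayer, ∀ g < K, I.check K q (z q) g (α q g) at hcheck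
  let val : ℕ → ℕ → ℕ := fun q v => bit (α q (I.slot (I.bagAt q) v / I.pieceLen K))
    (I.slot (I.bagAt q) v % I.pieceLen K)
  have hstep : ∀ q v, I.memb (I.bagAt q) v → I.memb (I.bagAt (q + 1)) v →
      val (q + 1) v = val q v := by
    intro q v h1 h2
    obtain ⟨k1, k2⟩ := hkeep q (lt_lastLayer h1) _ (slot_piece_lt hK h1)
    have k1 := k1 v h1.lt h1 h1 rfl
    have k2 := k2 v h1.lt h1 h2 rfl
    simp only [val, slot_bagAt_succ h1]
    rw [← k1, ← k2]
  have hconst : ∀ q v, I.memb (I.bagAt q) v → ∀ d, I.memb (I.bagAt (q + d)) v →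
      val (q + d) v = val q v := by
    intro q v h d hd
    induction d with
    | zero => rfl
    | succ d ih =>
      have hmid : I.memb (I.bagAt (q + d)) v :=
        memb_interval (bagAt_mono (by omega)) (bagAt_mono (by omega)) h hd
      rw [← add_assoc, hstep _ _ hmid hd, ih hmid]
  choose J hJ using exists_memb (I := I)
  let q₀ : Fin I.numVars → ℕ := fun v => J v * (I.numClauses + 1) + 0
  have hq₀ : ∀ v, I.memb (I.bagAt (q₀ v)) v := fun v => by
    simp only [q₀]; rw [bagAt_mul_add (by omega)]; exact hJ v
  refine ⟨fun v => decide (val (q₀ v) v = 1), fun c => ?_⟩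
  obtain ⟨j, hj⟩ := exists_bag c
  let q := j * (I.numClauses + 1) + c
  have hb : I.bagAt q = j := bagAt_mul_add c.isLt.le
  have hc : I.clauseAt q = c := clauseAt_mul_add c.isLt.le
  let i : Fin 3 := ⟨z q, hz q⟩
  have hm : I.memb (I.bagAt q) (I.formula c i).1 := by rw [hb]; exact hj i
  have hchk := hcheck q (lt_lastLayer hm) _ (slot_piece_lt hK hm)
  have hl : I.lvar (I.clauseAt q) (z q) = (I.formula c i).1 := by rw [hc]; exact lvar_eq c i
  have hs : I.lsgn (I.clauseAt q) (z q) = (I.formula c i).2.toNat := by rw [hc]; exact lsgn_eq c i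
  have hv := hchk (by rw [hc]; exact c.isLt) (fun i' hi' => by
    rw [hc, hb, lvar_eq c ⟨i', hi'⟩]; exact hj _) (by rw [hl])
  rw [hl, hs] at hv
  have hval : val (q₀ (I.formula c i).1) (I.formula c i).1 = (I.formula c i).2.toNat := by
    rw [← hv]
    rcases le_total q (q₀ (I.formula c i).1) with h | h
    · obtain ⟨d, hd⟩ := Nat.exists_eq_add_of_le h
      have := hq₀ (I.formula c i).1
      rw [hd] at this ⊢
      exact hconst q _ hm d this
    · obtain ⟨d, hd⟩ := Nat.exists_eq_add_of_le h
      rw [hd] at hm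
      have := hconst _ _ (hq₀ (I.formula c i).1) d hm
      rw [← hd] at this
      exact this.symm
  refine ⟨i, ?_⟩
  simp only [hval]
  cases (I.formula c i).2 <;> simp

/-- The state of a layer writes the values of the present variables into their slots and zero
elsewhere, which is consistent because slots are injective on a bag. Every copy is the piece itself.
-/
theorem run_of_satisfiable (hK : 0 < K) (h : I.formula.Satisfiable) : (I.layered K hK).Run := by
  classical
  obtain ⟨σ, hσ⟩ := h
  choose z hz using hσ
  let ε : ℕ → ℕ → ℕ → Prop := fun q g p => ∃ v : Fin I.numVars, I.memb (I.bagAt q) v ∧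
    I.slot (I.bagAt q) v / I.pieceLen K = g ∧ I.slot (I.bagAt q) v % I.pieceLen K = p ∧ σ v = true
  let α : ℕ → ℕ → ℕ := fun q g => ofDigits (I.pieceLen K) (ε q g)
  have hα : ∀ q (v : Fin I.numVars), I.memb (I.bagAt q) v →
      bit (α q (I.slot (I.bagAt q) v / I.pieceLen K)) (I.slot (I.bagAt q) v % I.pieceLen K) =
        (σ v).toNat := by
    intro q v hv
    simp only [α]
    rw [bit_ofDigits _ (slot_mod_lt _ _)]
    by_cases h : σ v = true
    · rw [ind_of ⟨v, hv, rfl, rfl, h⟩, h]; rfl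
    · rw [ind_of_not, Bool.eq_false_of_not_eq_true h]
      · rfl
      · rintro ⟨u, hu, h1, h2, h3⟩
        have : I.slot (I.bagAt q) u = I.slot (I.bagAt q) v := by
          rw [← Nat.div_add_mod (I.slot (I.bagAt q) u) (I.pieceLen K), h1, h2, Nat.div_add_mod]
        obtain rfl : u = v := Fin.ext (slot_inj hu hv this)
        exact h h3
  refine ⟨α, α, fun q => if h : I.clauseAt q < I.numClauses then z ⟨_, h⟩ else 0,
    fun q g => ofDigits_lt _ _, fun q g => ofDigits_lt _ _, fun q => ?_,
    fun g => ofDigits_eq_zero ?_, fun g => ofDigits_eq_zero ?_, fun q hq g hg => ⟨?_, ?_⟩,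
    fun q hq g hg => ?_⟩
  · beta_reduce
    split_ifs
    · exact (z _).isLt
    · omega
  · rintro p ⟨v, hv, -⟩
    rw [bagAt_zero] at hv
    exact not_memb_zero _ hv
  · rintro p ⟨v, hv, -⟩
    exact not_memb_last _ hv
  · intro v hv h1 h2 h3
    rfl
  · rintro v hv h1 h2 rfl
    rw [hα q ⟨v, hv⟩ h1]
    have := hα (q + 1) ⟨v, hv⟩ h2
    simp only [slot_bagAt_succ h1] at this
    rw [this]
  · intro hc hm hs
    simp only [hc, dif_pos] at hs ⊢
    have hl := lvar_eq (I := I) ⟨_, hc⟩ (z ⟨_, hc⟩)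
    simp only at hl
    subst hs
    have hm' := hm (z ⟨_, hc⟩) (z ⟨_, hc⟩).isLt
    rw [hl] at hm' ⊢
    rw [hα q _ hm', hz ⟨_, hc⟩]
    exact (lsgn_eq (I := I) ⟨_, hc⟩ (z ⟨_, hc⟩)).symm

theorem answer_iff_satisfiable (hK : 0 < K) :
    (I.layered K hK).inst.Answer ↔ I.formula.Satisfiable :=
  Reconf.Layered.answer_iff_run.trans ⟨satisfiable_of_run hK, run_of_satisfiable hK⟩

end Instance

end PathSat

/-! ### The reconfiguration instance is cheap to compute from the 3-SAT instance. -/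

namespace PathSat

namespace Instance

open RAM

variable {K : ℕ}

/-- The arrays that are computed from an instance. -/
noncomputable def arrays (hK : 0 < K) (I : Instance) : ℕ → ℕ → ℕ
  | 0 => I.inp 0
  | 1 => I.inp 1
  | 2 => I.inp 2
  | 3 => trunc (fun i => 2 ^ i) (I.numVars + 2)
  | 4 => trunc I.slotTable ((I.numBags + 1) * I.numVars)
  | 5 => trunc (fun _ => I.pieceLen K) 1
  | a + 6 => fun i => ((I.layered K hK).inst.encode.getD a []).getD i 0

noncomputable def arrayLen (hK : 0 < K) : ℕ → Instance → ℕ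
  | 3, I => I.numVars + 2
  | 4, I => (I.numBags + 1) * I.numVars
  | 5, _ => 1
  | 6, _ => 3
  | 7, I => (I.layered K hK).N
  | 8, I => (I.layered K hK).N
  | _, I => (I.layered K hK).N * (I.layered K hK).N

/-- The context `c` knows the first `i` arrays. -/
structure View {Δ : Type} (hK : 0 < K) (c : Ctx Δ) (π : Δ → Instance) (i : ℕ) : Prop where
  knows : Knows c π (fun I => I.arrays hK) i
  size_eq : ∀ δ, c.size δ = (π δ).size
  two_lt : 2 < i

theorem pieceLen_le (I : Instance) : I.pieceLen K ≤ I.numVars + 1 := by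
  have h1 : I.maxBag ≤ I.numVars :=
    (Finset.sum_le_card_nsmul _ _ 1 fun _ _ => ind_le _).trans (by simp)
  have := Nat.div_le_self I.maxBag K
  rw [pieceLen]; omega

theorem lt_of_memb {I : Instance} {j v : ℕ} (h : I.memb j v) :
    j * I.numVars + v < (I.numBags + 1) * I.numVars := by
  have h1 := h.lt
  have := Nat.mul_le_mul_right I.numVars h.2.1
  rw [add_mul]; omega

namespace View

variable {Δ : Type} {hK : 0 < K} {c : Ctx Δ} {π : Δ → Instance} {i : ℕ} {f g h j v q q' a b z s : Δ → ℕ}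

theorem lift (V : View hK c π i) {x : ℕ} {hx : c.top ≤ x} :
    View hK (c.ext g x hx) (fun δ => π δ.1) i :=
  ⟨V.knows.lift, fun δ => V.size_eq δ.1, V.two_lt⟩

variable (V : View hK c π i)

include V

theorem inp (n : ℕ) (hn : n < 3) (hf : Comp c f) : Comp c fun δ => (π δ).inp n (f δ) := by
  have hi := V.two_lt
  interval_cases n
  · exact V.knows.load 0 (by omega) hf
  · exact V.knows.load 1 (by omega) hf
  · exact V.knows.load 2 (by omega) hf

theorem numVars : Comp c fun δ => (π δ).numVars := V.inp 0 (by omega) (.const c 0)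

theorem numClauses : Comp c fun δ => (π δ).numClauses := V.inp 0 (by omega) (.const c 1)

theorem numBags : Comp c fun δ => (π δ).numBags := V.inp 0 (by omega) (.const c 2)

theorem bdd (hf : ∀ δ, f δ ≤ (π δ).size) : PolyBdd c.size f :=
  (PolyBdd.self c.size).mono fun δ => by rw [V.size_eq]; exact hf δ

theorem bdd_numVars : PolyBdd c.size fun δ => (π δ).numVars :=
  V.bdd fun δ => by rw [Instance.size]; omega

theorem bdd_numBags : PolyBdd c.size fun δ => (π δ).numBags :=
  V.bdd fun δ => by rw [Instance.size]; omega

theorem memb (hj : Comp c j) (hv : Comp c v) : CompP c fun δ => (π δ).memb (j δ) (v δ) :=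
  (CompP.le (.const c 1) hj).and ((CompP.le hj V.numBags).and ((CompP.lt hv V.numVars).and
    (CompP.eq (V.inp 2 (by omega) (((hj.sub (.const c 1)).mul V.numVars).add hv)) (.const c 1))))

theorem lvar (hj : Comp c j) (hv : Comp c v) : Comp c fun δ => (π δ).lvar (j δ) (v δ) :=
  (V.inp 1 (by omega) ((hj.mul (.const c 3)).add hv)).div (.const c 2)

theorem lsgn (hj : Comp c j) (hv : Comp c v) : Comp c fun δ => (π δ).lsgn (j δ) (v δ) :=
  (V.inp 1 (by omega) ((hj.mul (.const c 3)).add hv)).mod (.const c 2)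

theorem bagSize (hj : Comp c j) : Comp c fun δ => (π δ).bagSize (j δ) :=
  Comp.sum V.numVars V.bdd_numVars fun _ _ => V.lift.memb hj.lift (.index V.bdd_numVars)

theorem maxBag : Comp c fun δ => (π δ).maxBag :=
  Comp.sum V.numVars V.bdd_numVars fun x hx => by
    have V' : View hK (c.ext (fun δ => (π δ).numVars) x hx) _ i := V.lift
    have hb := V'.bdd_numBags.add (.const _ 1)
    exact CompP.exists_lt (R := fun δ j => (δ.2 : ℕ) < (π δ.1).bagSize j)
      (V'.numBags.add (.const _ 1)) hb fun _ _ =>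
        CompP.lt (Comp.index V.bdd_numVars).lift (V'.lift.bagSize (.index hb))

/-- The table is a parameter `T` here because array `4` is only partly filled when this predicate is
evaluated. -/
theorem taken {T : Δ → ℕ → ℕ} (hT : ∀ δ i, c.mem δ 4 i = T δ i)
    (hb : ∃ K, ∀ δ i, (T δ i).size ≤ (c.size δ + 2) ^ K) (hj : Comp c j) (hv : Comp c v)
    (hs : Comp c s) : CompP c fun δ => (π δ).taken (T δ) (j δ) (v δ) (s δ) :=
  CompP.exists_lt (R := fun δ u => (π δ).memb (j δ) u ∧
      (((π δ).memb (j δ - 1) u ∧ T δ ((j δ - 1) * (π δ).numVars + u) = s δ) ∨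
      (¬ (π δ).memb (j δ - 1) u ∧ u < v δ ∧ T δ (j δ * (π δ).numVars + u) = s δ)))
    V.numVars V.bdd_numVars fun x hx => by
      have V' : View hK (c.ext (fun δ => (π δ).numVars) x hx) _ i := V.lift
      have hu := Comp.index (c := c) V.bdd_numVars (hv := hx)
      have old := V'.memb (hj.lift.sub (.const _ 1)) hu
      have read : ∀ {f : (Σ δ, Fin (π δ).numVars) → ℕ},
          Comp (c.ext (fun δ => (π δ).numVars) x hx) f →
          Comp (c.ext (fun δ => (π δ).numVars) x hx) fun δ => T δ.1 (f δ) := fun hf =>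
        Comp.load (a := 4) (m := fun δ => T δ.1) (fun δ i => hT δ.1 i)
          (hb.imp fun _ hK δ i => hK δ.1 i) hf
      exact (V'.memb hj.lift hu).and ((old.and (CompP.eq (read
        (((hj.lift.sub (.const _ 1)).mul V'.numVars).add hu)) hs.lift)).or
        (old.not.and ((CompP.lt hu hv.lift).and (CompP.eq (read
          ((hj.lift.mul V'.numVars).add hu)) hs.lift))))

theorem slotStep {T : Δ → ℕ → ℕ} (hT : ∀ δ i, c.mem δ 4 i = T δ i)
    (hb : ∃ K, ∀ δ i, (T δ i).size ≤ (c.size δ + 2) ^ K) (hq : Comp c q) :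
    Comp c fun δ => (π δ).slotStep (q δ) (T δ) := by
  classical
  have hj := hq.div V.numVars
  have hv := hq.mod V.numVars
  refine Comp.ite (V.memb (hj.sub (.const c 1)) hv) (Comp.load (a := 4) hT hb
    (((hj.sub (.const c 1)).mul V.numVars).add hv)) ?_
  refine Comp.sum (h := fun δ s => ind (∀ s' < s + 1, (π δ).taken (T δ) (q δ / (π δ).numVars)
    (q δ % (π δ).numVars) s')) V.numVars V.bdd_numVars fun x hx => ?_
  have hidx := Comp.index (c := c) V.bdd_numVars (hv := hx)
  have hbd : PolyBdd (c.ext (fun δ => (π δ).numVars) x hx).size fun δ => (δ.2 : ℕ) + 1 :=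
    (V.lift.bdd_numVars.add (.const _ 1)).mono fun δ => by have := δ.2.isLt; omega
  exact CompP.forall_lt (R := fun (δ : Σ δ, Fin (π δ).numVars) s' => (π δ.1).taken (T δ.1)
      (q δ.1 / (π δ.1).numVars) (q δ.1 % (π δ.1).numVars) s')
    (hidx.add (.const _ 1)) hbd fun y hy =>
      V.lift.lift.taken (fun δ i => hT δ.1.1 i) (hb.imp fun _ hK δ i => hK δ.1.1 i)
        hj.lift.lift hv.lift.lift (.index hbd)

/-- Powers of two are looked up in array `3`, which is the reason for the bound on the exponent. -/
theorem pow (hi : 3 < i) (hf : Comp c f) (hlt : ∀ δ, f δ < (π δ).numVars + 2) :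
    Comp c fun δ => 2 ^ f δ :=
  (V.knows.load 3 hi hf).congr fun δ => by simp only [arrays, trunc, hlt, if_true]

theorem bit (hi : 3 < i) (ha : Comp c a) (hf : Comp c f) (hlt : ∀ δ, f δ < (π δ).numVars + 2) :
    Comp c fun δ => RAM.bit (a δ) (f δ) :=
  (ha.div (V.pow hi hf hlt)).mod (.const c 2)

/-- The cell of array `4` is the slot only within the range of the table; `keep` and `check` use it
under a membership condition that guarantees this. -/
theorem slot (hi : 4 < i) (hj : Comp c j) (hv : Comp c v) :
    Comp c fun δ => (π δ).arrays hK 4 (j δ * (π δ).numVars + v δ) :=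
  V.knows.load 4 hi ((hj.mul V.numVars).add hv)

theorem pieceLen (hi : 5 < i) : Comp c fun δ => (π δ).pieceLen K :=
  (V.knows.load 5 hi (.const c 0)).congr fun δ => by simp [arrays, trunc]

theorem bagAt (hq : Comp c q) : Comp c fun δ => (π δ).bagAt (q δ) :=
  hq.div (V.numClauses.add (.const c 1))

theorem clauseAt (hq : Comp c q) : Comp c fun δ => (π δ).clauseAt (q δ) :=
  hq.mod (V.numClauses.add (.const c 1))

theorem keep (hi : 5 < i) (hq : Comp c q) (hg : Comp c g) (hb : Comp c b) (hq' : Comp c q')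
    (ha : Comp c a) :
    CompP c fun δ => (π δ).keep K (q δ) (g δ) (b δ) (q' δ) (a δ) := by
  refine CompP.forall_lt (R := fun δ v => (π δ).memb ((π δ).bagAt (q δ)) v →
    (π δ).memb ((π δ).bagAt (q' δ)) v →
    (π δ).slot ((π δ).bagAt (q δ)) v / (π δ).pieceLen K = g δ →
      RAM.bit (b δ) ((π δ).slot ((π δ).bagAt (q δ)) v % (π δ).pieceLen K) =
        RAM.bit (a δ) ((π δ).slot ((π δ).bagAt (q δ)) v % (π δ).pieceLen K))
    V.numVars V.bdd_numVars fun x hx => ?_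
  have V' : View hK (c.ext (fun δ => (π δ).numVars) x hx) _ i := V.lift
  have hv := Comp.index (c := c) V.bdd_numVars (hv := hx)
  have hs := V'.slot (by omega) (V.bagAt hq).lift hv
  have hw := V'.pieceLen hi
  have hlt : ∀ δ : (Σ δ, Fin (π δ).numVars), (π δ.1).arrays hK 4 ((π δ.1).bagAt (q δ.1) *
      (π δ.1).numVars + δ.2) % (π δ.1).pieceLen K < (π δ.1).numVars + 2 := fun δ =>
    (Nat.mod_lt _ pieceLen_pos).trans_le ((pieceLen_le _).trans (by omega))
  refine ((V'.memb (V.bagAt hq).lift hv).imp ((V'.memb (V.bagAt hq').lift hv).imp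
    ((CompP.eq (hs.div hw) hg.lift).imp (CompP.eq (V'.bit (by omega) hb.lift (hs.mod hw) hlt)
      (V'.bit (by omega) ha.lift (hs.mod hw) hlt))))).congr fun δ => ?_
  refine imp_congr_right fun hm => ?_
  have : (π δ.1).arrays hK 4 ((π δ.1).bagAt (q δ.1) * (π δ.1).numVars + δ.2) =
      (π δ.1).slot ((π δ.1).bagAt (q δ.1)) δ.2 := if_pos (lt_of_memb hm)
  rw [this]

/-- The premise `z δ < 3` ensures that the chosen variable is among those known to lie in the bag,
so that its slot is found in the table. It costs nothing, as `conf` tests compatibility for helper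
vertices only. -/
theorem check (hi : 5 < i) (hq : Comp c q) (hz : Comp c z) (hg : Comp c g) (ha : Comp c a) :
    CompP c fun δ => z δ < 3 → (π δ).check K (q δ) (z δ) (g δ) (a δ) := by
  have hc := V.clauseAt hq
  have hj := V.bagAt hq
  have hl := V.lvar hc hz
  have hs := V.slot (by omega) hj hl
  have hw := V.pieceLen hi
  have hlt : ∀ δ, (π δ).arrays hK 4 ((π δ).bagAt (q δ) * (π δ).numVars +
      (π δ).lvar ((π δ).clauseAt (q δ)) (z δ)) % (π δ).pieceLen K < (π δ).numVars + 2 := fun δ =>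
    (Nat.mod_lt _ pieceLen_pos).trans_le ((pieceLen_le _).trans (by omega))
  have hall : CompP c fun δ => ∀ i < 3,
      (π δ).memb ((π δ).bagAt (q δ)) ((π δ).lvar ((π δ).clauseAt (q δ)) i) :=
    CompP.forall_lt (R := fun δ i => (π δ).memb ((π δ).bagAt (q δ))
      ((π δ).lvar ((π δ).clauseAt (q δ)) i)) (.const c 3) (.const _ 3) fun x hx =>
        V.lift.memb hj.lift (V.lift.lvar hc.lift (.index (.const _ 3)))
  refine ((CompP.lt hz (.const c 3)).imp ((CompP.lt hc V.numClauses).imp (hall.imp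
    ((CompP.eq (hs.div hw) hg).imp (CompP.eq (V.bit (by omega) ha (hs.mod hw) hlt)
      (V.lsgn hc hz)))))).congr fun δ => ?_
  refine imp_congr_right fun hz => imp_congr_right fun _ => imp_congr_right fun hm => ?_
  have : (π δ).arrays hK 4 ((π δ).bagAt (q δ) * (π δ).numVars +
      (π δ).lvar ((π δ).clauseAt (q δ)) (z δ)) =
      (π δ).slot ((π δ).bagAt (q δ)) ((π δ).lvar ((π δ).clauseAt (q δ)) (z δ)) :=
    if_pos (lt_of_memb (hm _ hz))
  rw [this]

theorem lastLayer : Comp c fun δ => (π δ).lastLayer :=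
  (V.numBags.add (.const c 2)).mul (V.numClauses.add (.const c 1))

theorem W (hi : 5 < i) : Comp c fun δ => ((π δ).layered K hK).W :=
  V.pow (by omega) (V.pieceLen hi) fun δ => (pieceLen_le _).trans_lt (by omega)

theorem N (hi : 5 < i) : Comp c fun δ => ((π δ).layered K hK).N :=
  (((V.lastLayer.add (.const c 1)).mul (.const c K)).mul (V.W hi)).mul (.const c 4)

theorem va (hi : 5 < i) (ha : Comp c a) : Comp c fun δ => ((π δ).layered K hK).va (a δ) :=
  (ha.div (.const c 4)).mod (V.W hi)

theorem vg (hi : 5 < i) (ha : Comp c a) : Comp c fun δ => ((π δ).layered K hK).vg (a δ) :=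
  ((ha.div (.const c 4)).div (V.W hi)).mod (.const c K)

theorem vq (hi : 5 < i) (ha : Comp c a) : Comp c fun δ => ((π δ).layered K hK).vq (a δ) :=
  ((ha.div (.const c 4)).div (V.W hi)).div (.const c K)

theorem compat (hi : 5 < i) (ha : Comp c a) (hb : Comp c b) :
    CompP c fun δ => Reconf.Layered.vz (a δ) < 3 → ((π δ).layered K hK).compat (a δ) (b δ) := by
  have hz : Comp c fun δ => Reconf.Layered.vz (a δ) := ha.mod (.const c 4)
  have qa := V.vq hi ha
  have qb := V.vq hi hb
  have ga := V.vg hi ha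
  have gb := V.vg hi hb
  have hk := V.keep hi qa ga (V.va hi ha) qb (V.va hi hb)
  have hc := V.check hi qa hz gb (V.va hi hb)
  have h0 := CompP.eq ga (.const c 0)
  have hq0 := CompP.eq qb qa
  have hq1 := CompP.eq qb (qa.add (.const c 1))
  refine ((CompP.lt hz (.const c 3)).imp (((CompP.lt gb ga).imp hq1).and
    (((CompP.lt ga gb).imp hq0).and (((CompP.eq gb ga).imp ((hq0.or hq1).and hk)).and
      (h0.imp (hq0.imp hc)))))).congr fun δ => ?_
  refine imp_congr_right fun hz => and_congr_right fun _ => and_congr_right fun _ =>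
    and_congr_right fun _ => imp_congr_right fun _ => imp_congr_right fun _ => ?_
  exact ⟨fun h => h hz, fun h _ => h⟩

theorem conf (hi : 5 < i) (ha : Comp c a) (hb : Comp c b) :
    CompP c fun δ => ((π δ).layered K hK).conf (a δ) (b δ) := by
  have hza := CompP.lt (f := fun δ => Reconf.Layered.vz (a δ)) (ha.mod (.const c 4)) (.const c 3)
  have hzb := CompP.lt (f := fun δ => Reconf.Layered.vz (b δ)) (hb.mod (.const c 4)) (.const c 3)
  refine ((hza.and hzb).or ((hza.not.and (hzb.not.and (CompP.eq (V.vg hi ha) (V.vg hi hb)))).or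
    (hza.and (hzb.not.and (V.compat hi ha hb).not)))).congr fun δ => ?_
  simp only [Reconf.Layered.conf]
  tauto

theorem enc (hi : 5 < i) (hq : Comp c q) (hg : Comp c g) (ha : Comp c a) (hz : Comp c z) :
    Comp c fun δ => ((π δ).layered K hK).enc (q δ) (g δ) (a δ) (z δ) :=
  (((((hq.mul (.const c K)).add hg).mul (V.W hi)).add ha).mul (.const c 4)).add hz

theorem restConf (hi : 5 < i) (hq : Comp c q) (hf : Comp c f) :
    Comp c fun δ => ((π δ).layered K hK).restConf (q δ) (f δ) :=
  Comp.ite (CompP.lt hf (.const c K)) (V.enc hi hq hf (.const c 0) (.const c 3))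
    (V.enc hi hq (.const c 0) (.const c 0) (.const c 0))

/-- Membership in the rest position. -/
theorem mem_rest (hi : 5 < i) (hq : Comp c q) (hf : Comp c f) :
    CompP c fun δ => ∃ x < K + 1, ((π δ).layered K hK).restConf (q δ) x = f δ :=
  CompP.exists_lt (R := fun δ x => ((π δ).layered K hK).restConf (q δ) x = f δ)
    (.const c (K + 1)) (.const _ _) fun _ _ =>
      CompP.eq (V.lift.restConf hi hq.lift (.index (.const _ _))) hf.lift

end View

end Instance

end PathSat

/-! ### The program of the reduction from satisfiability to reconfiguration. -/

namespace PathSat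

namespace Instance

open RAM

variable {K : ℕ}

open Classical in
theorem mem_confSet_rest {L : Reconf.Layered} {q : ℕ} (hq : q = 0 ∨ q = L.Q) (u : Fin L.N) :
    u ∈ L.confSet (L.restConf q) ↔ ∃ x < L.K + 1, L.restConf q x = u := by
  have hg := Reconf.Layered.restConf_good hq
  simp only [Reconf.Layered.confSet, Finset.mem_image, Finset.mem_range]
  refine exists_congr fun x => and_congr_right fun hx => ?_
  rw [Fin.ext_iff, Reconf.Layered.vtx_val (hg.lt x (by omega))]

theorem encode_source (hK : 0 < K) (I : Instance) {i : ℕ} (hi : i < (I.layered K hK).N) :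
    I.arrays hK 7 i = ind (∃ x < K + 1, (I.layered K hK).restConf 0 x = i) := by
  have h : I.arrays hK 7 i = ((I.layered K hK).inst.encode.getD 1 []).getD i 0 := rfl
  rw [h]
  simp only [Reconf.Instance.encode, List.getD_cons_succ, List.getD_cons_zero]
  rw [List.getD_ofFn_zero, dif_pos (show i < (I.layered K hK).inst.n from hi), ite_eq_ind]
  exact congrArg ind (propext (mem_confSet_rest (Or.inl rfl) ⟨i, hi⟩))

theorem encode_target (hK : 0 < K) (I : Instance) {i : ℕ} (hi : i < (I.layered K hK).N) :
    I.arrays hK 8 i = ind (∃ x < K + 1, (I.layered K hK).restConf I.lastLayer x = i) := by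
  have h : I.arrays hK 8 i = ((I.layered K hK).inst.encode.getD 2 []).getD i 0 := rfl
  rw [h]
  simp only [Reconf.Instance.encode, List.getD_cons_succ, List.getD_cons_zero]
  rw [List.getD_ofFn_zero, dif_pos (show i < (I.layered K hK).inst.n from hi), ite_eq_ind]
  exact congrArg ind (propext (mem_confSet_rest (Or.inr rfl) ⟨i, hi⟩))

theorem encode_adj (hK : 0 < K) (I : Instance) {i : ℕ}
    (hi : i < (I.layered K hK).N * (I.layered K hK).N) :
    I.arrays hK 9 i = ind (i / (I.layered K hK).N ≠ i % (I.layered K hK).N ∧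
      ((I.layered K hK).conf (i / (I.layered K hK).N) (i % (I.layered K hK).N) ∨
        (I.layered K hK).conf (i % (I.layered K hK).N) (i / (I.layered K hK).N))) := by
  have h : I.arrays hK 9 i = (List.ofFn fun q : Fin ((I.layered K hK).N * (I.layered K hK).N) =>
      open Classical in
      if (I.layered K hK).graph.Adj q.divNat q.modNat then 1 else 0).getD i 0 := rfl
  rw [h, List.getD_ofFn_zero, dif_pos hi, ite_eq_ind]
  refine congrArg ind (propext ?_)
  simp only [Reconf.Layered.graph, ne_eq, Fin.ext_iff, Fin.coe_divNat, Fin.coe_modNat]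

theorem arrays_zero (hK : 0 < K) (a : ℕ) (h3 : 3 ≤ a) (h10 : a < 10) (I : Instance) (i : ℕ)
    (hi : arrayLen hK a I ≤ i) : I.arrays hK a i = 0 := by
  have hnot := not_lt.2 hi
  interval_cases a
  · exact if_neg hnot
  · exact if_neg hnot
  · exact if_neg hnot
  · change [(I.layered K hK).N, K + 1, 2 * ((I.layered K hK).Q * K)].getD i 0 = 0
    rw [List.getD_eq_default _ _ hi]
  · exact List.getD_eq_default _ _ ((le_of_eq List.length_ofFn).trans hi)
  · exact List.getD_eq_default _ _ ((le_of_eq List.length_ofFn).trans hi)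
  · exact List.getD_eq_default _ _ ((le_of_eq List.length_ofFn).trans hi)

/-- What the running time of the reduction is compared to, up to polynomial factors. -/
noncomputable def tableSize (K : ℕ) (I : Instance) : ℕ := 2 ^ I.pieceLen K * 2 ^ I.pieceLen K

/-- The number of values of a piece enters the number of vertices linearly; layers, pieces and kinds
contribute a polynomial factor. -/
theorem N_le (hK : 0 < K) : ∃ D, ∀ I : Instance,
    (I.layered K hK).N ≤ 2 ^ I.pieceLen K * (I.size + 2) ^ D := by
  have hs : PolyBdd Instance.size Instance.size := PolyBdd.self _
  have hc := PolyBdd.const Instance.size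
  have h : PolyBdd Instance.size fun I : Instance => (I.lastLayer + 1) * K * 4 :=
    ((((((hs.add (hc 2)).mul (hs.add (hc 1))).mono (f := fun I : Instance => I.lastLayer)
      fun I => Nat.mul_le_mul (by rw [Instance.size]; omega) (by rw [Instance.size]; omega)).add
        (hc 1)).mul (hc K)).mul (hc 4))
  obtain ⟨D, hD⟩ := h
  refine ⟨D, fun I => ?_⟩
  calc (I.layered K hK).N = 2 ^ I.pieceLen K * ((I.lastLayer + 1) * K * 4) := by
        simp only [Reconf.Layered.N, layered]; ring
    _ ≤ _ := Nat.mul_le_mul_left _ (hD I)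

/-- The longest array is the adjacency matrix, whose length is `tableSize` up to a polynomial
factor; every single entry takes polynomial time. -/
theorem exists_fill (hK : 0 < K) : ∃ (p : Prog) (R : ℕ) (T : Instance → ℕ),
    PolyBdd Instance.size T ∧ ∀ (I : Instance) s, s.arr = stage (fun I => I.arrays hK) 3 I →
      ∃ t s', Exec p s t s' ∧ s'.arr = stage (fun I => I.arrays hK) 10 I ∧
        (∀ x ≥ R, s'.reg x = s.reg x) ∧ t ≤ (tableSize K I + 1) * T I := by
  have hself : PolyBdd Instance.size Instance.size := PolyBdd.self _
  have hc := PolyBdd.const Instance.size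
  refine (fill_all (cnt := tableSize K) (len := arrayLen hK) (i₀ := 3) (N := 10) ?_
    (fun a h3 h10 I i => arrays_zero hK a h3 h10 I i) ?_ ?_ ?_ 10 (by omega) le_rfl).2
  · intro a ha
    have key : ∀ I : Instance, ∀ x ∈ [I.inp 0, I.inp 1, I.inp 2], ∀ j, (x j) ≤ 2 * I.size + 2 := by
      intro I x hx j
      simp only [List.mem_cons, List.not_mem_nil, or_false] at hx
      rcases hx with rfl | rfl | rfl
      · simp only [inp, Instance.encode, List.getD_cons_zero]
        rcases j with _ | _ | _ | j <;> simp [Instance.size] <;> omega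
      · simp only [inp, Instance.encode, List.getD_cons_succ, List.getD_cons_zero]
        rw [List.getD_ofFn_zero]
        split_ifs with h
        · have h1 := (I.formula (Fin.divNat ⟨j, h⟩) (Fin.modNat ⟨j, h⟩)).1.isLt
          have h2 := Bool.toNat_lt (I.formula (Fin.divNat ⟨j, h⟩) (Fin.modNat ⟨j, h⟩)).2
          rw [Instance.size]
          omega
        · omega
      · simp only [inp, Instance.encode, List.getD_cons_succ, List.getD_cons_zero]
        rw [List.getD_ofFn_zero]
        split_ifs <;> omega
    obtain ⟨D, hD⟩ := (((hc 2).mul hself).add (hc 2)).natSize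
    refine ⟨D, fun I j => (Nat.size_le_size (?_ : _ ≤ 2 * I.size + 2)).trans (hD I)⟩
    interval_cases a
    · exact key I (I.inp 0) (by simp) j
    · exact key I (I.inp 1) (by simp) j
    · exact key I (I.inp 2) (by simp) j
  · intro a h3 h10
    obtain ⟨D, hD⟩ := N_le hK
    have small : ∀ {f : Instance → ℕ}, PolyBdd Instance.size f →
        ∃ D, ∀ I, f I ≤ (tableSize K I + 1) * (I.size + 2) ^ D := fun hf =>
      hf.imp fun D hD I => (hD I).trans (Nat.le_mul_of_pos_left _ (by omega))
    have hN : ∃ D, ∀ I : Instance, (I.layered K hK).N ≤ (tableSize K I + 1) * (I.size + 2) ^ D := by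
      refine ⟨D, fun I => (hD I).trans (Nat.mul_le_mul_right _ ?_)⟩
      have : 2 ^ I.pieceLen K * 1 ≤ 2 ^ I.pieceLen K * 2 ^ I.pieceLen K :=
        Nat.mul_le_mul_left _ (by have := Nat.one_le_two_pow (n := I.pieceLen K); omega)
      rw [tableSize]; omega
    interval_cases a
    · exact small ((hself.add (hc 2)).mono fun I => by simp only [arrayLen, Instance.size]; omega)
    · exact small (((hself.add (hc 1)).mul hself).mono fun I => Nat.mul_le_mul
        (by rw [Instance.size]; omega) (by rw [Instance.size]; omega))
    · exact small (hc 1)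
    · exact small (hc 3)
    · exact hN
    · exact hN
    · refine ⟨D + D, fun I => ?_⟩
      calc (I.layered K hK).N * (I.layered K hK).N
          ≤ (2 ^ I.pieceLen K * (I.size + 2) ^ D) * (2 ^ I.pieceLen K * (I.size + 2) ^ D) :=
            Nat.mul_le_mul (hD I) (hD I)
        _ = tableSize K I * (I.size + 2) ^ (D + D) := by rw [tableSize, pow_add]; ring
        _ ≤ _ := Nat.mul_le_mul_right _ (by omega)
  · intro a h3 h10 c hsize hk
    have V : View hK c id a := ⟨hk, fun I => by rw [hsize]; rfl, h3⟩
    interval_cases a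
    · exact V.numVars.add (.const c 2)
    · exact (V.numBags.add (.const c 1)).mul V.numVars
    · exact .const c 1
    · exact .const c 3
    · exact V.N (by omega)
    · exact V.N (by omega)
    · exact (V.N (by omega)).mul (V.N (by omega))
  · intro a h3 h10 c hsize hk hself' hidx
    have V : View hK c Sigma.fst a := ⟨hk, fun I => by rw [hsize], h3⟩
    interval_cases a
    · have hread : Comp c fun δ => trunc (δ.1.arrays hK 3) δ.2 (δ.2 - 1) := by
        refine Comp.load (a := 3) (m := fun δ => trunc (δ.1.arrays hK 3) δ.2)
          (fun δ i => by rw [hself']) ?_ (hidx.sub (.const c 1))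
        refine ((V.bdd_numVars).add (PolyBdd.const _ 3)).imp fun D hD δ i => le_trans ?_ (hD δ)
        rw [Nat.size_le]
        simp only [trunc, arrays]
        split_ifs
        · exact Nat.pow_lt_pow_right (by omega) (by omega)
        · positivity
        · positivity
      refine (Comp.ite (CompP.eq hidx (.const c 0)) (.const c 1) ((Comp.const c 2).mul hread)).congr
        fun δ => ?_
      have hlt : (δ.2 : ℕ) < δ.1.numVars + 2 := δ.2.isLt
      simp only [arrays, trunc, hlt, if_true]
      have h2 : ((δ.2 : ℕ) ≠ 0 → (δ.2 : ℕ) - 1 < δ.2) ∧ (δ.2 : ℕ) - 1 < δ.1.numVars + 2 := by omega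
      split_ifs with h1
      · simp [h1]
      · rw [← pow_succ', Nat.sub_add_cancel (by omega)]
      · omega
      · omega
    · refine (V.slotStep (T := fun δ => trunc δ.1.slotTable δ.2) (fun δ i => ?_) ?_ hidx).congr
        fun δ => ?_
      · have hlt : (δ.2 : ℕ) < (δ.1.numBags + 1) * δ.1.numVars := δ.2.isLt
        rw [hself']
        simp only [trunc, arrays]
        split_ifs
        · rfl
        · omega
        · rfl
      · refine V.bdd_numVars.natSize.imp fun D hD δ i => (Nat.size_le_size ?_).trans (hD δ)
        simp only [trunc]
        split_ifs
        · exact slotTable_le i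
        · omega
      · have hlt : (δ.2 : ℕ) < (δ.1.numBags + 1) * δ.1.numVars := δ.2.isLt
        simp only [arrays]
        rw [trunc, if_pos hlt, slotTable, entry_eq]
    · refine ((V.maxBag.div (.const c K)).add (.const c 1)).congr fun δ => ?_
      have hlt : (δ.2 : ℕ) < 1 := δ.2.isLt
      simp only [arrays, trunc, hlt, if_true]
      rfl
    · refine (Comp.ite (CompP.eq hidx (.const c 0)) (V.N (by omega)) (Comp.ite
        (CompP.eq hidx (.const c 1)) (.const c (K + 1))
          ((Comp.const c 2).mul (V.lastLayer.mul (.const c K))))).congr fun δ => ?_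
      obtain ⟨I, i⟩ := δ
      change (if (i : ℕ) = 0 then (I.layered K hK).N else if (i : ℕ) = 1 then K + 1 else
        2 * (I.lastLayer * K)) = [(I.layered K hK).N, K + 1, 2 * (I.lastLayer * K)].getD i 0
      have hlt : (i : ℕ) < 3 := i.isLt
      generalize (i : ℕ) = x at hlt
      interval_cases x <;> rfl
    · exact Comp.congr (V.mem_rest (by omega) (.const c 0) hidx) fun δ =>
        (encode_source hK δ.1 δ.2.isLt).symm
    · exact Comp.congr (V.mem_rest (by omega) V.lastLayer hidx) fun δ =>
        (encode_target hK δ.1 δ.2.isLt).symm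
    · have hN := V.N (by omega)
      have hd := hidx.div hN
      have hm := hidx.mod hN
      exact Comp.congr ((CompP.eq hd hm).not.and ((V.conf (by omega) hd hm).or
        (V.conf (by omega) hm hd))) fun δ => (encode_adj hK δ.1 δ.2.isLt).symm

/-- Path-decomposed satisfiability is decided by reduction to reconfiguration. -/
theorem exists_reduction (hK : 0 < K) (q : Prog) : ∃ (p : Prog) (D : ℕ),
    ∀ (I : Instance) (bound : ℝ),
      Decides q (I.layered K hK).inst.encode (I.layered K hK).inst.Answer bound →
      Decides p I.encode I.formula.Satisfiable
        (((tableSize K I : ℝ) + 1) * ((I.size : ℝ) + 2) ^ D + 2 * bound + 3) := by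
  obtain ⟨p, D, h⟩ := decides_of_fill (input := fun I : Instance => I.encode)
    (enc := fun I : Instance => (I.layered K hK).inst.encode) (A := 6) (fun _ => le_rfl)
    (fun I a ha j => by interval_cases a <;> rfl) (fun _ => le_rfl)
    (fun I a _ j => by rw [Nat.add_comm 6 a]; rfl) (exists_fill hK) q
  refine ⟨p, D, fun I bound hb => ?_⟩
  rw [answer_iff_satisfiable] at hb
  exact h I _ bound hb

end Instance

end PathSat

/-! ### Running times: fast reconfiguration refutes the PP-SETH. -/

theorem RAM.Decides.mono {p : Prog} {input : List (List ℕ)} {ans : Prop} {b b' : ℝ}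
    (h : Decides p input ans b) (hb : b ≤ b') : Decides p input ans b' := by
  obtain ⟨t, s, he, ht, ha⟩ := h
  exact ⟨t, s, he, ht.trans hb, ha⟩

namespace PathSat

open RAM

/-- The piece length exceeds `width / K` by at most two: one for the summand in `pieceLen`, and at
most one because a bag may have `width + 1` elements. -/
theorem Instance.two_pow_pieceLen_le {K : ℕ} (hK : 0 < K) (I : Instance) :
    (2 : ℝ) ^ I.pieceLen K ≤ 4 * (2 : ℝ) ^ ((width I.bag : ℝ) / K) := by
  have hK' : (1 : ℝ) ≤ K := by exact_mod_cast hK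
  have h1 : (I.pieceLen K : ℝ) ≤ (width I.bag : ℝ) / K + 2 := by
    have h2 : ((I.maxBag / K : ℕ) : ℝ) ≤ (I.maxBag : ℝ) / K := Nat.cast_div_le
    have h3 : (I.maxBag : ℝ) ≤ width I.bag + 1 := by exact_mod_cast Instance.maxBag_le
    have h4 : (I.maxBag : ℝ) / K ≤ (width I.bag + 1) / K := by gcongr
    have h5 : ((width I.bag : ℝ) + 1) / K ≤ (width I.bag : ℝ) / K + 1 := by
      rw [add_div]
      have : (1 : ℝ) / K ≤ 1 := by rw [div_le_one (by linarith)]; exact hK'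
      linarith
    have h6 : (I.pieceLen K : ℝ) = ((I.maxBag / K : ℕ) : ℝ) + 1 := by
      rw [Instance.pieceLen]; push_cast; ring
    linarith
  calc (2 : ℝ) ^ I.pieceLen K = (2 : ℝ) ^ (I.pieceLen K : ℝ) := (Real.rpow_natCast _ _).symm
    _ ≤ (2 : ℝ) ^ ((width I.bag : ℝ) / K + 2) := Real.rpow_le_rpow_of_exponent_le (by norm_num) h1
    _ = _ := by
      rw [Real.rpow_add (by norm_num), show (2 : ℝ) ^ (2 : ℝ) = 4 by norm_num]; ring

/-- With `K = k - 1` data tokens the graph has `2 ^ (pw / K)` vertices up to polynomial factors, so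
the assumed algorithm takes `2 ^ ((1 - ε / K) * pw)`. Building the graph takes `2 ^ (2 * pw / K)`,
which is at most `2 ^ (2 * pw / 3)` since `k ≥ 4`. -/
theorem not_PPSETH_of_reconf {ε : ℝ} {k : ℕ} (hε : 0 < ε) (hk : 4 ≤ k) {q : Prog} {C : ℝ} {c : ℕ}
    (h : ∀ I : Reconf.Instance k, Decides q I.encode I.Answer
      (C * (I.n : ℝ) ^ ((k : ℝ) - 1 - ε) * ((I.len : ℝ) + 1) ^ c)) : ¬ PPSETH := by
  obtain ⟨K, rfl⟩ : ∃ K, k = K + 1 := ⟨k - 1, by omega⟩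
  have hK3 : 3 ≤ K := by omega
  have hK : 0 < K := by omega
  have hKr : (3 : ℝ) ≤ K := by exact_mod_cast hK3
  -- The gain is capped at one so that the exponent `K - η` stays nonnegative and powers are
  -- monotone in the base.
  set η : ℝ := min ε 1 with hη
  have hη0 : 0 < η := lt_min hε one_pos
  have hη1 : η ≤ 1 := min_le_right _ _
  obtain ⟨p, D₁, hp⟩ := Instance.exists_reduction hK q
  obtain ⟨D₂, hN⟩ := Instance.N_le hK
  obtain ⟨E, hE⟩ : PolyBdd Instance.size fun I => 2 * (I.lastLayer * K) + 1 := by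
    have hs : PolyBdd Instance.size Instance.size := PolyBdd.self _
    have hc := PolyBdd.const Instance.size
    exact ((hc 2).mul ((((hs.add (hc 2)).mul (hs.add (hc 1))).mono
      (f := fun I : Instance => I.lastLayer) fun I => Nat.mul_le_mul
        (by rw [Instance.size]; omega) (by rw [Instance.size]; omega)).mul (hc K))).add (hc 1)
  -- The two terms pay for building the graph and for running the algorithm on it; the new base is
  -- `2 ^ β`.
  set β : ℝ := max (2 / 3) (1 - η / K) with hβ
  have hβ1 : β < 1 := max_lt (by norm_num) (by
    have : 0 < η / K := by positivity
    linarith)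
  have hβ0 : 0 < β := lt_max_of_lt_left (by norm_num)
  have hb1 : (1 : ℝ) < 2 ^ β := Real.one_lt_rpow (by norm_num) hβ0
  have hb2 : (2 : ℝ) ^ β < 2 := by
    calc (2 : ℝ) ^ β < 2 ^ (1 : ℝ) := Real.rpow_lt_rpow_of_exponent_lt (by norm_num) hβ1
      _ = 2 := Real.rpow_one 2
  let M : ℕ := D₁ + D₂ * K + E * c
  unfold PPSETH
  push Not
  refine ⟨2 - 2 ^ β, by linarith, by linarith, p, (20 + 2 * (|C| * 4 ^ K)) * 2 ^ M, M, fun I => ?_⟩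
  have hn1 : (1 : ℝ) ≤ (I.layered K hK).N := by
    exact_mod_cast (Reconf.Layered.N_pos (L := I.layered K hK))
  refine (hp I _ ((h (I.layered K hK).inst).mono (b' := |C| *
    ((I.layered K hK).N : ℝ) ^ ((K : ℝ) - η) * ((I.size : ℝ) + 2) ^ (E * c)) ?_)).mono ?_
  · have e1 : (((I.layered K hK).inst.len : ℝ) + 1) ^ c ≤ ((I.size : ℝ) + 2) ^ (E * c) := by
      rw [pow_mul]
      refine pow_le_pow_left₀ (by positivity) ?_ c
      exact_mod_cast hE I
    have e2 : ((I.layered K hK).inst.n : ℝ) ^ (((K + 1 : ℕ) : ℝ) - 1 - ε) ≤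
        ((I.layered K hK).N : ℝ) ^ ((K : ℝ) - η) := by
      refine Real.rpow_le_rpow_of_exponent_le hn1 ?_
      have := min_le_left ε 1
      push_cast
      linarith
    have e3 : C * ((I.layered K hK).inst.n : ℝ) ^ (((K + 1 : ℕ) : ℝ) - 1 - ε) ≤
        |C| * ((I.layered K hK).N : ℝ) ^ ((K : ℝ) - η) :=
      mul_le_mul (le_abs_self C) e2 (by positivity) (abs_nonneg C)
    exact mul_le_mul e3 e1 (by positivity) (by positivity)
  · set U : ℝ := (2 : ℝ) ^ ((width I.bag : ℝ) / K) with hU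
    set S : ℝ := (I.size : ℝ) + 2 with hS
    have hS1 : 1 ≤ S := by
      have : (0 : ℝ) ≤ I.size := Nat.cast_nonneg _
      linarith
    have hU1 : 1 ≤ U := Real.one_le_rpow (by norm_num) (by positivity)
    have hw := Instance.two_pow_pieceLen_le hK I
    set X : ℝ := (2 - (2 - (2 : ℝ) ^ β)) ^ width I.bag with hX
    have hX' : X = (2 : ℝ) ^ (β * width I.bag) := by
      rw [hX, sub_sub_cancel, ← Real.rpow_natCast, ← Real.rpow_mul (by norm_num)]
    have hX1 : 1 ≤ X := by
      rw [hX']; exact Real.one_le_rpow (by norm_num) (by positivity)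
    have hpw : (0 : ℝ) ≤ width I.bag := Nat.cast_nonneg _
    have t1 : (Instance.tableSize K I : ℝ) ≤ 16 * X := by
      have hUU : U * U ≤ X := by
        rw [hX', hU, ← Real.rpow_add (by norm_num)]
        refine Real.rpow_le_rpow_of_exponent_le (by norm_num) ?_
        have h1 : (width I.bag : ℝ) / K ≤ width I.bag / 3 := by gcongr
        have h2 : 2 / 3 * (width I.bag : ℝ) ≤ β * width I.bag :=
          mul_le_mul_of_nonneg_right (le_max_left _ _) hpw
        linarith
      have h3 : (Instance.tableSize K I : ℝ) = 2 ^ I.pieceLen K * 2 ^ I.pieceLen K := by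
        rw [Instance.tableSize]; push_cast; ring
      have h4 := mul_le_mul hw hw (by positivity) (by positivity)
      rw [h3]
      linarith
    have t2 : ((I.layered K hK).N : ℝ) ^ ((K : ℝ) - η) ≤ 4 ^ K * X * S ^ (D₂ * K) := by
      have hNr : ((I.layered K hK).N : ℝ) ≤ 4 * U * S ^ D₂ := by
        have h1 : ((I.layered K hK).N : ℝ) ≤ 2 ^ I.pieceLen K * S ^ D₂ := by
          rw [hS]; exact_mod_cast hN I
        exact h1.trans (mul_le_mul_of_nonneg_right hw (by positivity))
      have hle : ∀ x : ℝ, 1 ≤ x → x ^ ((K : ℝ) - η) ≤ x ^ K := fun x hx => by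
        rw [← Real.rpow_natCast x K]
        exact Real.rpow_le_rpow_of_exponent_le hx (by linarith)
      have hUX : U ^ ((K : ℝ) - η) ≤ X := by
        rw [hX', hU, ← Real.rpow_mul (by norm_num)]
        refine Real.rpow_le_rpow_of_exponent_le (by norm_num) ?_
        have h1 : (width I.bag : ℝ) / K * (K - η) = (1 - η / K) * width I.bag := by
          field_simp
        rw [h1]
        exact mul_le_mul_of_nonneg_right (le_max_right _ _) hpw
      calc ((I.layered K hK).N : ℝ) ^ ((K : ℝ) - η) ≤ (4 * U * S ^ D₂) ^ ((K : ℝ) - η) :=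
            Real.rpow_le_rpow (by positivity) hNr (by linarith)
        _ = 4 ^ ((K : ℝ) - η) * U ^ ((K : ℝ) - η) * (S ^ D₂) ^ ((K : ℝ) - η) := by
            rw [Real.mul_rpow (by positivity) (by positivity),
              Real.mul_rpow (by positivity) (by positivity)]
        _ ≤ 4 ^ K * X * (S ^ D₂) ^ K := by
            refine mul_le_mul (mul_le_mul (hle 4 (by norm_num)) hUX (by positivity)
              (by positivity)) (hle _ (one_le_pow₀ hS1)) (by positivity) (by positivity)
        _ = _ := by rw [← pow_mul]
    have hSM : ∀ d ≤ M, S ^ d ≤ S ^ M := fun d hd => pow_le_pow_right₀ hS1 hd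
    have hSM1 : 1 ≤ S ^ M := one_le_pow₀ hS1
    have hXS : 1 ≤ X * S ^ M := one_le_mul_of_one_le_of_one_le hX1 hSM1
    have b1 : ((Instance.tableSize K I : ℝ) + 1) * S ^ D₁ ≤ 17 * (X * S ^ M) := by
      calc ((Instance.tableSize K I : ℝ) + 1) * S ^ D₁ ≤ (17 * X) * S ^ M :=
            mul_le_mul (by linarith) (hSM _ (by simp only [M]; omega)) (by positivity)
              (by positivity)
        _ = _ := by ring
    have b2 : |C| * ((I.layered K hK).N : ℝ) ^ ((K : ℝ) - η) * S ^ (E * c) ≤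
        (|C| * 4 ^ K) * (X * S ^ M) := by
      calc |C| * ((I.layered K hK).N : ℝ) ^ ((K : ℝ) - η) * S ^ (E * c)
          ≤ |C| * (4 ^ K * X * S ^ (D₂ * K)) * S ^ (E * c) := by gcongr
        _ = (|C| * 4 ^ K) * (X * S ^ (D₂ * K + E * c)) := by rw [pow_add]; ring
        _ ≤ _ := by
          refine mul_le_mul_of_nonneg_left (mul_le_mul_of_nonneg_left (hSM _ ?_) (by positivity))
            (by positivity)
          simp only [M]; omega
    have b3 : S ^ M ≤ 2 ^ M * ((I.size : ℝ) + 1) ^ M := by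
      rw [← mul_pow]
      refine pow_le_pow_left₀ (by positivity) ?_ M
      have : (0 : ℝ) ≤ I.size := Nat.cast_nonneg _
      linarith
    calc _ ≤ (20 + 2 * (|C| * 4 ^ K)) * (X * S ^ M) := by linarith
      _ ≤ (20 + 2 * (|C| * 4 ^ K)) * (X * (2 ^ M * ((I.size : ℝ) + 1) ^ M)) := by gcongr
      _ = _ := by ring

end PathSat

/-! ### Reconfiguration sequences as queues of tokens. -/

namespace Reconf

theorem Reachable.succ {V : Type*} [DecidableEq V] {G : SimpleGraph V} {S A B : Finset V} {l : ℕ}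
    (h : Reachable G S A l) (hAB : A = B ∨ TokenJump G A B) : Reachable G S B (l + 1) := by
  obtain ⟨r, hr, P, h0, hP, hstep⟩ := h
  rcases hAB with rfl | hj
  · exact ⟨r, by omega, P, h0, hP, hstep⟩
  · refine ⟨r + 1, by omega, fun i => if i ≤ r then P i else B, by simp [h0], by simp,
      fun i hi => ?_⟩
    rcases Nat.lt_succ_iff_lt_or_eq.1 hi with hlt | rfl
    · have : i + 1 ≤ r := hlt
      simp only [hlt.le, this, if_true]
      exact hstep i hlt
    · simp only [le_refl, if_true, hP]
      simpa using hj

namespace Instance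

variable {k : ℕ} (J : Instance k)

/-- The tokens `u` and `v` may not lie in the set at time `e` together; `last` is the time of the
target. -/
def Forbidden (last e u v : ℕ) : Prop :=
  J.n ≤ u ∨ J.n ≤ v ∨ u = v ∨ (∃ a b : Fin J.n, (a : ℕ) = u ∧ (b : ℕ) = v ∧ J.graph.Adj a b) ∨
    (e = 0 ∧ ¬ ∃ a ∈ J.source, (a : ℕ) = u) ∨ (e = last ∧ ¬ ∃ a ∈ J.target, (a : ℕ) = u)

/-- A queue of tokens: the current set consists of `k` consecutive tokens; in every step the first
token is removed and a new one appended, which agrees with the removed one up to one exception in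
every block of `k` steps. -/
structure Queue (f : ℕ → ℕ) : Prop where
  window : ∀ e ≤ J.len * k, ∀ g < k, ∀ h < k, g ≠ h →
    ¬ J.Forbidden (J.len * k) e (f (e + g)) (f (e + h))
  change : ∀ e₁ e₂, e₁ < e₂ → e₂ < J.len * k → e₁ / k = e₂ / k → f e₁ ≠ f (e₁ + k) →
    f e₂ = f (e₂ + k)

variable {J}

/-- Every window is an independent set, and a step either leaves the set alone or is a token jump.
At most one step of a block is a jump, so the sets at the block boundaries form a sequence of at
most `len` moves. At least two tokens are needed, since conditions on a single token are only
expressed through pairs. -/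
theorem Queue.answer {f : ℕ → ℕ} (hk : 2 ≤ k) (hf : J.Queue f) : J.Answer := by
  have hother : ∀ g < k, ∃ h < k, g ≠ h := fun g _ =>
    if hg : g = 0 then ⟨1, by omega, by omega⟩ else ⟨0, by omega, hg⟩
  have hlt : ∀ e ≤ J.len * k, ∀ g < k, f (e + g) < J.n := by
    intro e he g hg
    obtain ⟨h, hh, hne⟩ := hother g hg
    by_contra hn
    exact hf.window e he g hg h hh hne (Or.inl (not_lt.1 hn))
  have hinj : ∀ e ≤ J.len * k, ∀ g < k, ∀ h < k, f (e + g) = f (e + h) → g = h := by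
    intro e he g hg h hh heq
    by_contra hne
    exact hf.window e he g hg h hh hne (Or.inr (Or.inr (Or.inl heq)))
  obtain ⟨A, hmem⟩ : ∃ A : ℕ → Finset (Fin J.n), ∀ e v, v ∈ A e ↔ ∃ g < k, f (e + g) = v := by
    classical
    exact ⟨fun e => Finset.univ.filter fun v => ∃ g < k, f (e + g) = v, by simp⟩
  have hcard : ∀ e ≤ J.len * k, (A e).card = k := by
    intro e he
    have himg : (A e).map Fin.valEmbedding = (Finset.range k).image fun g => f (e + g) := by
      ext x
      simp only [Finset.mem_map, Finset.mem_image, Finset.mem_range, hmem, Fin.valEmbedding_apply]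
      constructor
      · rintro ⟨v, ⟨g, hg, hv⟩, rfl⟩
        exact ⟨g, hg, hv⟩
      · rintro ⟨g, hg, rfl⟩
        exact ⟨⟨_, hlt e he g hg⟩, ⟨g, hg, rfl⟩, rfl⟩
    rw [← Finset.card_map, himg, Finset.card_image_of_injOn, Finset.card_range]
    intro g hg h hh heq
    exact hinj e he g (Finset.mem_range.1 hg) h (Finset.mem_range.1 hh) heq
  have h0 : A 0 = J.source := by
    refine Finset.eq_of_subset_of_card_le (fun v hv => ?_) (by
      rw [hcard 0 (by omega), J.card_source])
    obtain ⟨g, hg, hv⟩ := (hmem 0 v).1 hv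
    obtain ⟨h, hh, hne⟩ := hother g hg
    by_contra hn
    refine hf.window 0 (by omega) g hg h hh hne
      (Or.inr (Or.inr (Or.inr (Or.inr (Or.inl ⟨rfl, ?_⟩)))))
    rintro ⟨a, ha, hav⟩
    obtain rfl : a = v := Fin.ext (hav.trans hv)
    exact hn ha
  have hlast : A (J.len * k) = J.target := by
    refine Finset.eq_of_subset_of_card_le (fun v hv => ?_) (by
      rw [hcard _ le_rfl, J.card_target])
    obtain ⟨g, hg, hv⟩ := (hmem _ v).1 hv
    obtain ⟨h, hh, hne⟩ := hother g hg
    by_contra hn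
    refine hf.window _ le_rfl g hg h hh hne
      (Or.inr (Or.inr (Or.inr (Or.inr (Or.inr ⟨rfl, ?_⟩)))))
    rintro ⟨a, ha, hav⟩
    obtain rfl : a = v := Fin.ext (hav.trans hv)
    exact hn ha
  have hindep : ∀ e ≤ J.len * k, J.graph.IsIndepSet (A e : Set (Fin J.n)) := by
    intro e he u hu v hv huv hadj
    obtain ⟨g, hg, hu⟩ := (hmem e u).1 hu
    obtain ⟨h, hh, hv⟩ := (hmem e v).1 hv
    have hne : g ≠ h := by rintro rfl; exact huv (Fin.ext (hu.symm.trans hv))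
    exact hf.window e he g hg h hh hne
      (Or.inr (Or.inr (Or.inr (Or.inl ⟨u, v, hu.symm, hv.symm, hadj⟩))))
  have hsame : ∀ e, f e = f (e + k) → A (e + 1) = A e := by
    intro e he
    ext v
    rw [hmem, hmem]
    constructor
    · rintro ⟨g, hg, hv⟩
      by_cases hgk : g + 1 = k
      · exact ⟨0, by omega, by rw [add_zero, he, ← hv]; congr 1; omega⟩
      · exact ⟨g + 1, by omega, by rw [← hv]; congr 1; omega⟩
    · rintro ⟨g, hg, hv⟩
      rcases g with _ | g
      · exact ⟨k - 1, by omega, by rw [← hv, add_zero, he]; congr 1; omega⟩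
      · exact ⟨g, by omega, by rw [← hv]; congr 1; omega⟩
  have hjump : ∀ e < J.len * k, f e ≠ f (e + k) → TokenJump J.graph (A e) (A (e + 1)) := by
    intro e he hne
    have l0 := hlt e he.le 0 (by omega)
    have l1 := hlt (e + 1) he (k - 1) (by omega)
    have ek : e + 1 + (k - 1) = e + k := by omega
    rw [ek] at l1
    refine ⟨hindep (e + 1) he, ⟨_, l0⟩, (hmem e _).2 ⟨0, by omega, rfl⟩, ⟨_, l1⟩, fun hm => ?_, ?_⟩
    · obtain ⟨g, hg, hv⟩ := (hmem e _).1 hm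
      simp only at hv
      rcases g with _ | g
      · exact hne hv
      · have := hinj (e + 1) he g (by omega) (k - 1) (by omega) (by
          rw [ek, ← hv]; congr 1; omega)
        omega
    · ext v
      rw [Finset.mem_insert, Finset.mem_erase, hmem, hmem]
      simp only [Fin.ext_iff, ne_eq]
      constructor
      · rintro ⟨g, hg, hv⟩
        by_cases hgk : g + 1 = k
        · left
          rw [← hv]; congr 1; omega
        · right
          refine ⟨fun h => ?_, g + 1, by omega, by rw [← hv]; congr 1; omega⟩
          have := hinj e he.le (g + 1) (by omega) 0 (by omega) (by
            rw [← h, ← hv]; congr 1; omega)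
          omega
      · rintro (hv | ⟨hv, g, hg, hg'⟩)
        · exact ⟨k - 1, by omega, by rw [hv, ek]⟩
        · rcases g with _ | g
          · exact absurd hg'.symm hv
          · exact ⟨g, by omega, by rw [← hg']; congr 1; omega⟩
  have hblock : ∀ τ < J.len, A (τ * k) = A ((τ + 1) * k) ∨
      TokenJump J.graph (A (τ * k)) (A ((τ + 1) * k)) := by
    intro τ hτ
    have hle : τ * k + k ≤ J.len * k := by
      have := Nat.mul_le_mul_right k hτ
      rwa [Nat.succ_mul] at this
    -- Within a block the set stays as it was until the exceptional step, and after it remains one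
    -- jump away from the start.
    have key : ∀ i ≤ k, (A (τ * k) = A (τ * k + i) ∧
        ∀ j < i, f (τ * k + j) = f (τ * k + j + k)) ∨
        (TokenJump J.graph (A (τ * k)) (A (τ * k + i)) ∧
          ∃ j < i, f (τ * k + j) ≠ f (τ * k + j + k)) := by
      intro i hi
      induction i with
      | zero => exact Or.inl ⟨rfl, fun j hj => absurd hj (by omega)⟩
      | succ i ih =>
        by_cases he : f (τ * k + i) = f (τ * k + i + k)
        · rcases ih (by omega) with ⟨h1, h2⟩ | ⟨h1, j, hj, h2⟩
          · refine Or.inl ⟨by rw [h1, ← add_assoc, hsame _ he], fun j hj => ?_⟩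
            rcases Nat.lt_succ_iff_lt_or_eq.1 hj with hj | rfl
            · exact h2 j hj
            · exact he
          · exact Or.inr ⟨by rw [← add_assoc, hsame _ he]; exact h1, j, by omega, h2⟩
        · rcases ih (by omega) with ⟨h1, h2⟩ | ⟨h1, j, hj, h2⟩
          · refine Or.inr ⟨?_, i, by omega, he⟩
            rw [h1, ← add_assoc]
            exact hjump _ (by omega) he
          · refine absurd (hf.change (τ * k + j) (τ * k + i) (by omega) (by omega) ?_ h2) he
            have hdiv : ∀ y < k, (τ * k + y) / k = τ := fun y hy => by
              rw [Nat.add_comm, Nat.add_mul_div_right _ _ (by omega), Nat.div_eq_of_lt hy, zero_add]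
            rw [hdiv j (by omega), hdiv i (by omega)]
    have e1 : (τ + 1) * k = τ * k + k := Nat.succ_mul _ _
    rw [e1]
    exact (key k le_rfl).imp And.left And.left
  have hreach : ∀ τ ≤ J.len, Reachable J.graph J.source (A (τ * k)) τ := by
    intro τ hτ
    induction τ with
    | zero => exact ⟨0, le_rfl, A, h0, by rw [zero_mul], fun i hi => absurd hi (by omega)⟩
    | succ τ ih => exact (ih (by omega)).succ (hblock τ hτ)
  have := hreach J.len le_rfl
  rwa [hlast] at this

/-- `φ` lists the vertices of `A`. -/
def Lists (A : Finset (Fin J.n)) (k : ℕ) (φ : ℕ → ℕ) : Prop :=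
  (∀ g < k, ∃ v ∈ A, (v : ℕ) = φ g) ∧ (∀ g < k, ∀ h < k, φ g = φ h → g = h) ∧
    ∀ v ∈ A, ∃ g < k, φ g = v

theorem exists_lists (A : Finset (Fin J.n)) (hA : A.card = k) : ∃ φ, J.Lists A k φ := by
  let e := A.equivFinOfCardEq hA
  refine ⟨fun g => if h : g < k then (e.symm ⟨g, h⟩ : Fin J.n) else 0, fun g hg => ?_,
    fun g hg h hh he => ?_, fun v hv => ?_⟩
  · simp only [hg, dif_pos]
    exact ⟨_, (e.symm ⟨g, hg⟩).2, rfl⟩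
  · simp only [hg, hh, dif_pos] at he
    have := e.symm.injective (Subtype.ext (Fin.ext he))
    simpa using this
  · refine ⟨e ⟨v, hv⟩, (e ⟨v, hv⟩).isLt, ?_⟩
    simp

/-- The arriving vertex inherits the place of the removed one in the list, so only one place
changes. -/
theorem Lists.jump {A B : Finset (Fin J.n)} {φ : ℕ → ℕ} (h : J.Lists A k φ)
    (hAB : A = B ∨ TokenJump J.graph A B) :
    ∃ φ', J.Lists B k φ' ∧ ∃ m, ∀ g < k, g ≠ m → φ' g = φ g := by
  rcases hAB with rfl | ⟨-, u, hu, v, hv, rfl⟩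
  · exact ⟨φ, h, 0, fun _ _ _ => rfl⟩
  · obtain ⟨m, hm, hmu⟩ := h.2.2 u hu
    have hvn : ∀ g < k, φ g ≠ v := by
      intro g hg he
      obtain ⟨w, hw, hwg⟩ := h.1 g hg
      obtain rfl : w = v := Fin.ext (hwg.trans he)
      exact hv hw
    refine ⟨Function.update φ m v, ⟨fun g hg => ?_, fun g hg g' hg' he => ?_, fun w hw => ?_⟩, m,
      fun g _ hne => Function.update_of_ne hne _ _⟩
    · by_cases hgm : g = m
      · subst hgm
        exact ⟨v, Finset.mem_insert_self _ _, by simp⟩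
      · obtain ⟨w, hw, hwg⟩ := h.1 g hg
        refine ⟨w, Finset.mem_insert_of_mem (Finset.mem_erase.2 ⟨?_, hw⟩), by
          rw [Function.update_of_ne hgm, hwg]⟩
        rintro rfl
        exact hgm (h.2.1 g hg m hm (by rw [← hwg, hmu]))
    · by_cases hgm : g = m <;> by_cases hgm' : g' = m
      · rw [hgm, hgm']
      · subst hgm
        rw [Function.update_self, Function.update_of_ne hgm'] at he
        exact absurd he.symm (hvn g' hg')
      · subst hgm'
        rw [Function.update_self, Function.update_of_ne hgm] at he
        exact absurd he (hvn g hg)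
      · rw [Function.update_of_ne hgm, Function.update_of_ne hgm'] at he
        exact h.2.1 g hg g' hg' he
    · rcases Finset.mem_insert.1 hw with rfl | hw
      · exact ⟨m, hm, by simp⟩
      · obtain ⟨hne, hw⟩ := Finset.mem_erase.1 hw
        obtain ⟨g, hg, hgw⟩ := h.2.2 w hw
        refine ⟨g, hg, ?_⟩
        have : g ≠ m := by
          rintro rfl
          exact hne (Fin.ext (hgw.symm.trans hmu))
        rw [Function.update_of_ne this, hgw]

/-- List the sets of the sequence so that consecutive lists differ in one place, and concatenate the
lists. A window straddles at most two consecutive lists, yet its elements are always those of a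
single one of them. -/
theorem exists_queue (hk : 2 ≤ k) (hJ : J.Answer) : ∃ f, J.Queue f ∧ ∀ e, f e < J.n := by
  obtain ⟨r, hr, P, h0, hlast, hstep⟩ := hJ
  have hn : 0 < J.n := by
    have h1 := Finset.card_le_univ J.source
    rw [J.card_source, Fintype.card_fin] at h1
    omega
  -- A sequence shorter than `len` is continued by its last set.
  let A : ℕ → Finset (Fin J.n) := fun i => P (min i r)
  have hA : ∀ i, A i = A (i + 1) ∨ TokenJump J.graph (A i) (A (i + 1)) := by
    intro i
    by_cases hi : i < r
    · right
      have e1 : min i r = i := by omega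
      have e2 : min (i + 1) r = i + 1 := by omega
      simp only [A, e1, e2]
      exact hstep i hi
    · left
      have : min i r = min (i + 1) r := by omega
      simp only [A, this]
  have hA0 : A 0 = J.source := by simp [A, h0]
  have hAl : A J.len = J.target := by
    have : min J.len r = r := by omega
    simp only [A, this, hlast]
  have hind : ∀ i, J.graph.IsIndepSet (A i : Set (Fin J.n)) := by
    intro i
    induction i with
    | zero => rw [hA0]; exact J.indep_source
    | succ i ih =>
      rcases hA i with h | h
      · rwa [← h]
      · exact h.1
  obtain ⟨φ₀, hφ₀⟩ := exists_lists (A 0) (by rw [hA0, J.card_source])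
  let seq : ∀ i, {φ : ℕ → ℕ // J.Lists (A i) k φ} := fun i =>
    Nat.rec ⟨φ₀, hφ₀⟩ (fun i φ => ⟨(φ.2.jump (hA i)).choose, (φ.2.jump (hA i)).choose_spec.1⟩) i
  let F : ℕ → ℕ → ℕ := fun i => (seq i).1
  have hF : ∀ i, J.Lists (A i) k (F i) := fun i => (seq i).2
  have hm : ∀ i, ∃ m, ∀ g < k, g ≠ m → F (i + 1) g = F i g := fun i =>
    ((seq i).2.jump (hA i)).choose_spec.2
  choose m hm using hm
  have hk0 : 0 < k := by omega
  have hFn : ∀ i, ∀ g < k, F i g < J.n := by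
    intro i g hg
    obtain ⟨v, -, hv⟩ := (hF i).1 g hg
    rw [← hv]; exact v.isLt
  have hmod : ∀ e, e % k < k := fun e => Nat.mod_lt e hk0
  have hdiv : ∀ τ y, y < k → (τ * k + y) / k = τ := fun τ y hy => by
    rw [Nat.add_comm, Nat.add_mul_div_right _ _ hk0, Nat.div_eq_of_lt hy, zero_add]
  have hmod' : ∀ τ y, y < k → (τ * k + y) % k = y := fun τ y hy => by
    rw [Nat.mul_add_mod', Nat.mod_eq_of_lt hy]
  let f : ℕ → ℕ := fun e => F (e / k) (e % k)
  have hfv : ∀ τ y, y < k → f (τ * k + y) = F τ y := fun τ y hy => by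
    simp only [f, hdiv τ y hy, hmod' τ y hy]
  have hwin : ∀ e, ∃ τ, ∀ g < k, f (e + g) = F τ ((e + g) % k) := by
    intro e
    have he := Nat.div_add_mod' e k
    have hi := hmod e
    have hsplit : ∀ g < k, (e + g = e / k * k + (e % k + g) ∧ (e + g) % k = e % k + g ∧
        e % k + g < k) ∨ (e + g = (e / k + 1) * k + (e % k + g - k) ∧
          (e + g) % k = e % k + g - k ∧ e % k + g - k < k ∧ k ≤ e % k + g) := by
      intro g hg
      by_cases h : e % k + g < k
      · left
        have : e + g = e / k * k + (e % k + g) := by omega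
        exact ⟨this, by rw [this, hmod' _ _ h], h⟩
      · right
        have h1 : e % k + g - k < k := by omega
        have : e + g = (e / k + 1) * k + (e % k + g - k) := by rw [add_mul]; omega
        refine ⟨this, ?_, h1, by omega⟩
        conv_lhs => rw [this]
        rw [hmod' _ _ h1]
    -- The window takes the places below `e % k` from the next list. If the exceptional place is not
    -- among them, they are the same in the old list; otherwise the remaining places are the same in
    -- the new list.
    by_cases hle : e % k ≤ m (e / k)
    · refine ⟨e / k, fun g hg => ?_⟩
      rcases hsplit g hg with ⟨h1, h2, h3⟩ | ⟨h1, h2, h3, h4⟩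
      · rw [h2, h1, hfv _ _ h3]
      · rw [h2, h1, hfv _ _ h3, hm _ _ h3 (by omega)]
    · refine ⟨e / k + 1, fun g hg => ?_⟩
      rcases hsplit g hg with ⟨h1, h2, h3⟩ | ⟨h1, h2, h3, h4⟩
      · rw [h2, h1, hfv _ _ h3, hm _ _ h3 (by omega)]
      · rw [h2, h1, hfv _ _ h3]
  have hmodne : ∀ e g h, g < k → h < k → (e + g) % k = (e + h) % k → g = h := by
    intro e g h hg hh he
    have := Nat.ModEq.add_left_cancel' e (show e + g ≡ e + h [MOD k] from he)
    rwa [Nat.ModEq, Nat.mod_eq_of_lt hg, Nat.mod_eq_of_lt hh] at this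
  refine ⟨f, ⟨fun e he g hg h hh hne => ?_, fun e₁ e₂ hlt _ hblock hch => ?_⟩,
    fun e => hFn _ _ (hmod e)⟩
  · obtain ⟨τ, hτ⟩ := hwin e
    rintro (h1 | h1 | h1 | ⟨a, b, ha, hb, hab⟩ | ⟨rfl, h1⟩ | ⟨rfl, h1⟩)
    · rw [hτ g hg] at h1
      have := hFn τ _ (hmod (e + g)); omega
    · rw [hτ h hh] at h1
      have := hFn τ _ (hmod (e + h)); omega
    · rw [hτ g hg, hτ h hh] at h1
      exact hne (hmodne e g h hg hh ((hF τ).2.1 _ (hmod _) _ (hmod _) h1))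
    · rw [hτ g hg] at ha
      rw [hτ h hh] at hb
      obtain ⟨a', ha', hag⟩ := (hF τ).1 _ (hmod (e + g))
      obtain ⟨b', hb', hbh⟩ := (hF τ).1 _ (hmod (e + h))
      obtain rfl : a = a' := Fin.ext (ha.trans hag.symm)
      obtain rfl : b = b' := Fin.ext (hb.trans hbh.symm)
      exact hind τ ha' hb' hab.ne hab
    · have h2 := hfv 0 g hg
      rw [zero_mul] at h2
      rw [h2, ← hA0] at h1
      exact h1 ((hF 0).1 g hg)
    · have h2 := hfv J.len g hg
      rw [h2, ← hAl] at h1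
      exact h1 ((hF J.len).1 g hg)
  · have hstep : ∀ e, f (e + k) = F (e / k + 1) (e % k) := by
      intro e
      simp only [f, Nat.add_div_right _ hk0, Nat.add_mod_right]
    have hm1 : e₁ % k = m (e₁ / k) := by
      by_contra hne
      exact hch (by rw [hstep, hm _ _ (hmod _) hne])
    have hne2 : e₂ % k ≠ m (e₂ / k) := by
      intro he
      have a1 := Nat.div_add_mod' e₁ k
      have a2 := Nat.div_add_mod' e₂ k
      rw [← hblock, hm1] at *
      omega
    rw [hstep, hm _ _ (hmod _) hne2]

end Instance

end Reconf

namespace RAM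

theorem ofDigits_congr {w : ℕ} {ε ε' : ℕ → Prop} (h : ∀ p < w, (ε p ↔ ε' p)) :
    ofDigits w ε = ofDigits w ε' := by
  refine eq_of_bit_eq (ofDigits_lt _ _) (ofDigits_lt _ _) fun p hp => ?_
  rw [bit_ofDigits _ hp, bit_ofDigits _ hp, show ε p = ε' p from propext (h p hp)]

theorem exists_bit_ne {w a b : ℕ} (ha : a < 2 ^ w) (hb : b < 2 ^ w) (h : a ≠ b) :
    ∃ p < w, bit a p ≠ bit b p := by
  by_contra hc
  push Not at hc
  exact h (eq_of_bit_eq ha hb hc)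

end RAM

/-! ### Formulas whose variables live during intervals of time. -/

namespace PathSat

open RAM

/-- A 3-CNF formula whose variables are alive during intervals of time; at some time the three
literals of a clause are all alive. -/
structure Timed where
  numVars : ℕ
  numClauses : ℕ
  numBags : ℕ
  code : ℕ → ℕ → ℕ
  start : ℕ → ℕ
  finish : ℕ → ℕ
  code_lt : ∀ q < numClauses, ∀ i < 3, code q i / 2 < numVars
  start_lt : ∀ v < numVars, start v < numBags
  start_le : ∀ v < numVars, start v ≤ finish v
  alive : ∀ q < numClauses, ∃ j < numBags, ∀ i < 3,
    start (code q i / 2) ≤ j ∧ j ≤ finish (code q i / 2)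

namespace Timed

variable (D : Timed)

def inst : Instance where
  numVars := D.numVars
  numClauses := D.numClauses
  numBags := D.numBags
  formula q i := (⟨D.code q i / 2, D.code_lt q q.2 i i.2⟩, decide (D.code q i % 2 = 1))
  bag j := Finset.univ.filter fun v => D.start v ≤ j ∧ (j : ℕ) ≤ D.finish v
  isPathDecomposition := by
    refine ⟨fun x => ⟨⟨D.start x, D.start_lt x x.2⟩, ?_⟩, ?_, fun x j₁ j j₂ h₁ h₂ hx₁ hx₂ => ?_⟩
    · simpa using D.start_le x x.2
    · rintro x y ⟨-, q, ⟨i, rfl⟩, i', rfl⟩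
      obtain ⟨j, hj, h⟩ := D.alive q q.2
      exact ⟨⟨j, hj⟩, by simpa using h i i.2, by simpa using h i' i'.2⟩
    · simp only [Finset.mem_filter, Finset.mem_univ, true_and] at hx₁ hx₂ ⊢
      exact ⟨hx₁.1.trans h₁, le_trans (by exact_mod_cast h₂) hx₂.2⟩

theorem mem_bag (j : Fin D.inst.numBags) (v : Fin D.inst.numVars) :
    v ∈ D.inst.bag j ↔ D.start v ≤ j ∧ (j : ℕ) ≤ D.finish v :=
  Finset.mem_filter.trans (and_iff_right (Finset.mem_univ _))

theorem satisfiable_iff : D.inst.formula.Satisfiable ↔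
    ∃ σ : ℕ → Prop, ∀ q < D.numClauses, ∃ i < 3, (σ (D.code q i / 2) ↔ D.code q i % 2 = 1) := by
  classical
  constructor
  · rintro ⟨σ, hσ⟩
    refine ⟨fun v => ∃ h : v < D.numVars, σ ⟨v, h⟩ = true, fun q hq => ?_⟩
    obtain ⟨i, hi⟩ := hσ ⟨q, hq⟩
    refine ⟨i, i.2, ?_⟩
    have hlt := D.code_lt q hq i i.2
    change σ ⟨D.code q i / 2, hlt⟩ = decide (D.code q i % 2 = 1) at hi
    simp only [hlt, exists_true_left, hi, decide_eq_true_eq]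
  · rintro ⟨σ, hσ⟩
    refine ⟨fun v => decide (σ v), fun q => ?_⟩
    obtain ⟨i, hi, h⟩ := hσ q q.2
    refine ⟨⟨i, hi⟩, ?_⟩
    change decide (σ (D.code q i / 2)) = decide (D.code q i % 2 = 1)
    simp only [h]

theorem width_le {w : ℕ} (h : ∀ j, ∃ s : Finset ℕ, s.card ≤ w + 1 ∧
    ∀ v, D.start v ≤ j → j ≤ D.finish v → v ∈ s) : width D.inst.bag ≤ w := by
  have : (Finset.univ.sup fun j => (D.inst.bag j).card) ≤ w + 1 := by
    refine Finset.sup_le fun j _ => ?_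
    obtain ⟨s, hs, hv⟩ := h j
    rw [← Finset.card_map Fin.valEmbedding]
    refine (Finset.card_le_card fun v hvm => ?_).trans hs
    obtain ⟨x, hx, rfl⟩ := Finset.mem_map.1 hvm
    obtain ⟨h1, h2⟩ := (Finset.mem_filter.1 hx).2
    exact hv _ h1 h2
  rw [width]; omega

end Timed

end PathSat

/-! ### The formula that describes a queue. -/

namespace Reconf.Instance

open RAM

variable {k : ℕ} (J : Instance k)

/-- The number of binary digits of a token. -/
def digits : ℕ := J.n.size

/-- The number of checks of a pair of tokens. -/
def checks : ℕ := 2 * J.digits + 1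

/-- The number of bags for one step of the queue. -/
def period : ℕ := k * k * 2 ^ J.digits * 2 ^ J.digits * J.checks

/-- The number of steps of the queue. -/
def steps : ℕ := J.len * k + 1

/-- A time is a mixed-radix number with digits step, slot A, slot B, token A, token B and check. So
every step runs through all pairs of slots and all pairs of candidate tokens, and compares each pair
digit by digit with the queue. -/
def stepOf (ρ : ℕ) : ℕ := ρ / J.period

def phase (ρ : ℕ) : ℕ := ρ % J.period

def checkOf (ρ : ℕ) : ℕ := J.phase ρ % J.checks

def tokenB (ρ : ℕ) : ℕ := J.phase ρ / J.checks % 2 ^ J.digits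

def tokenA (ρ : ℕ) : ℕ := J.phase ρ / J.checks / 2 ^ J.digits % 2 ^ J.digits

def slotB (ρ : ℕ) : ℕ := J.phase ρ / J.checks / 2 ^ J.digits / 2 ^ J.digits % k

def slotA (ρ : ℕ) : ℕ := J.phase ρ / J.checks / 2 ^ J.digits / 2 ^ J.digits / k

/-- The variable which says that one of the first tests on the pair of tokens has failed. -/
def varY (ρ : ℕ) : ℕ := 3 * ρ

/-- The variable which says that the block of step `e` has seen a change up to step `e`. -/
def varC (e : ℕ) : ℕ := 3 * (e * J.period) + 1

/-- The variable for digit `p` of token `e`. -/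
def varX (e p : ℕ) : ℕ := 3 * (e * J.period + p) + 2

/-- The tokens at hand may not be in the queue together. -/
def Forced (ρ : ℕ) : Prop :=
  J.checkOf ρ = 2 * J.digits ∧ J.slotA ρ ≠ J.slotB ρ ∧
    J.Forbidden (J.len * k) (J.stepOf ρ) (J.tokenA ρ) (J.tokenB ρ)

/-- The literal which says that a digit of the queue differs from that of the tokens at hand. -/
def testCode (ρ : ℕ) : ℕ :=
  if J.checkOf ρ - 1 < J.digits then
    2 * J.varX (J.stepOf ρ + J.slotA ρ) (J.checkOf ρ - 1) +
      (1 - bit (J.tokenA ρ) (J.checkOf ρ - 1))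
  else
    2 * J.varX (J.stepOf ρ + J.slotB ρ) (J.checkOf ρ - 1 - J.digits) +
      (1 - bit (J.tokenB ρ) (J.checkOf ρ - 1 - J.digits))

open Classical in
/-- The literals of the clauses for time `ρ`. -/
noncomputable def literal (ρ κ i : ℕ) : ℕ :=
  -- Clause `0`: if `varY ρ` holds, then so does `varY (ρ - 1)`, or the latest test fails; at check
  -- `0`, `varY ρ` is false.
  if κ = 0 then
    if i = 0 ∨ J.checkOf ρ = 0 then 2 * varY ρ
    else if i = 1 then 2 * varY (ρ - 1) + 1
    else J.testCode ρ
  -- Clause `1` demands `varY ρ` when the pair is forbidden and is a tautology otherwise.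
  else if κ = 1 then 2 * varY ρ + if J.Forced ρ ∨ i ≠ 0 then 1 else 0
  -- Clause `6`: inside a block, a change that has been seen stays recorded.
  else if κ = 6 ∧ J.stepOf ρ % k ≠ 0 then
    if i = 0 then 2 * J.varC (J.stepOf ρ - 1) else 2 * J.varC (J.stepOf ρ) + 1
  -- The phase serves as the number of a digit. Clauses `2` and `3` equate this digit of the removed
  -- and the appended token unless a change is recorded; clauses `4` and `5` equate them if a change
  -- was recorded earlier in the block.
  else if κ < 6 ∧ J.phase ρ < J.digits ∧ J.stepOf ρ + 1 < J.steps ∧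
      (κ < 4 ∨ J.stepOf ρ % k ≠ 0) then
    if i = 0 then 2 * J.varX (J.stepOf ρ) (J.phase ρ) + (1 - κ % 2)
    else if i = 1 then 2 * J.varX (J.stepOf ρ + k) (J.phase ρ) + κ % 2
    else if κ < 4 then 2 * J.varC (J.stepOf ρ) + 1
    else 2 * J.varC (J.stepOf ρ - 1)
  else 2 * varY ρ + if i ≠ 0 then 1 else 0

/-- Variable `v` is anchored at time `v / 3`. A digit of token `e` comes to life in step `e - k`,
when the token is compared with the one it replaces. Numbers that name no variable of the formula
live in a single bag. -/
def begins (v : ℕ) : ℕ :=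
  if v % 3 = 2 ∧ v / 3 % J.period < J.digits then (v / 3 / J.period - k) * J.period else v / 3

def ends (v : ℕ) : ℕ :=
  if v % 3 = 0 then v / 3 + 1
  else if v % 3 = 1 then
    if v / 3 % J.period = 0 then v / 3 + (2 * J.period - 1) else v / 3
  else if v / 3 % J.period < J.digits then v / 3 / J.period * J.period + (J.period - 1)
  else v / 3

/-- The variable `v` is alive at time `j`, which has to be before time `t`. -/
def Alive (v j t : ℕ) : Prop := J.begins v ≤ j ∧ j ≤ J.ends v ∧ v < t * 3

variable {J}

theorem checks_pos : 0 < J.checks := Nat.succ_pos _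

/-- This gives room for the numbering of the digit variables inside one step, and lets the first
phases of a step stand for digits. -/
theorem digits_lt_period (hk : 0 < k) : J.digits < J.period := by
  have h1 : J.digits < J.checks := by rw [checks]; omega
  refine h1.trans_le (Nat.le_mul_of_pos_left _ ?_)
  positivity

theorem period_pos (hk : 0 < k) : 0 < J.period := (Nat.zero_le _).trans_lt (digits_lt_period hk)

theorem div_mul_le_phase (ρ : ℕ) : J.stepOf ρ * J.period + J.phase ρ = ρ :=
  Nat.div_add_mod' ρ J.period

theorem phase_lt (hk : 0 < k) (ρ : ℕ) : J.phase ρ < J.period := Nat.mod_lt _ (period_pos hk)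

theorem slotA_lt (hk : 0 < k) (ρ : ℕ) : J.slotA ρ < k := by
  have := J.phase_lt hk ρ
  simp only [slotA, Nat.div_div_eq_div_mul]
  rw [Nat.div_lt_iff_lt_mul (by have := J.checks_pos; positivity)]
  refine this.trans_eq ?_
  rw [period]; ring

theorem slotB_lt (hk : 0 < k) (ρ : ℕ) : J.slotB ρ < k := Nat.mod_lt _ hk

theorem checkOf_le (ρ : ℕ) : J.checkOf ρ ≤ 2 * J.digits :=
  Nat.lt_succ_iff.1 (Nat.mod_lt _ J.checks_pos)

theorem varX_alive (hk : 0 < k) {e e' p j : ℕ} (hp : p < J.digits) (h1 : e * J.period ≤ j)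
    (h2 : j < e * J.period + J.period) (he : e ≤ e') (he' : e' ≤ e + k) {t : ℕ} (ht : e' < t) :
    J.Alive (J.varX e' p) j (t * J.period) := by
  have hpR := hp.trans (digits_lt_period hk)
  have hR := J.period_pos hk
  have d1 : J.varX e' p / 3 = e' * J.period + p := by rw [varX]; omega
  have d2 : J.varX e' p % 3 = 2 := by rw [varX]; omega
  have d3 : (e' * J.period + p) % J.period = p := by rw [Nat.mul_add_mod', Nat.mod_eq_of_lt hpR]
  have d4 : (e' * J.period + p) / J.period = e' := by
    rw [Nat.add_comm, Nat.add_mul_div_right _ _ hR, Nat.div_eq_of_lt hpR, zero_add]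
  have m1 : (e' - k) * J.period ≤ e * J.period := Nat.mul_le_mul_right _ (by omega)
  have m2 : e * J.period ≤ e' * J.period := Nat.mul_le_mul_right _ he
  have m3 : (e' + 1) * J.period ≤ t * J.period := Nat.mul_le_mul_right _ ht
  rw [add_mul, one_mul] at m3
  refine ⟨?_, ?_, ?_⟩
  · rw [begins, d1, d2, d3, d4, if_pos ⟨rfl, hp⟩]; omega
  · rw [ends, d1, d2, d3, d4, if_neg (by omega), if_neg (by omega), if_pos hp]; omega
  · rw [varX]; omega

theorem varC_alive (hk : 0 < k) {e j t : ℕ} (h1 : e * J.period ≤ j)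
    (h2 : j < e * J.period + 2 * J.period) (ht : e < t) :
    J.Alive (J.varC e) j (t * J.period) := by
  have hR := J.period_pos hk
  have d1 : J.varC e / 3 = e * J.period := by rw [varC]; omega
  have d2 : J.varC e % 3 = 1 := by rw [varC]; omega
  have d3 : (e * J.period) % J.period = 0 := Nat.mul_mod_left _ _
  have m3 : (e + 1) * J.period ≤ t * J.period := Nat.mul_le_mul_right _ ht
  rw [add_mul, one_mul] at m3
  refine ⟨?_, ?_, ?_⟩
  · rw [begins, d1, d2, if_neg (by omega)]; exact h1
  · rw [ends, d1, d2, d3, if_neg (by omega), if_pos rfl, if_pos rfl]; omega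
  · rw [varC]; omega

theorem varY_alive {ρ j t : ℕ} (h1 : ρ ≤ j) (h2 : j ≤ ρ + 1) (ht : ρ < t) :
    J.Alive (varY ρ) j t := by
  have d1 : varY ρ / 3 = ρ := by rw [varY]; omega
  have d2 : varY ρ % 3 = 0 := by rw [varY]; omega
  refine ⟨?_, ?_, ?_⟩
  · rw [begins, d1, d2, if_neg (by omega)]; exact h1
  · rw [ends, d1, d2, if_pos rfl]; exact h2
  · rw [varY]; omega

theorem literal_alive (hk : 0 < k) {ρ : ℕ} (hρ : ρ < J.steps * J.period) (κ i : ℕ) :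
    J.Alive (J.literal ρ κ i / 2) ρ ((J.steps + k) * J.period) := by
  have hsum := J.div_mul_le_phase ρ
  have hph := J.phase_lt hk ρ
  have hstep : J.stepOf ρ < J.steps := Nat.div_lt_of_lt_mul (by rwa [mul_comm])
  have hT : J.steps * J.period ≤ (J.steps + k) * J.period := Nat.mul_le_mul_right _ (by omega)
  have hgA := J.slotA_lt hk ρ
  have hgB := J.slotB_lt hk ρ
  have hc := J.checkOf_le ρ
  have halve : ∀ v s : ℕ, s ≤ 1 → (2 * v + s) / 2 = v := by omega
  have halve0 : ∀ v : ℕ, (2 * v) / 2 = v := by omega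
  have hY : J.Alive (varY ρ) ρ ((J.steps + k) * J.period) :=
    varY_alive le_rfl (by omega) (by omega)
  have hC : J.Alive (J.varC (J.stepOf ρ)) ρ ((J.steps + k) * J.period) :=
    varC_alive hk (by omega) (by omega) (by omega)
  have hC' : J.stepOf ρ % k ≠ 0 →
      J.Alive (J.varC (J.stepOf ρ - 1)) ρ ((J.steps + k) * J.period) := by
    intro h
    have h0 : J.stepOf ρ ≠ 0 := by intro h0; rw [h0] at h; simp at h
    obtain ⟨e, he⟩ := Nat.exists_eq_succ_of_ne_zero h0
    rw [he, Nat.succ_mul] at hsum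
    rw [he, Nat.succ_sub_one]
    exact varC_alive hk (by omega) (by omega) (by omega)
  have hX : ∀ y ≤ k, ∀ p < J.digits,
      J.Alive (J.varX (J.stepOf ρ + y) p) ρ ((J.steps + k) * J.period) := fun y hy p hp =>
    varX_alive hk (e := J.stepOf ρ) hp (by omega) (by omega) (by omega) (by omega) (by omega)
  rw [literal]
  split_ifs with h1 h2 h3 h4 h5 h6 h7 h8 h9 h10 h11
  · rwa [halve0]
  · rw [halve _ _ (by omega)]
    have h0 : ρ ≠ 0 := by
      rintro rfl
      exact h2 (Or.inr (by simp [checkOf, phase]))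
    exact varY_alive (by omega) (by omega) (by omega)
  · rw [testCode]
    have hc0 : J.checkOf ρ ≠ 0 := fun h => h2 (Or.inr h)
    split_ifs with h4
    · rw [halve _ _ (by omega)]
      exact hX _ (by omega) _ h4
    · rw [halve _ _ (by omega)]
      exact hX _ (by omega) _ (by omega)
  · rwa [halve _ _ (by omega)]
  · rwa [halve _ _ (by omega)]
  · rw [halve0]; exact hC' h6.2
  · rwa [halve _ _ (by omega)]
  · rw [halve _ _ (by omega)]
    exact hX 0 (by omega) _ h8.2.1
  · rw [halve _ _ (by omega)]
    exact hX k (by omega) _ h8.2.1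
  · rwa [halve _ _ (by omega)]
  · rw [halve0]; exact hC' (h8.2.2.2.resolve_left h11)
  · rwa [halve _ _ (by omega)]
  · rwa [halve _ _ (by omega)]

/-- The formula with a path decomposition which says that there is a queue of tokens. -/
noncomputable def timed (J : Instance k) (hk : 0 < k) : PathSat.Timed where
  numVars := (J.steps + k) * J.period * 3
  numClauses := J.steps * J.period * 7
  numBags := (J.steps + k) * J.period
  code q i := J.literal (q / 7) (q % 7) i
  start := J.begins
  finish := J.ends
  code_lt q hq i _ := (literal_alive hk (Nat.div_lt_of_lt_mul (by omega)) _ i).2.2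
  start_lt v hv := by
    have h1 : (v / 3 / J.period - k) * J.period ≤ v / 3 :=
      (Nat.mul_le_mul_right _ (Nat.sub_le _ _)).trans (Nat.div_mul_le_self _ _)
    rw [begins]
    split_ifs <;> omega
  start_le v _ := by
    have h1 : (v / 3 / J.period - k) * J.period ≤ v / 3 / J.period * J.period :=
      Nat.mul_le_mul_right _ (Nat.sub_le _ _)
    rw [begins, ends]
    split_ifs <;> omega
  alive q hq := by
    have hρ : q / 7 < J.steps * J.period := Nat.div_lt_of_lt_mul (by omega)
    refine ⟨q / 7, hρ.trans_le (Nat.mul_le_mul_right _ (by omega)), fun i _ => ?_⟩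
    have := literal_alive hk hρ (q % 7) i
    exact ⟨this.1, this.2.1⟩

/-- In a step the digits of `k + 1` tokens are alive: the window and the token about to be appended.
Apart from them there are at most six variables: two of type `varY`, two of type `varC`, and two
numbers without a role. -/
theorem width_timed_le (hk : 0 < k) :
    PathSat.width (J.timed hk).inst.bag ≤ (k + 1) * J.digits + 5 := by
  classical
  refine PathSat.Timed.width_le _ fun j => ?_
  refine ⟨((Finset.range (k + 1) ×ˢ Finset.range J.digits).image fun x =>
    J.varX (j / J.period + x.1) x.2) ∪ {3 * j, 3 * (j - 1), 3 * j + 1, 3 * j + 2,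
      J.varC (j / J.period), J.varC (j / J.period - 1)}, ?_, fun v h1 h2 => ?_⟩
  · refine (Finset.card_union_le _ _).trans (Nat.add_le_add (b := (k + 1) * J.digits)
      (d := 6) (Finset.card_image_le.trans ?_) Finset.card_le_six)
    rw [Finset.card_product, Finset.card_range, Finset.card_range]
  · have hR := J.period_pos hk
    have hv := Nat.div_add_mod v 3
    have hj := Nat.div_add_mod' j J.period
    have hjm := Nat.mod_lt j hR
    have hi := Nat.div_add_mod' (v / 3) J.period
    have him := Nat.mod_lt (v / 3) hR
    have hv3 : v % 3 < 3 := Nat.mod_lt _ (by omega)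
    simp only [Finset.mem_union, Finset.mem_image, Finset.mem_product, Finset.mem_range,
      Finset.mem_insert, Finset.mem_singleton, Prod.exists]
    simp only [timed] at h1 h2
    rw [begins] at h1
    rw [ends] at h2
    have hcases : v % 3 = 0 ∨ v % 3 = 1 ∨ v % 3 = 2 := by omega
    rcases hcases with h0 | h0 | h0
    · rw [if_neg (by omega)] at h1
      rw [if_pos h0] at h2
      right; omega
    · rw [if_neg (by omega)] at h1
      rw [if_neg (by omega), if_pos h0] at h2
      split_ifs at h2 with h3
      · right
        have l1 : v / 3 / J.period ≤ j / J.period := Nat.div_le_div_right h1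
        have l2 : j / J.period ≤ v / 3 / J.period + 1 := by
          rw [← Nat.add_div_right _ hR, ← Nat.lt_succ_iff, Nat.div_lt_iff_lt_mul hR, Nat.succ_mul,
            Nat.add_div_right _ hR, Nat.succ_mul]
          omega
        have hc : v = J.varC (v / 3 / J.period) := by
          rw [varC]
          rw [h3, add_zero] at hi
          rw [hi]
          omega
        have near : ∀ x y : ℕ, x ≤ y → y ≤ x + 1 → x = y ∨ x = y - 1 := by omega
        rcases near _ _ l1 l2 with h | h <;> rw [h] at hc
        · exact Or.inr (Or.inr (Or.inr (Or.inr (Or.inl hc))))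
        · exact Or.inr (Or.inr (Or.inr (Or.inr (Or.inr hc))))
      · right; omega
    · rw [if_neg (by omega), if_neg (by omega)] at h2
      by_cases h3 : v / 3 % J.period < J.digits
      · rw [if_pos ⟨h0, h3⟩] at h1
        rw [if_pos h3] at h2
        left
        have l1 : v / 3 / J.period - k ≤ j / J.period := (Nat.le_div_iff_mul_le hR).2 h1
        have l2 : j / J.period ≤ v / 3 / J.period := by
          rw [← Nat.lt_succ_iff, Nat.div_lt_iff_lt_mul hR, Nat.succ_mul]
          omega
        refine ⟨v / 3 / J.period - j / J.period, v / 3 % J.period, ⟨by omega, h3⟩, ?_⟩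
        have : j / J.period + (v / 3 / J.period - j / J.period) = v / 3 / J.period := by omega
        rw [this, varX]
        omega
      · rw [if_neg fun h => h3 h.2] at h1
        rw [if_neg h3] at h2
        right; omega

/-! ### Correctness -/

/-- The time of check `p` for the tokens `u` and `v` in the slots `g` and `h`, in step `e`. -/
def time (J : Instance k) (e g h u v p : ℕ) : ℕ :=
  e * J.period + ((((g * k + h) * 2 ^ J.digits + u) * 2 ^ J.digits + v) * J.checks + p)

theorem time_spec {e g h u v p : ℕ} (hg : g < k) (hh : h < k) (hu : u < 2 ^ J.digits)
    (hv : v < 2 ^ J.digits) (hp : p < J.checks) :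
    J.stepOf (J.time e g h u v p) = e ∧ J.slotA (J.time e g h u v p) = g ∧
      J.slotB (J.time e g h u v p) = h ∧ J.tokenA (J.time e g h u v p) = u ∧
      J.tokenB (J.time e g h u v p) = v ∧ J.checkOf (J.time e g h u v p) = p := by
  have hk : 0 < k := by omega
  have hW : 0 < 2 ^ J.digits := by positivity
  have hR := J.period_pos hk
  have digit : ∀ {a x m : ℕ}, x < m → (a * m + x) / m = a ∧ (a * m + x) % m = x := by
    intro a x m hx
    refine ⟨?_, by rw [Nat.mul_add_mod', Nat.mod_eq_of_lt hx]⟩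
    rw [Nat.add_comm, Nat.add_mul_div_right _ _ (by omega), Nat.div_eq_of_lt hx, zero_add]
  have step : ∀ {a x m M : ℕ}, a < M → x < m → a * m + x < M * m := by
    intro a x m M ha hx
    have := Nat.mul_le_mul_right m ha
    rw [Nat.succ_mul] at this
    omega
  have hr : (((g * k + h) * 2 ^ J.digits + u) * 2 ^ J.digits + v) * J.checks + p < J.period :=
    step (step (step (step hg hh) hu) hv) hp
  have hph : J.phase (J.time e g h u v p) =
      (((g * k + h) * 2 ^ J.digits + u) * 2 ^ J.digits + v) * J.checks + p := (digit hr).2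
  refine ⟨(digit hr).1, ?_, ?_, ?_, ?_, ?_⟩
  · rw [slotA, hph, (digit hp).1, (digit hv).1, (digit hu).1, (digit hh).1]
  · rw [slotB, hph, (digit hp).1, (digit hv).1, (digit hu).1, (digit hh).2]
  · rw [tokenA, hph, (digit hp).1, (digit hv).1, (digit hu).2]
  · rw [tokenB, hph, (digit hp).1, (digit hv).2]
  · rw [checkOf, hph, (digit hp).2]

/-- `σ` satisfies the formula. -/
def Sat (J : Instance k) (σ : ℕ → Prop) : Prop :=
  ∀ ρ < J.steps * J.period, ∀ κ < 7, ∃ i < 3,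
    (σ (J.literal ρ κ i / 2) ↔ J.literal ρ κ i % 2 = 1)

theorem satisfiable_iff_sat (hk : 0 < k) :
    (J.timed hk).inst.formula.Satisfiable ↔ ∃ σ, J.Sat σ := by
  rw [PathSat.Timed.satisfiable_iff]
  refine exists_congr fun σ => ⟨fun h ρ hρ κ hκ => ?_, fun h q hq => ?_⟩
  · have := h (ρ * 7 + κ) (by simp only [timed]; omega)
    have e1 : (ρ * 7 + κ) / 7 = ρ := by omega
    have e2 : (ρ * 7 + κ) % 7 = κ := by omega
    simpa only [timed, e1, e2] using this
  · exact h (q / 7) (Nat.div_lt_of_lt_mul (by simp only [timed] at hq; omega)) (q % 7)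
      (Nat.mod_lt _ (by omega))

end Reconf.Instance

/-! ### Satisfying assignments correspond to queues. -/

namespace Reconf.Instance

open RAM

variable {k : ℕ} {J : Instance k}

theorem lt_two_pow_digits {u : ℕ} (h : u < J.n) : u < 2 ^ J.digits :=
  h.trans (Nat.lt_size_self _)

theorem time_lt {e g h u v p : ℕ} (hg : g < k) (hh : h < k) (hu : u < 2 ^ J.digits)
    (hv : v < 2 ^ J.digits) (hp : p < J.checks) (he : e < J.steps) :
    J.time e g h u v p < J.steps * J.period := by
  have hR := J.period_pos (by omega : 0 < k)
  have h1 : J.time e g h u v p / J.period = e := (time_spec hg hh hu hv hp).1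
  rw [← Nat.div_lt_iff_lt_mul hR, h1]
  exact he

/-- When the candidates are the tokens of the queue themselves, no test fails, so the clauses pass
the falsity of `varY` on from check to check. -/
theorem Sat.not_varY {σ : ℕ → Prop} (hσ : J.Sat σ) {f : ℕ → ℕ}
    (hf : ∀ e, ∀ p < J.digits, bit (f e) p = ind (σ (J.varX e p))) {e g h p : ℕ}
    (he : e < J.steps) (hg : g < k) (hh : h < k) (hfn : ∀ e, f e < 2 ^ J.digits)
    (hp : p < J.checks) : ¬ σ (varY (J.time e g h (f (e + g)) (f (e + h)) p)) := by
  have hspec := fun {p} => J.time_spec (e := e) (p := p) hg hh (hfn (e + g)) (hfn (e + h))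
  have hdiff : ∀ e, ∀ p < J.digits, ¬ (σ ((2 * J.varX e p + (1 - bit (f e) p)) / 2) ↔
      (2 * J.varX e p + (1 - bit (f e) p)) % 2 = 1) := by
    intro e p hp
    have h1 : ∀ v s : ℕ, s ≤ 1 → (2 * v + s) / 2 = v ∧ (2 * v + s) % 2 = s := by omega
    obtain ⟨h2, h3⟩ := h1 (J.varX e p) (1 - bit (f e) p) (by omega)
    rw [h2, h3, hf e p hp]
    by_cases hs : σ (J.varX e p)
    · rw [ind_of hs]; simp [hs]
    · rw [ind_of_not hs]; simp [hs]
  have e0 : ∀ v : ℕ, 2 * v / 2 = v ∧ (2 * v) % 2 = 0 := by omega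
  have e1 : ∀ v : ℕ, (2 * v + 1) / 2 = v ∧ (2 * v + 1) % 2 = 1 := by omega
  induction p with
  | zero =>
    obtain ⟨i, hi, hs⟩ := hσ _ (time_lt hg hh (hfn _) (hfn _) hp he) 0 (by omega)
    rw [literal, if_pos rfl, if_pos (Or.inr (hspec hp).2.2.2.2.2), (e0 _).1, (e0 _).2] at hs
    simpa using hs
  | succ p ih =>
    obtain ⟨i, hi, hs⟩ := hσ _ (time_lt hg hh (hfn _) (hfn _) hp he) 0 (by omega)
    obtain ⟨s1, s2, s3, s4, s5, s6⟩ := hspec hp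
    rw [literal, if_pos rfl] at hs
    have hpred : J.time e g h (f (e + g)) (f (e + h)) (p + 1) - 1 =
        J.time e g h (f (e + g)) (f (e + h)) p := by simp only [time]; omega
    by_cases h1 : i = 0
    · rw [if_pos (Or.inl h1), (e0 _).1, (e0 _).2] at hs
      simpa using hs
    · rw [if_neg (by rw [s6]; omega)] at hs
      by_cases h2 : i = 1
      · rw [if_pos h2, (e1 _).1, (e1 _).2, hpred] at hs
        exact absurd (hs.2 rfl) (ih (by omega))
      · rw [if_neg h2, testCode, s1, s2, s3, s4, s5, s6, Nat.add_sub_cancel] at hs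
        rw [checks] at hp
        split_ifs at hs with h3
        · exact absurd hs (hdiff _ _ h3)
        · exact absurd hs (hdiff _ _ (by omega))

theorem Sat.changes {σ : ℕ → Prop} (hσ : J.Sat σ) (hk : 0 < k) {e p : ℕ} (he : e + 1 < J.steps)
    (hp : p < J.digits) :
    ((σ (J.varX e p) ↔ σ (J.varX (e + k) p)) ∨ σ (J.varC e)) ∧
    (e % k ≠ 0 → σ (J.varC (e - 1)) → (σ (J.varX e p) ↔ σ (J.varX (e + k) p)) ∧ σ (J.varC e)) := by
  have hR := J.period_pos hk
  have hpR := hp.trans (digits_lt_period hk)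
  have d1 : J.stepOf (e * J.period + p) = e := by
    rw [stepOf, Nat.add_comm, Nat.add_mul_div_right _ _ hR, Nat.div_eq_of_lt hpR, zero_add]
  have d2 : J.phase (e * J.period + p) = p := by
    rw [phase, Nat.mul_add_mod', Nat.mod_eq_of_lt hpR]
  have hρ : e * J.period + p < J.steps * J.period := by
    rw [← Nat.div_lt_iff_lt_mul hR]
    change J.stepOf _ < _
    rw [d1]; omega
  have e0 : ∀ v : ℕ, 2 * v / 2 = v ∧ (2 * v) % 2 = 0 := by omega
  have e1 : ∀ v : ℕ, (2 * v + 1) / 2 = v ∧ (2 * v + 1) % 2 = 1 := by omega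
  -- The parity of `κ` selects one of the two implications that make up the equality of the digits.
  have key : ∀ κ, 2 ≤ κ → κ < 6 → (κ < 4 ∨ e % k ≠ 0) →
      (σ (J.varX e p) ↔ κ % 2 = 0) ∨ (σ (J.varX (e + k) p) ↔ κ % 2 = 1) ∨
        (if κ < 4 then σ (J.varC e) else ¬ σ (J.varC (e - 1))) := by
    intro κ h2 h6 hc
    obtain ⟨i, hi, hs⟩ := hσ _ hρ κ (by omega)
    rw [literal, if_neg (by omega), if_neg (by omega), if_neg (by omega), d1, d2,
      if_pos ⟨h6, hp, he, hc⟩] at hs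
    split_ifs at hs with i0 i1 i2
    · left
      have : (2 * J.varX e p + (1 - κ % 2)) / 2 = J.varX e p := by omega
      rw [this] at hs
      rw [hs]; omega
    · right; left
      have : (2 * J.varX (e + k) p + κ % 2) / 2 = J.varX (e + k) p := by omega
      rw [this] at hs
      rw [hs]; omega
    · right; right
      rw [(e1 _).1, (e1 _).2] at hs
      rw [if_pos i2]; exact hs.2 rfl
    · right; right
      rw [(e0 _).1, (e0 _).2] at hs
      rw [if_neg i2]; simpa using hs
  refine ⟨?_, fun hc hC => ⟨?_, ?_⟩⟩
  · have k2 := key 2 (by omega) (by omega) (by omega)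
    have k3 := key 3 (by omega) (by omega) (by omega)
    norm_num at k2 k3
    tauto
  · have k4 := key 4 (by omega) (by omega) (Or.inr hc)
    have k5 := key 5 (by omega) (by omega) (Or.inr hc)
    norm_num at k4 k5
    tauto
  · obtain ⟨i, hi, hs⟩ := hσ _ hρ 6 (by omega)
    rw [literal, if_neg (by omega), if_neg (by omega), d1, if_pos ⟨rfl, hc⟩] at hs
    split_ifs at hs
    · rw [(e0 _).1, (e0 _).2] at hs
      simp [hC] at hs
    · rw [(e1 _).1, (e1 _).2] at hs
      exact hs.2 rfl

/-- Read the tokens off the digit variables. A forbidden pair in a window would make clause `1`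
demand a `varY` that is false. A change switches `varC` on for the rest of the block, which rules
out a second change. -/
theorem Sat.exists_queue {σ : ℕ → Prop} (hσ : J.Sat σ) (hk : 0 < k) : ∃ f, J.Queue f := by
  let f : ℕ → ℕ := fun e => ofDigits J.digits fun p => σ (J.varX e p)
  have hf : ∀ e, ∀ p < J.digits, bit (f e) p = ind (σ (J.varX e p)) := fun e p hp =>
    bit_ofDigits _ hp
  have hfn : ∀ e, f e < 2 ^ J.digits := fun e => ofDigits_lt _ _
  refine ⟨f, ⟨fun e he g hg h hh hne hforb => ?_, fun e₁ e₂ hlt hle hblock hch => ?_⟩⟩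
  · have he' : e < J.steps := Nat.lt_succ_of_le he
    have hp : 2 * J.digits < J.checks := by rw [checks]; omega
    have hY := hσ.not_varY hf he' hg hh hfn hp
    obtain ⟨s1, s2, s3, s4, s5, s6⟩ := J.time_spec (e := e) hg hh (hfn (e + g)) (hfn (e + h)) hp
    obtain ⟨i, hi, hs⟩ := hσ _ (time_lt hg hh (hfn _) (hfn _) hp he') 1 (by omega)
    have hF : J.Forced (J.time e g h (f (e + g)) (f (e + h)) (2 * J.digits)) := by
      rw [Forced, s1, s2, s3, s4, s5, s6]
      exact ⟨rfl, hne, hforb⟩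
    have e1 : ∀ v : ℕ, (2 * v + 1) / 2 = v ∧ (2 * v + 1) % 2 = 1 := by omega
    rw [literal, if_neg (by omega), if_pos rfl, if_pos (Or.inl hF), (e1 _).1, (e1 _).2] at hs
    exact hY (hs.2 rfl)
  · have hsteps : ∀ e ≤ e₂, e + 1 < J.steps := fun e he => by rw [steps]; omega
    have h1 : σ (J.varC e₁) := by
      by_contra hC
      refine hch (ofDigits_congr fun p hp => ?_)
      exact (hσ.changes hk (hsteps _ hlt.le) hp).1.resolve_right hC
    have hdig : 0 < J.digits := by
      by_contra h0
      refine hch (ofDigits_congr fun p hp => absurd hp (by omega))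
    -- A multiple of `k` here would separate `e₁` and `e₂` into different blocks.
    have hmod : ∀ e, e₁ < e → e ≤ e₂ → e % k ≠ 0 := by
      intro e h1 h2 h0
      have h3 : e₁ / k ≤ (e - 1) / k := Nat.div_le_div_right (by omega)
      have h4 : e / k ≤ e₂ / k := Nat.div_le_div_right h2
      obtain ⟨x, rfl⟩ := Nat.dvd_of_mod_eq_zero h0
      rw [Nat.mul_div_cancel_left _ hk] at h4
      have h5 : e₁ / k < x := by rw [Nat.div_lt_iff_lt_mul hk, mul_comm]; exact h1
      omega
    have hC : ∀ e, e₁ ≤ e → e < e₂ → σ (J.varC e) := by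
      intro e he
      induction e, he using Nat.le_induction with
      | base => exact fun _ => h1
      | succ e he ih =>
        intro h2
        exact ((hσ.changes hk (hsteps _ h2.le) hdig).2 (hmod _ (by omega) h2.le)
          (ih (by omega))).2
    refine ofDigits_congr fun p hp => ?_
    exact ((hσ.changes hk (hsteps _ le_rfl) hp).2 (hmod _ hlt le_rfl) (hC _ (by omega) (by omega))).1

/-- The first `p` digits of the tokens at hand are not all those of the queue. -/
def Differs (J : Instance k) (f : ℕ → ℕ) (ρ p : ℕ) : Prop :=
  if p < J.digits then bit (f (J.stepOf ρ + J.slotA ρ)) p ≠ bit (J.tokenA ρ) p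
  else bit (f (J.stepOf ρ + J.slotB ρ)) (p - J.digits) ≠ bit (J.tokenB ρ) (p - J.digits)

/-- The assignment that belongs to a queue. -/
def assignment (J : Instance k) (f : ℕ → ℕ) (v : ℕ) : Prop :=
  if v % 3 = 0 then ∃ p < J.checkOf (v / 3), J.Differs f (v / 3) p
  else if v % 3 = 1 then ∃ e ≤ v / 3 / J.period, e / k = v / 3 / J.period / k ∧ f e ≠ f (e + k)
  else bit (f (v / 3 / J.period)) (v / 3 % J.period) = 1

theorem assignment_varY (f : ℕ → ℕ) (ρ : ℕ) :
    J.assignment f (varY ρ) ↔ ∃ p < J.checkOf ρ, J.Differs f ρ p := by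
  have d1 : varY ρ / 3 = ρ := by rw [varY]; omega
  have d2 : varY ρ % 3 = 0 := by rw [varY]; omega
  rw [assignment, d1, if_pos d2]

theorem assignment_varC (hk : 0 < k) (f : ℕ → ℕ) (e : ℕ) :
    J.assignment f (J.varC e) ↔ ∃ e' ≤ e, e' / k = e / k ∧ f e' ≠ f (e' + k) := by
  have d1 : J.varC e / 3 = e * J.period := by rw [varC]; omega
  have d2 : J.varC e % 3 = 1 := by rw [varC]; omega
  rw [assignment, d1, if_neg (by omega), if_pos d2, Nat.mul_div_cancel _ (J.period_pos hk)]

theorem assignment_varX (hk : 0 < k) (f : ℕ → ℕ) (e : ℕ) {p : ℕ} (hp : p < J.digits) :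
    J.assignment f (J.varX e p) ↔ bit (f e) p = 1 := by
  have hpR := hp.trans (digits_lt_period hk)
  have d1 : J.varX e p / 3 = e * J.period + p := by rw [varX]; omega
  have d2 : J.varX e p % 3 = 2 := by rw [varX]; omega
  have d3 : (e * J.period + p) % J.period = p := by rw [Nat.mul_add_mod', Nat.mod_eq_of_lt hpR]
  have d4 : (e * J.period + p) / J.period = e := by
    rw [Nat.add_comm, Nat.add_mul_div_right _ _ (J.period_pos hk), Nat.div_eq_of_lt hpR, zero_add]
  rw [assignment, d1, if_neg (by omega), if_neg (by omega), d3, d4]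

/-- Each auxiliary variable gets the meaning it is named for, and the clauses are verified one by
one. -/
theorem Queue.sat {f : ℕ → ℕ} (hf : J.Queue f) (hfn : ∀ e, f e < J.n) (hk : 0 < k) :
    J.Sat (J.assignment f) := by
  have e0 : ∀ v : ℕ, 2 * v / 2 = v ∧ (2 * v) % 2 = 0 := by omega
  have e1 : ∀ v : ℕ, (2 * v + 1) / 2 = v ∧ (2 * v + 1) % 2 = 1 := by omega
  have es : ∀ v s : ℕ, s ≤ 1 → (2 * v + s) / 2 = v ∧ (2 * v + s) % 2 = s := by omega
  intro ρ hρ κ hκ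
  have hstep : J.stepOf ρ < J.steps := Nat.div_lt_of_lt_mul (by rwa [mul_comm])
  by_cases h0 : κ = 0
  · simp only [literal, if_pos h0]
    by_cases hY : J.assignment f (varY ρ)
    · rw [assignment_varY] at hY
      obtain ⟨p, hp, hd⟩ := hY
      have hc0 : J.checkOf ρ ≠ 0 := by omega
      have hc := J.checkOf_le ρ
      -- The failed test is either the latest one, which the third literal reports, or an earlier
      -- one, which is known to the `varY` of the previous time.
      by_cases hlast : p = J.checkOf ρ - 1
      · refine ⟨2, by omega, ?_⟩
        rw [if_neg (by omega), if_neg (by omega), testCode]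
        rw [Differs, hlast] at hd
        split_ifs at hd ⊢ with h1
        · rw [(es _ _ (by omega)).1, (es _ _ (by omega)).2, assignment_varX hk f _ h1]
          have b1 := bit_lt (f (J.stepOf ρ + J.slotA ρ)) (J.checkOf ρ - 1)
          have b2 := bit_lt (J.tokenA ρ) (J.checkOf ρ - 1)
          omega
        · rw [(es _ _ (by omega)).1, (es _ _ (by omega)).2, assignment_varX hk f _ (by omega)]
          have b1 := bit_lt (f (J.stepOf ρ + J.slotB ρ)) (J.checkOf ρ - 1 - J.digits)
          have b2 := bit_lt (J.tokenB ρ) (J.checkOf ρ - 1 - J.digits)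
          omega
      · refine ⟨1, by omega, ?_⟩
        rw [if_neg (by omega), if_pos rfl, (e1 _).1, (e1 _).2, assignment_varY]
        refine ⟨fun _ => rfl, fun _ => ⟨p, ?_, ?_⟩⟩
        -- As the check number is positive, the previous time has the same step, slots and
        -- candidates, and the check number is one less.
        all_goals
          have hρ' := Nat.div_add_mod' (J.phase ρ) J.checks
          have hsum := J.div_mul_le_phase ρ
          have hph := J.phase_lt hk ρ
          have hcc : J.phase ρ % J.checks = J.checkOf ρ := rfl
          have hcl := Nat.mod_lt (J.phase ρ) J.checks_pos
          have hp1 : J.phase (ρ - 1) = J.phase ρ - 1 := by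
            have : ρ - 1 = J.stepOf ρ * J.period + (J.phase ρ - 1) := by omega
            rw [phase, this, Nat.mul_add_mod', Nat.mod_eq_of_lt (by omega)]
          have hs1 : J.stepOf (ρ - 1) = J.stepOf ρ := by
            have : ρ - 1 = J.phase ρ - 1 + J.stepOf ρ * J.period := by omega
            rw [stepOf, this, Nat.add_mul_div_right _ _ (J.period_pos hk),
              Nat.div_eq_of_lt (by omega), zero_add]
          have hq : J.phase ρ - 1 = J.phase ρ / J.checks * J.checks + (J.checkOf ρ - 1) := by omega
        · rw [checkOf, hp1, hq, Nat.mul_add_mod', Nat.mod_eq_of_lt (by omega)]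
          omega
        · have hd1 : J.phase (ρ - 1) / J.checks = J.phase ρ / J.checks := by
            rw [hp1, hq, Nat.add_comm, Nat.add_mul_div_right _ _ J.checks_pos,
              Nat.div_eq_of_lt (by omega), zero_add]
          rw [Differs] at hd ⊢
          simp only [slotA, slotB, tokenA, tokenB, hd1, hs1] at hd ⊢
          exact hd
    · refine ⟨0, by omega, ?_⟩
      rw [if_pos (Or.inl rfl), (e0 _).1, (e0 _).2]
      simpa using hY
  by_cases h1 : κ = 1
  · simp only [literal, if_neg h0, if_pos h1]
    by_cases hF : J.Forced ρ
    · refine ⟨0, by omega, ?_⟩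
      rw [if_pos (Or.inl hF), (e1 _).1, (e1 _).2, assignment_varY]
      refine ⟨fun _ => rfl, fun _ => ?_⟩
      obtain ⟨hc, hne, hforb⟩ := hF
      have hno := hf.window _ (Nat.lt_succ_iff.1 hstep) _ (J.slotA_lt hk ρ) _ (J.slotB_lt hk ρ) hne
      have hW : 0 < 2 ^ J.digits := by positivity
      -- A forbidden pair cannot be the pair of the queue, so a digit of one of its members differs;
      -- the tests for the second member are numbered from `digits` on.
      by_cases hA : f (J.stepOf ρ + J.slotA ρ) = J.tokenA ρ
      · by_cases hB : f (J.stepOf ρ + J.slotB ρ) = J.tokenB ρ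
        · rw [hA, hB] at hno
          exact absurd hforb hno
        · obtain ⟨p, hp, hd⟩ := exists_bit_ne (lt_two_pow_digits (hfn _))
            (Nat.mod_lt _ hW : J.tokenB ρ < _) hB
          refine ⟨J.digits + p, by omega, ?_⟩
          rw [Differs, if_neg (by omega), Nat.add_sub_cancel_left]
          exact hd
      · obtain ⟨p, hp, hd⟩ := exists_bit_ne (lt_two_pow_digits (hfn _))
          (Nat.mod_lt _ hW : J.tokenA ρ < _) hA
        refine ⟨p, by omega, ?_⟩
        rw [Differs, if_pos hp]
        exact hd
    · by_cases hY : J.assignment f (varY ρ)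
      · refine ⟨1, by omega, ?_⟩
        rw [if_pos (Or.inr (by omega)), (e1 _).1, (e1 _).2]
        simpa using hY
      · refine ⟨0, by omega, ?_⟩
        rw [if_neg (by tauto), (es _ 0 (by omega)).1, (es _ 0 (by omega)).2]
        simpa using hY
  have hpred : J.stepOf ρ % k ≠ 0 → (J.stepOf ρ - 1) / k = J.stepOf ρ / k := by
    intro hm
    have h1 := Nat.div_add_mod' (J.stepOf ρ) k
    have h2 := Nat.mod_lt (J.stepOf ρ) hk
    have h3 : J.stepOf ρ - 1 = J.stepOf ρ % k - 1 + J.stepOf ρ / k * k := by omega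
    rw [h3, Nat.add_mul_div_right _ _ hk, Nat.div_eq_of_lt (by omega), zero_add]
  by_cases h6 : κ = 6 ∧ J.stepOf ρ % k ≠ 0
  · simp only [literal, if_neg h0, if_neg h1, if_pos h6]
    by_cases hC : J.assignment f (J.varC (J.stepOf ρ - 1))
    · refine ⟨1, by omega, ?_⟩
      rw [if_neg (by omega), (e1 _).1, (e1 _).2, assignment_varC hk]
      rw [assignment_varC hk, hpred h6.2] at hC
      obtain ⟨e, he, h⟩ := hC
      exact ⟨fun _ => rfl, fun _ => ⟨e, by omega, h⟩⟩
    · refine ⟨0, by omega, ?_⟩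
      rw [if_pos rfl, (e0 _).1, (e0 _).2]
      simpa using hC
  by_cases h7 : κ < 6 ∧ J.phase ρ < J.digits ∧ J.stepOf ρ + 1 < J.steps ∧
      (κ < 4 ∨ J.stepOf ρ % k ≠ 0)
  · simp only [literal, if_neg h0, if_neg h1, if_neg h6, if_pos h7]
    -- If the digits agree, one of the first two literals is true. Otherwise this step is the change
    -- of its block: it is recorded now, and none was recorded before.
    by_cases hX : bit (f (J.stepOf ρ)) (J.phase ρ) = bit (f (J.stepOf ρ + k)) (J.phase ρ)
    · have hb := bit_lt (f (J.stepOf ρ)) (J.phase ρ)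
      by_cases hs : bit (f (J.stepOf ρ)) (J.phase ρ) = κ % 2
      · refine ⟨1, by omega, ?_⟩
        rw [if_neg (by omega), if_pos rfl, (es _ _ (by omega)).1, (es _ _ (by omega)).2,
          assignment_varX hk _ _ h7.2.1]
        omega
      · refine ⟨0, by omega, ?_⟩
        rw [if_pos rfl, (es _ _ (by omega)).1, (es _ _ (by omega)).2,
          assignment_varX hk _ _ h7.2.1]
        omega
    · refine ⟨2, by omega, ?_⟩
      have hne : f (J.stepOf ρ) ≠ f (J.stepOf ρ + k) := fun h => hX (by rw [h])
      rw [if_neg (by omega), if_neg (by omega)]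
      split_ifs with h4
      · rw [(e1 _).1, (e1 _).2, assignment_varC hk]
        exact ⟨fun _ => rfl, fun _ => ⟨_, le_rfl, rfl, hne⟩⟩
      · have hm := h7.2.2.2.resolve_left h4
        have h00 : J.stepOf ρ ≠ 0 := by intro h0; rw [h0] at hm; simp at hm
        rw [(e0 _).1, (e0 _).2, assignment_varC hk, hpred hm]
        refine ⟨?_, fun h => absurd h (by omega)⟩
        rintro ⟨e, he, hb, hch⟩
        exact absurd (hf.change e _ (by omega) (by have := h7.2.2.1; rw [steps] at this; omega)
          hb hch) hne
  · simp only [literal, if_neg h0, if_neg h1, if_neg h6, if_neg h7]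
    by_cases hY : J.assignment f (varY ρ)
    · refine ⟨1, by omega, ?_⟩
      rw [if_pos (by omega), (e1 _).1, (e1 _).2]
      simpa using hY
    · refine ⟨0, by omega, ?_⟩
      rw [if_neg (by omega), (es _ 0 (by omega)).1, (es _ 0 (by omega)).2]
      simpa using hY

theorem satisfiable_timed_iff (hk : 2 ≤ k) (hk' : 0 < k) :
    (J.timed hk').inst.formula.Satisfiable ↔ J.Answer := by
  rw [satisfiable_iff_sat]
  constructor
  · rintro ⟨σ, hσ⟩
    obtain ⟨f, hf⟩ := hσ.exists_queue hk'
    exact hf.answer hk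
  · intro h
    obtain ⟨f, hf, hfn⟩ := exists_queue hk h
    exact ⟨_, hf.sat hfn hk'⟩

end Reconf.Instance

/-! ### The program of the reduction from reconfiguration to satisfiability. -/

namespace Reconf

open RAM

/-- An instance with any number, at least two, of tokens. -/
abbrev AnyInstance := {x : Σ k, Instance k // 2 ≤ x.1}

namespace AnyInstance

variable (x : AnyInstance)

abbrev k : ℕ := x.1.1

abbrev inst : Instance x.k := x.1.2

def size : ℕ := x.inst.n + x.inst.len

theorem k_pos : 0 < x.k := by have := x.2; unfold k; omega

noncomputable def formula : PathSat.Instance := (x.inst.timed x.k_pos).inst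

noncomputable def inp (a i : ℕ) : ℕ := (x.inst.encode.getD a []).getD i 0

/-- The arrays that are computed from an instance. -/
noncomputable def arrays : ℕ → ℕ → ℕ
  | 0 => x.inp 0
  | 1 => x.inp 1
  | 2 => x.inp 2
  | 3 => x.inp 3
  | 4 => trunc (fun i => 2 ^ i) (2 * x.inst.n + 2)
  | 5 => trunc (fun _ => x.inst.digits) 1
  | a + 6 => fun i => (x.formula.encode.getD a []).getD i 0

noncomputable def arrayLen : ℕ → AnyInstance → ℕ
  | 4, x => 2 * x.inst.n + 2
  | 5, _ => 1
  | 6, _ => 3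
  | 7, x => x.formula.numClauses * 3
  | _, x => x.formula.numBags * x.formula.numVars

variable {x}

theorem inp_one (u : Fin x.inst.n) : x.inp 1 u = ind (u ∈ x.inst.source) := by
  simp only [inp, Instance.encode, List.getD_cons_succ, List.getD_cons_zero]
  rw [List.getD_ofFn_zero, dif_pos u.2, ite_eq_ind]

theorem inp_two (u : Fin x.inst.n) : x.inp 2 u = ind (u ∈ x.inst.target) := by
  simp only [inp, Instance.encode, List.getD_cons_succ, List.getD_cons_zero]
  rw [List.getD_ofFn_zero, dif_pos u.2, ite_eq_ind]

theorem inp_three (u v : Fin x.inst.n) :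
    x.inp 3 (u * x.inst.n + v) = ind (x.inst.graph.Adj u v) := by
  have hlt : (u : ℕ) * x.inst.n + v < x.inst.n * x.inst.n := by
    have := Nat.mul_le_mul_right x.inst.n u.2
    rw [Nat.succ_mul] at this
    have := v.2
    omega
  simp only [inp, Instance.encode, List.getD_cons_succ, List.getD_cons_zero]
  rw [List.getD_ofFn_zero, dif_pos hlt, ite_eq_ind]
  have hn : 0 < x.inst.n := u.pos
  have h1 : Fin.divNat (⟨u * x.inst.n + v, hlt⟩ : Fin (x.inst.n * x.inst.n)) = u := by
    ext
    change (u * x.inst.n + v) / x.inst.n = (u : ℕ)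
    rw [Nat.add_comm, Nat.add_mul_div_right _ _ hn, Nat.div_eq_of_lt v.2, zero_add]
  have h2 : Fin.modNat (⟨u * x.inst.n + v, hlt⟩ : Fin (x.inst.n * x.inst.n)) = v := by
    ext
    change (u * x.inst.n + v) % x.inst.n = (v : ℕ)
    rw [Nat.mul_add_mod', Nat.mod_eq_of_lt v.2]
  rw [h1, h2]

/-- Cells outside the input tables do no harm: candidates that are not vertices are already decided
by the first two alternatives. -/
theorem forbidden_iff (last e u v : ℕ) : x.inst.Forbidden last e u v ↔
    x.inst.n ≤ u ∨ x.inst.n ≤ v ∨ u = v ∨ x.inp 3 (u * x.inst.n + v) = 1 ∨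
      (e = 0 ∧ ¬ x.inp 1 u = 1) ∨ (e = last ∧ ¬ x.inp 2 u = 1) := by
  rw [Instance.Forbidden]
  by_cases hu : x.inst.n ≤ u
  · simp [hu]
  by_cases hv : x.inst.n ≤ v
  · simp [hv]
  obtain ⟨u, rfl⟩ : ∃ a : Fin x.inst.n, (a : ℕ) = u := ⟨⟨u, by omega⟩, rfl⟩
  obtain ⟨v, rfl⟩ : ∃ a : Fin x.inst.n, (a : ℕ) = v := ⟨⟨v, by omega⟩, rfl⟩
  rw [inp_one, inp_two, inp_three, ind_eq_one, ind_eq_one, ind_eq_one]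
  simp [← Fin.ext_iff]

theorem digits_le : x.inst.digits ≤ x.inst.n := by
  rw [Instance.digits, Nat.size_le]
  exact Nat.lt_two_pow_self

theorem digits_eq : x.inst.digits = ∑ c ∈ Finset.range x.inst.n, ind (2 ^ c ≤ x.inst.n) := by
  have h : ∀ c, 2 ^ c ≤ x.inst.n ↔ c < x.inst.digits := fun c => Nat.lt_size.symm
  simp only [h, sum_ind_lt]
  have := x.digits_le
  omega

/-- The source consists of `k` vertices. Thus polynomials in `k` are polynomials in `n` with an
exponent independent of `k`, as a single algorithm for all `k` requires. -/
theorem k_le : x.k ≤ x.inst.n :=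
  x.inst.card_source.symm.trans_le ((Finset.card_le_univ _).trans_eq (Fintype.card_fin _))

theorem two_pow_digits_le : 2 ^ x.inst.digits ≤ 2 * x.inst.n := by
  have hn : x.inst.n ≠ 0 := by have := x.k_le; have := x.k_pos; omega
  have h1 : x.inst.digits - 1 < x.inst.n.size := by
    have := Nat.size_pos.2 (Nat.pos_of_ne_zero hn)
    rw [Instance.digits]; omega
  have h2 : x.inst.digits = x.inst.digits - 1 + 1 := by
    rw [Instance.digits] at h1 ⊢; omega
  rw [h2, pow_succ, mul_comm]
  exact Nat.mul_le_mul_left _ (Nat.lt_size.1 h1)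

section

variable {Δ : Type} {c : Ctx Δ} {π : Δ → AnyInstance} {i : ℕ}

/-- The context `c` knows the first `i` arrays. -/
structure View (c : Ctx Δ) (π : Δ → AnyInstance) (i : ℕ) : Prop where
  knows : Knows c π arrays i
  size_eq : ∀ δ, c.size δ = (π δ).size
  three_lt : 3 < i

namespace View

variable {f g e ρ κ ι u v : Δ → ℕ}

theorem lift (V : View c π i) {x : ℕ} {hx : c.top ≤ x} :
    View (c.ext g x hx) (fun δ => π δ.1) i :=
  ⟨V.knows.lift, fun δ => V.size_eq δ.1, V.three_lt⟩

theorem inp (V : View c π i) (n : ℕ) (hn : n < 4) (hf : Comp c f) :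
    Comp c fun δ => (π δ).inp n (f δ) := by
  have hi := V.three_lt
  interval_cases n
  · exact V.knows.load 0 (by omega) hf
  · exact V.knows.load 1 (by omega) hf
  · exact V.knows.load 2 (by omega) hf
  · exact V.knows.load 3 (by omega) hf

theorem n (V : View c π i) : Comp c fun δ => (π δ).inst.n := V.inp 0 (by omega) (.const c 0)

theorem k (V : View c π i) : Comp c fun δ => (π δ).k := V.inp 0 (by omega) (.const c 1)

theorem len (V : View c π i) : Comp c fun δ => (π δ).inst.len := V.inp 0 (by omega) (.const c 2)

theorem bdd (V : View c π i) (hf : ∀ δ, f δ ≤ (π δ).size) : PolyBdd c.size f :=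
  (PolyBdd.self c.size).mono fun δ => by rw [V.size_eq]; exact hf δ

theorem forbidden (V : View c π i) {last : Δ → ℕ} (hl : Comp c last) (he : Comp c e)
    (hu : Comp c u) (hv : Comp c v) :
    CompP c fun δ => (π δ).inst.Forbidden (last δ) (e δ) (u δ) (v δ) :=
  ((CompP.le V.n hu).or ((CompP.le V.n hv).or ((CompP.eq hu hv).or
    ((CompP.eq (V.inp 3 (by omega) ((hu.mul V.n).add hv)) (.const c 1)).or
      (((CompP.eq he (.const c 0)).and (CompP.eq (V.inp 1 (by omega) hu) (.const c 1)).not).or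
        ((CompP.eq he hl).and (CompP.eq (V.inp 2 (by omega) hu) (.const c 1)).not)))))).congr
    fun _ => (forbidden_iff _ _ _ _).symm

theorem pow (V : View c π i) (hi : 4 < i) (hf : Comp c f)
    (hlt : ∀ δ, f δ < 2 * (π δ).inst.n + 2) : Comp c fun δ => 2 ^ f δ :=
  (V.knows.load 4 hi hf).congr fun δ => by simp only [arrays, trunc, hlt, if_true]

theorem bit (V : View c π i) (hi : 4 < i) (hu : Comp c u) (hf : Comp c f)
    (hlt : ∀ δ, f δ < 2 * (π δ).inst.n + 2) : Comp c fun δ => RAM.bit (u δ) (f δ) :=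
  (hu.div (V.pow hi hf hlt)).mod (.const c 2)

theorem digits (V : View c π i) (hi : 5 < i) : Comp c fun δ => (π δ).inst.digits :=
  (V.knows.load 5 hi (.const c 0)).congr fun δ => by simp [arrays, trunc]

theorem pow_digits (V : View c π i) (hi : 5 < i) : Comp c fun δ => 2 ^ (π δ).inst.digits :=
  V.pow (by omega) (V.digits hi) fun δ => by have := (π δ).digits_le; omega

theorem checks (V : View c π i) (hi : 5 < i) : Comp c fun δ => (π δ).inst.checks :=
  ((Comp.const c 2).mul (V.digits hi)).add (.const c 1)

theorem period (V : View c π i) (hi : 5 < i) : Comp c fun δ => (π δ).inst.period :=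
  (((V.k.mul V.k).mul (V.pow_digits hi)).mul (V.pow_digits hi)).mul (V.checks hi)

theorem steps (V : View c π i) : Comp c fun δ => (π δ).inst.steps :=
  (V.len.mul V.k).add (.const c 1)

theorem stepOf (V : View c π i) (hi : 5 < i) (hρ : Comp c ρ) :
    Comp c fun δ => (π δ).inst.stepOf (ρ δ) := hρ.div (V.period hi)

theorem phase (V : View c π i) (hi : 5 < i) (hρ : Comp c ρ) :
    Comp c fun δ => (π δ).inst.phase (ρ δ) := hρ.mod (V.period hi)

theorem checkOf (V : View c π i) (hi : 5 < i) (hρ : Comp c ρ) :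
    Comp c fun δ => (π δ).inst.checkOf (ρ δ) := (V.phase hi hρ).mod (V.checks hi)

theorem tokenB (V : View c π i) (hi : 5 < i) (hρ : Comp c ρ) :
    Comp c fun δ => (π δ).inst.tokenB (ρ δ) :=
  ((V.phase hi hρ).div (V.checks hi)).mod (V.pow_digits hi)

theorem tokenA (V : View c π i) (hi : 5 < i) (hρ : Comp c ρ) :
    Comp c fun δ => (π δ).inst.tokenA (ρ δ) :=
  (((V.phase hi hρ).div (V.checks hi)).div (V.pow_digits hi)).mod (V.pow_digits hi)

theorem slotB (V : View c π i) (hi : 5 < i) (hρ : Comp c ρ) :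
    Comp c fun δ => (π δ).inst.slotB (ρ δ) :=
  ((((V.phase hi hρ).div (V.checks hi)).div (V.pow_digits hi)).div (V.pow_digits hi)).mod V.k

theorem slotA (V : View c π i) (hi : 5 < i) (hρ : Comp c ρ) :
    Comp c fun δ => (π δ).inst.slotA (ρ δ) :=
  ((((V.phase hi hρ).div (V.checks hi)).div (V.pow_digits hi)).div (V.pow_digits hi)).div V.k

theorem varY (hρ : Comp c ρ) : Comp c fun δ => Instance.varY (ρ δ) := (Comp.const c 3).mul hρ

theorem varC (V : View c π i) (hi : 5 < i) (he : Comp c e) :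
    Comp c fun δ => (π δ).inst.varC (e δ) :=
  ((Comp.const c 3).mul (he.mul (V.period hi))).add (.const c 1)

theorem varX (V : View c π i) (hi : 5 < i) (he : Comp c e) (hf : Comp c f) :
    Comp c fun δ => (π δ).inst.varX (e δ) (f δ) :=
  ((Comp.const c 3).mul ((he.mul (V.period hi)).add hf)).add (.const c 2)

theorem forced (V : View c π i) (hi : 5 < i) (hρ : Comp c ρ) :
    CompP c fun δ => (π δ).inst.Forced (ρ δ) :=
  (CompP.eq (V.checkOf hi hρ) ((Comp.const c 2).mul (V.digits hi))).and
    ((CompP.eq (V.slotA hi hρ) (V.slotB hi hρ)).not.and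
      (V.forbidden (V.len.mul V.k) (V.stepOf hi hρ) (V.tokenA hi hρ) (V.tokenB hi hρ)))

theorem pos (hf : Comp c f) : Comp c fun δ => 2 * f δ + 1 :=
  ((Comp.const c 2).mul hf).add (.const c 1)

theorem neg (hf : Comp c f) : Comp c fun δ => 2 * f δ := (Comp.const c 2).mul hf

theorem testCode (V : View c π i) (hi : 5 < i) (hρ : Comp c ρ) :
    Comp c fun δ => (π δ).inst.testCode (ρ δ) := by
  have hp := (V.checkOf hi hρ).sub (.const c 1)
  have hq := hp.sub (V.digits hi)
  have hle : ∀ δ, (π δ).inst.checkOf (ρ δ) ≤ 2 * (π δ).inst.n := fun δ =>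
    (Instance.checkOf_le _).trans (Nat.mul_le_mul_left _ digits_le)
  have lt1 : ∀ δ, (π δ).inst.checkOf (ρ δ) - 1 < 2 * (π δ).inst.n + 2 := fun δ => by
    have := hle δ; omega
  have lt2 : ∀ δ, (π δ).inst.checkOf (ρ δ) - 1 - (π δ).inst.digits < 2 * (π δ).inst.n + 2 :=
    fun δ => by have := hle δ; omega
  exact Comp.ite (CompP.lt hp (V.digits hi))
    ((neg (V.varX hi ((V.stepOf hi hρ).add (V.slotA hi hρ)) hp)).add
      ((Comp.const c 1).sub (V.bit (by omega) (V.tokenA hi hρ) hp lt1)))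
    ((neg (V.varX hi ((V.stepOf hi hρ).add (V.slotB hi hρ)) hq)).add
      ((Comp.const c 1).sub (V.bit (by omega) (V.tokenB hi hρ) hq lt2)))

open Classical in
theorem literal (V : View c π i) (hi : 5 < i) (hρ : Comp c ρ) (hκ : Comp c κ) (hι : Comp c ι) :
    Comp c fun δ => (π δ).inst.literal (ρ δ) (κ δ) (ι δ) := by
  have hi0 := CompP.eq hι (.const c 0)
  have hi1 := CompP.eq hι (.const c 1)
  have hs := V.stepOf hi hρ
  have hp := V.phase hi hρ
  have hm := (CompP.eq (hs.mod V.k) (.const c 0)).not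
  have hs' := hs.sub (.const c 1)
  have h4 := CompP.lt hκ (.const c 4)
  have h2 := hκ.mod (.const c 2)
  unfold Instance.literal
  refine Comp.ite (CompP.eq hκ (.const c 0)) (Comp.ite
    (hi0.or (CompP.eq (V.checkOf hi hρ) (.const c 0))) (neg (varY hρ))
    (Comp.ite hi1 (pos (varY (hρ.sub (.const c 1)))) (V.testCode hi hρ))) ?_
  refine Comp.ite (CompP.eq hκ (.const c 1)) ((neg (varY hρ)).add
    (Comp.ite ((V.forced hi hρ).or hi0.not) (.const c 1) (.const c 0))) ?_
  refine Comp.ite ((CompP.eq hκ (.const c 6)).and hm) (Comp.ite hi0 (neg (V.varC hi hs'))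
    (pos (V.varC hi hs))) ?_
  refine Comp.ite ((CompP.lt hκ (.const c 6)).and ((CompP.lt hp (V.digits hi)).and
    ((CompP.lt (hs.add (.const c 1)) V.steps).and (h4.or hm)))) ?_
    ((neg (varY hρ)).add (Comp.ite hi0.not (.const c 1) (.const c 0)))
  exact Comp.ite hi0 ((neg (V.varX hi hs hp)).add ((Comp.const c 1).sub h2)) (Comp.ite hi1
    ((neg (V.varX hi (hs.add V.k) hp)).add h2) (Comp.ite h4 (pos (V.varC hi hs))
      (neg (V.varC hi hs'))))

theorem begins (V : View c π i) (hi : 5 < i) (hv : Comp c v) :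
    Comp c fun δ => (π δ).inst.begins (v δ) := by
  have hd := hv.div (.const c 3)
  have hR := V.period hi
  exact Comp.ite ((CompP.eq (hv.mod (.const c 3)) (.const c 2)).and
    (CompP.lt (hd.mod hR) (V.digits hi))) (((hd.div hR).sub V.k).mul hR) hd

theorem ends (V : View c π i) (hi : 5 < i) (hv : Comp c v) :
    Comp c fun δ => (π δ).inst.ends (v δ) := by
  have hd := hv.div (.const c 3)
  have hm := hv.mod (.const c 3)
  have hR := V.period hi
  exact Comp.ite (CompP.eq hm (.const c 0)) (hd.add (.const c 1)) (Comp.ite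
    (CompP.eq hm (.const c 1)) (Comp.ite (CompP.eq (hd.mod hR) (.const c 0))
      (hd.add (((Comp.const c 2).mul hR).sub (.const c 1))) hd)
    (Comp.ite (CompP.lt (hd.mod hR) (V.digits hi))
      (((hd.div hR).mul hR).add (hR.sub (.const c 1))) hd))

theorem numBags (V : View c π i) (hi : 5 < i) : Comp c fun δ => (π δ).formula.numBags :=
  (V.steps.add V.k).mul (V.period hi)

theorem numVars (V : View c π i) (hi : 5 < i) : Comp c fun δ => (π δ).formula.numVars :=
  (V.numBags hi).mul (.const c 3)

theorem numClauses (V : View c π i) (hi : 5 < i) : Comp c fun δ => (π δ).formula.numClauses :=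
  (V.steps.mul (V.period hi)).mul (.const c 7)

end View

end

theorem encode_literals {i : ℕ} (hi : i < x.formula.numClauses * 3) :
    x.arrays 7 i = x.inst.literal (i / 3 / 7) (i / 3 % 7) (i % 3) := by
  have h : x.arrays 7 i = (x.formula.encode.getD 1 []).getD i 0 := rfl
  rw [h]
  simp only [PathSat.Instance.encode, List.getD_cons_succ, List.getD_cons_zero]
  rw [List.getD_ofFn_zero, dif_pos hi]
  change 2 * (x.inst.literal (i / 3 / 7) (i / 3 % 7) (i % 3) / 2) +
    (decide (x.inst.literal (i / 3 / 7) (i / 3 % 7) (i % 3) % 2 = 1)).toNat = _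
  generalize x.inst.literal (i / 3 / 7) (i / 3 % 7) (i % 3) = y
  by_cases hy : y % 2 = 1
  · simp only [hy, decide_true, Bool.toNat_true]; omega
  · simp only [hy, decide_false, Bool.toNat_false]; omega

theorem encode_bags {i : ℕ} (hi : i < x.formula.numBags * x.formula.numVars) :
    x.arrays 8 i = ind (x.inst.begins (i % x.formula.numVars) ≤ i / x.formula.numVars ∧
      i / x.formula.numVars ≤ x.inst.ends (i % x.formula.numVars)) := by
  have h : x.arrays 8 i = (x.formula.encode.getD 2 []).getD i 0 := rfl
  rw [h]
  simp only [PathSat.Instance.encode, List.getD_cons_succ, List.getD_cons_zero]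
  rw [List.getD_ofFn_zero, dif_pos hi, ite_eq_ind]
  exact congrArg ind (propext (PathSat.Timed.mem_bag _ _ _))

theorem arrays_zero (a : ℕ) (h4 : 4 ≤ a) (h9 : a < 9) (x : AnyInstance) (i : ℕ)
    (hi : arrayLen a x ≤ i) : x.arrays a i = 0 := by
  have hnot := not_lt.2 hi
  interval_cases a
  · exact if_neg hnot
  · exact if_neg hnot
  · change [x.formula.numVars, x.formula.numClauses, x.formula.numBags].getD i 0 = 0
    rw [List.getD_eq_default _ _ hi]
  · exact List.getD_eq_default _ _ ((le_of_eq List.length_ofFn).trans hi)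
  · exact List.getD_eq_default _ _ ((le_of_eq List.length_ofFn).trans hi)

theorem bdd_numBags : PolyBdd size fun x => x.formula.numBags := by
  have hs := PolyBdd.self size
  have hc := PolyBdd.const size
  have hn : PolyBdd size fun x => x.inst.n := hs.mono fun x => by rw [size]; omega
  have hl : PolyBdd size fun x => x.inst.len := hs.mono fun x => by rw [size]; omega
  have hk : PolyBdd size fun x => x.k := hn.mono fun x => x.k_le
  have hd : PolyBdd size fun x => x.inst.digits := hn.mono fun x => x.digits_le
  have hW : PolyBdd size fun x => 2 ^ x.inst.digits :=
    ((hc 2).mul hn).mono fun x => x.two_pow_digits_le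
  exact (((hl.mul hk).add (hc 1)).add hk).mul ((((hk.mul hk).mul hW).mul hW).mul
    (((hc 2).mul hd).add (hc 1)))

theorem bdd_numVars : PolyBdd size fun x => x.formula.numVars :=
  bdd_numBags.mul (PolyBdd.const _ 3)

theorem bdd_numClauses : PolyBdd size fun x => x.formula.numClauses :=
  (bdd_numBags.mul (PolyBdd.const _ 7)).mono fun _ =>
    Nat.mul_le_mul_right _ (Nat.mul_le_mul_right _ (Nat.le_add_right _ _))

/-- Here the whole table has polynomial size, so no extra factor for the number of entries is
needed. -/
theorem exists_fill : ∃ (p : Prog) (R : ℕ) (T : AnyInstance → ℕ), PolyBdd size T ∧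
    ∀ x s, s.arr = stage arrays 4 x → ∃ t s', Exec p s t s' ∧ s'.arr = stage arrays 9 x ∧
      (∀ y ≥ R, s'.reg y = s.reg y) ∧ t ≤ (0 + 1) * T x := by
  have hs : PolyBdd size size := PolyBdd.self _
  have hc := PolyBdd.const size
  have hn : PolyBdd size fun x => x.inst.n := hs.mono fun x => by rw [size]; omega
  refine (fill_all (cnt := fun _ => 0) (len := arrayLen) (i₀ := 4) (N := 9) ?_
    (fun a h3 h9 x i => arrays_zero a h3 h9 x i) ?_ ?_ ?_ 9 (by omega) le_rfl).2
  · intro a ha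
    have key : ∀ x : AnyInstance, ∀ a < 4, ∀ j, x.arrays a j ≤ x.size + 1 := by
      intro x a ha j
      have hk := x.k_le
      interval_cases a
      · change [x.inst.n, x.k, x.inst.len].getD j 0 ≤ _
        rcases j with _ | _ | _ | j <;> simp [size] <;> omega
      all_goals
        simp only [arrays, inp, Instance.encode, List.getD_cons_succ, List.getD_cons_zero]
        rw [List.getD_ofFn_zero]
        split_ifs <;> omega
    obtain ⟨D, hD⟩ := (hs.add (hc 1)).natSize
    exact ⟨D, fun x j => (Nat.size_le_size (key x a ha j)).trans (hD x)⟩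
  · intro a h4 h9
    have small : ∀ {f : AnyInstance → ℕ}, PolyBdd size f →
        ∃ D, ∀ x, f x ≤ (0 + 1) * (x.size + 2) ^ D := fun hf =>
      hf.imp fun D hD x => (hD x).trans (by omega)
    interval_cases a
    · exact small (((hc 2).mul hn).add (hc 2))
    · exact small (hc 1)
    · exact small (hc 3)
    · exact small (bdd_numClauses.mul (hc 3))
    · exact small (bdd_numBags.mul bdd_numVars)
  · intro a h4 h9 c hsize hk
    have V : View c id a := ⟨hk, fun x => by rw [hsize]; rfl, h4⟩
    interval_cases a
    · exact ((Comp.const c 2).mul V.n).add (.const c 2)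
    · exact .const c 1
    · exact .const c 3
    · exact (V.numClauses (by omega)).mul (.const c 3)
    · exact (V.numBags (by omega)).mul (V.numVars (by omega))
  · intro a h4 h9 c hsize hk hself' hidx
    have V : View c Sigma.fst a := ⟨hk, fun x => by rw [hsize], h4⟩
    have bdd_n : PolyBdd c.size fun δ => δ.1.inst.n := V.bdd fun δ => by rw [size]; omega
    interval_cases a
    · have hread : Comp c fun δ => trunc (δ.1.arrays 4) δ.2 (δ.2 - 1) := by
        refine Comp.load (a := 4) (m := fun δ => trunc (δ.1.arrays 4) δ.2)
          (fun δ i => by rw [hself']) ?_ (hidx.sub (.const c 1))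
        refine (((PolyBdd.const _ 2).mul bdd_n).add (PolyBdd.const _ 3)).imp
          fun D hD δ i => le_trans ?_ (hD δ)
        rw [Nat.size_le]
        simp only [trunc, arrays]
        split_ifs
        · exact Nat.pow_lt_pow_right (by omega) (by omega)
        · positivity
        · positivity
      refine (Comp.ite (CompP.eq hidx (.const c 0)) (.const c 1) ((Comp.const c 2).mul hread)).congr
        fun δ => ?_
      have hlt : (δ.2 : ℕ) < 2 * δ.1.inst.n + 2 := δ.2.isLt
      simp only [arrays, trunc, hlt, if_true]
      have h2 : ((δ.2 : ℕ) ≠ 0 → (δ.2 : ℕ) - 1 < δ.2) ∧ (δ.2 : ℕ) - 1 < 2 * δ.1.inst.n + 2 := by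
        omega
      split_ifs with h1
      · simp [h1]
      · rw [← pow_succ', Nat.sub_add_cancel (by omega)]
      · omega
      · omega
    · refine (Comp.sum (h := fun δ j => ind (2 ^ j ≤ δ.1.inst.n)) V.n bdd_n fun y hy =>
        CompP.le (V.lift.pow (by omega) (.index bdd_n) fun δ => ?_) V.n.lift).congr fun δ => ?_
      · have : (δ.2 : ℕ) < δ.1.1.inst.n := δ.2.isLt
        omega
      · have hlt : (δ.2 : ℕ) < 1 := δ.2.isLt
        simp only [arrays, trunc, hlt, if_true]
        exact digits_eq.symm
    · refine (Comp.ite (CompP.eq hidx (.const c 0)) (V.numVars (by omega)) (Comp.ite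
        (CompP.eq hidx (.const c 1)) (V.numClauses (by omega))
          (V.numBags (by omega)))).congr fun δ => ?_
      obtain ⟨x, i⟩ := δ
      change (if (i : ℕ) = 0 then x.formula.numVars else if (i : ℕ) = 1 then
        x.formula.numClauses else x.formula.numBags) =
          [x.formula.numVars, x.formula.numClauses, x.formula.numBags].getD i 0
      have hlt : (i : ℕ) < 3 := i.isLt
      generalize (i : ℕ) = y at hlt
      interval_cases y <;> rfl
    · have hd := hidx.div (.const c 3)
      exact Comp.congr (V.literal (by omega) (hd.div (.const c 7)) (hd.mod (.const c 7))
        (hidx.mod (.const c 3))) fun δ => (encode_literals δ.2.isLt).symm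
    · have hN := V.numVars (by omega)
      have hd := hidx.div hN
      have hm := hidx.mod hN
      exact Comp.congr ((CompP.le (V.begins (by omega) hm) hd).and
        (CompP.le hd (V.ends (by omega) hm))) fun δ => (encode_bags δ.2.isLt).symm

/-- Reconfiguration is decided by reduction to path-decomposed satisfiability. -/
theorem exists_reduction (q : Prog) : ∃ (p : Prog) (D : ℕ), ∀ (x : AnyInstance) (bound : ℝ),
    Decides q x.formula.encode x.formula.formula.Satisfiable bound →
    Decides p x.inst.encode x.inst.Answer (((x.size : ℝ) + 2) ^ D + 2 * bound + 3) := by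
  obtain ⟨p, D, h⟩ := decides_of_fill (input := fun x : AnyInstance => x.inst.encode)
    (enc := fun x : AnyInstance => x.formula.encode) (A := 6) (fun _ => le_rfl)
    (fun x a ha j => by interval_cases a <;> rfl) (fun _ => le_rfl)
    (fun x a _ j => by rw [Nat.add_comm 6 a]; rfl) exists_fill q
  refine ⟨p, D, fun x bound hb => ?_⟩
  have hiff := x.inst.satisfiable_timed_iff x.2 x.k_pos
  have := h x _ bound hb
  rw [formula, hiff] at this
  simpa using this

end AnyInstance

end Reconf

/-! ### Running times: fast satisfiability gives fast reconfiguration. -/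

/-- Rounding `log n` up to whole digits costs a factor of at most two per token, at most `4 ^ k` in
all. This is not a constant when `k` varies, but `4 ≤ n ^ δ` turns it into `n ^ (δ * k)`. The
constant `32 = 2 ^ 5` comes from the additive term of the width. -/
theorem Real.rpow_pow_le_of_two_pow_le {β δ n : ℝ} {k b w : ℕ} (hβ0 : 0 ≤ β) (hβ1 : β ≤ 1)
    (hk : 1 ≤ k) (hn : 1 ≤ n) (h4 : 4 ≤ n ^ δ) (h2 : (2 : ℝ) ^ b ≤ 2 * n)
    (hw : w ≤ (k + 1) * b + 5) :
    ((2 : ℝ) ^ β) ^ w ≤ 32 * n ^ (β * (k + 1) + δ * k) := by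
  have hkr : (1 : ℝ) ≤ k := by exact_mod_cast hk
  have hB1 : 1 ≤ (2 : ℝ) ^ β := Real.one_le_rpow (by norm_num) hβ0
  have hB2 : (2 : ℝ) ^ β ≤ 2 := by
    calc (2 : ℝ) ^ β ≤ 2 ^ (1 : ℝ) := Real.rpow_le_rpow_of_exponent_le (by norm_num) hβ1
      _ = 2 := Real.rpow_one 2
  have hβk : β * (k + 1) ≤ 2 * k := by
    have := mul_le_mul_of_nonneg_right hβ1 (by linarith : (0 : ℝ) ≤ k + 1)
    linarith
  have h3 : (2 : ℝ) ^ (β * (k + 1)) ≤ n ^ (δ * k) := by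
    calc (2 : ℝ) ^ (β * (k + 1)) ≤ 2 ^ ((2 : ℝ) * k) :=
          Real.rpow_le_rpow_of_exponent_le (by norm_num) hβk
      _ = 4 ^ (k : ℝ) := by rw [Real.rpow_mul (by norm_num)]; norm_num
      _ ≤ (n ^ δ) ^ (k : ℝ) := Real.rpow_le_rpow (by norm_num) h4 (by linarith)
      _ = n ^ (δ * k) := by rw [← Real.rpow_mul (by linarith)]
  calc ((2 : ℝ) ^ β) ^ w ≤ ((2 : ℝ) ^ β) ^ ((k + 1) * b + 5) := pow_le_pow_right₀ hB1 hw
    _ = ((2 : ℝ) ^ β) ^ ((k + 1) * b) * ((2 : ℝ) ^ β) ^ 5 := pow_add _ _ _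
    _ = ((2 : ℝ) ^ b) ^ (β * (k + 1)) * ((2 : ℝ) ^ β) ^ 5 := by
      congr 1
      rw [← Real.rpow_natCast, ← Real.rpow_natCast, ← Real.rpow_mul (by norm_num),
        ← Real.rpow_mul (by norm_num)]
      congr 1
      push_cast
      ring
    _ ≤ (2 * n) ^ (β * (k + 1)) * 2 ^ 5 :=
      mul_le_mul (Real.rpow_le_rpow (by positivity) h2 (by positivity))
        (pow_le_pow_left₀ (by linarith) hB2 5) (by positivity) (by positivity)
    _ = 32 * (n ^ (β * (k + 1)) * 2 ^ (β * (k + 1))) := by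
      rw [Real.mul_rpow (by norm_num) (by linarith)]; ring
    _ ≤ 32 * (n ^ (β * (k + 1)) * n ^ (δ * k)) := by gcongr
    _ = _ := by rw [← Real.rpow_add (by linarith)]

-- The formula has width about `(k + 1) * log n`, so the assumed algorithm takes `n ^ (β * (k + 1))`
-- up to polynomial factors with a fixed exponent. The loss of one token, of rounding and of these
-- factors is covered by the gain `(1 - β) * k` once `k` is large.
open RAM in
theorem Reconf.exists_of_not_PPSETH (h : ¬ PathSat.PPSETH) :
    ∃ (ε : ℝ) (k₀ : ℕ), 0 < ε ∧ 4 ≤ k₀ ∧ ∃ (p : Prog) (C : ℝ) (c : ℕ), ∀ k : ℕ, k₀ ≤ k →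
      ∀ I : Instance k, Decides p I.encode I.Answer
        (C * (I.n : ℝ) ^ ((1 - ε) * (k : ℝ)) * ((I.len : ℝ) + 1) ^ c) := by
  unfold PathSat.PPSETH at h
  push Not at h
  obtain ⟨ε, hε0, hε2, q, C, c, hq⟩ := h
  obtain ⟨p, D, hp⟩ := AnyInstance.exists_reduction q
  obtain ⟨E, hE⟩ : PolyBdd AnyInstance.size fun x => x.formula.size + 1 :=
    ((AnyInstance.bdd_numVars.add AnyInstance.bdd_numClauses).add AnyInstance.bdd_numBags).add
      (PolyBdd.const _ 1)
  -- A base of at least one makes the powers monotone in the width and the exponent `β` nonnegative.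
  set B : ℝ := max (2 - ε) 1 with hB
  have hB1 : 1 ≤ B := le_max_right _ _
  have hBε : 2 - ε ≤ B := le_max_left _ _
  have hB2 : B < 2 := max_lt (by linarith) (by norm_num)
  set β : ℝ := Real.logb 2 B with hβ
  have hBβ : B = 2 ^ β := (Real.rpow_logb (by norm_num) (by norm_num) (by linarith)).symm
  have hβ0 : 0 ≤ β := Real.logb_nonneg (by norm_num) hB1
  have hβ1 : β < 1 := by
    rw [hβ, Real.logb_lt_iff_lt_rpow (by norm_num) (by linarith), Real.rpow_one]
    exact hB2
  set M : ℕ := D + E * c with hM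
  -- Of the four parts `δ` of the gain, one pays for rounding, one is the final saving, and two are
  -- left for the terms that do not grow with `k`.
  set δ : ℝ := (1 - β) / 4 with hδ
  have hδ0 : 0 < δ := by rw [hδ]; linarith
  clear_value B β M δ
  -- The summands ensure `4 ≤ k`, `4 ≤ n ^ δ` (through `k ≤ n`), and `1 + 2 * M ≤ 2 * δ * k`.
  obtain ⟨k₀, hk₀⟩ := exists_nat_ge (4 + (4 : ℝ) ^ (1 / δ) + (1 + 2 * M) / (2 * δ))
  have hz1 : (0 : ℝ) ≤ (4 : ℝ) ^ (1 / δ) := by positivity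
  have hz2 : (0 : ℝ) ≤ (1 + 2 * M) / (2 * δ) := by positivity
  refine ⟨δ, k₀, hδ0, by exact_mod_cast (by linarith : (4 : ℝ) ≤ k₀), p, 64 * |C| + 4, M,
    fun k hk I => ?_⟩
  have hkr : (k₀ : ℝ) ≤ k := by exact_mod_cast hk
  have hk4 : (4 : ℝ) ≤ k := by linarith
  have hk2 : 2 ≤ k := by
    have : 4 ≤ k := by exact_mod_cast hk4
    omega
  let x : AnyInstance := ⟨⟨k, I⟩, hk2⟩
  have hkn : (k : ℝ) ≤ I.n := by exact_mod_cast x.k_le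
  set n : ℝ := (I.n : ℝ) with hn
  set L : ℝ := (I.len : ℝ) + 1 with hL
  set S : ℝ := (x.size : ℝ) + 2 with hS
  set w : ℕ := PathSat.width x.formula.bag with hw
  clear_value n L S w
  have hL1 : 1 ≤ L := by
    have : (0 : ℝ) ≤ I.len := Nat.cast_nonneg _
    linarith
  have hn1 : (1 : ℝ) ≤ n := by linarith
  have hS1 : 1 ≤ S := by
    have : (0 : ℝ) ≤ x.size := Nat.cast_nonneg _
    linarith
  have hSn : S ≤ n ^ 2 * L := by
    have h1 : S = n + L + 1 := by
      have : (x.size : ℝ) = I.n + I.len := by exact_mod_cast rfl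
      rw [hS, hL, hn, this]; ring
    rw [h1]
    have hn4 : 4 * n ≤ n ^ 2 := by
      rw [sq]; exact mul_le_mul_of_nonneg_right (hk4.trans hkn) (by linarith)
    have h2 := mul_nonneg (by linarith : 0 ≤ n ^ 2 - n - 2) (by linarith : 0 ≤ L - 1)
    have h3 : 0 ≤ n * (L - 1) := mul_nonneg (by linarith) (by linarith)
    linarith
  have hSM : S ^ M ≤ n ^ (2 * M) * L ^ M := by
    rw [pow_mul, ← mul_pow]
    exact pow_le_pow_left₀ (by linarith) hSn M
  have hwidth : B ^ w ≤ 32 * n ^ (β * (k + 1) + δ * k) := by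
    have h2 : (2 : ℝ) ^ I.digits ≤ 2 * n := by
      rw [hn]; exact_mod_cast x.two_pow_digits_le
    have h4 : 4 ≤ n ^ δ := by
      calc (4 : ℝ) = ((4 : ℝ) ^ (1 / δ)) ^ δ := by
            rw [← Real.rpow_mul (by norm_num), one_div, inv_mul_cancel₀ hδ0.ne', Real.rpow_one]
        _ ≤ n ^ δ := Real.rpow_le_rpow hz1 (by linarith) hδ0.le
    rw [hBβ]
    exact Real.rpow_pow_le_of_two_pow_le hβ0 hβ1.le (by omega) hn1 h4 h2
      (hw.trans_le (I.width_timed_le x.k_pos))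
  have hexp : β * (k + 1) + δ * k + ((2 * M : ℕ) : ℝ) ≤ (1 - δ) * k := by
    have h1 : (1 + 2 * M) / (2 * δ) ≤ (k : ℝ) := by linarith
    rw [div_le_iff₀ (by positivity)] at h1
    have h2 : β = 1 - 4 * δ := by rw [hδ]; ring
    push_cast
    rw [h2]
    linarith
  set Z : ℝ := n ^ ((1 - δ) * k) * L ^ M with hZ
  clear_value Z
  have hmain : n ^ (β * (k + 1) + δ * k) * S ^ M ≤ Z := by
    calc n ^ (β * (k + 1) + δ * k) * S ^ M ≤ n ^ (β * (k + 1) + δ * k) * (n ^ (2 * M) * L ^ M) := by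
          gcongr
      _ = n ^ (β * (k + 1) + δ * k + ((2 * M : ℕ) : ℝ)) * L ^ M := by
        rw [Real.rpow_add (by linarith) _ ((2 * M : ℕ) : ℝ), Real.rpow_natCast, mul_assoc]
      _ ≤ Z := by
        rw [hZ]
        gcongr
  have hone : 1 ≤ n ^ (β * (k + 1) + δ * k) := Real.one_le_rpow hn1 (by positivity)
  have hSZ : S ^ M ≤ Z := le_trans (le_mul_of_one_le_left (by positivity) hone) hmain
  have hZ1 : 1 ≤ Z := (one_le_pow₀ hS1).trans hSZ
  have hsub : (2 - ε) ^ w ≤ B ^ w := pow_le_pow_left₀ (by linarith) hBε w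
  have hbound : C * (2 - ε) ^ w * ((x.formula.size : ℝ) + 1) ^ c ≤ 32 * |C| * Z := by
    have e1 : ((x.formula.size : ℝ) + 1) ^ c ≤ S ^ M := by
      have h1 : ((x.formula.size : ℝ) + 1) ≤ S ^ E := by rw [hS]; exact_mod_cast hE x
      calc ((x.formula.size : ℝ) + 1) ^ c ≤ (S ^ E) ^ c := pow_le_pow_left₀ (by positivity) h1 c
        _ = S ^ (E * c) := (pow_mul _ _ _).symm
        _ ≤ S ^ M := pow_le_pow_right₀ hS1 (by omega)
    have h2e : 0 ≤ 2 - ε := by linarith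
    calc C * (2 - ε) ^ w * ((x.formula.size : ℝ) + 1) ^ c
        ≤ |C| * (32 * n ^ (β * (k + 1) + δ * k)) * S ^ M := by
          refine mul_le_mul (mul_le_mul (le_abs_self C) (hsub.trans hwidth) (by positivity)
            (abs_nonneg C)) e1 (by positivity) (by positivity)
      _ = 32 * |C| * (n ^ (β * (k + 1) + δ * k) * S ^ M) := by ring
      _ ≤ _ := by gcongr
  refine (hp x _ (hq x.formula)).mono ?_
  have hD : S ^ D ≤ Z := (pow_le_pow_right₀ hS1 (by omega)).trans hSZ
  rw [← hS, ← hw]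
  calc S ^ D + 2 * (C * (2 - ε) ^ w * ((x.formula.size : ℝ) + 1) ^ c) + 3
      ≤ Z + 2 * (32 * |C| * Z) + 3 * Z := by linarith
    _ = (64 * |C| + 4) * n ^ ((1 - δ) * (k : ℝ)) * L ^ M := by rw [hZ]; ring

theorem mainTheorem5 :
    List.TFAE [
      ¬ PathSat.PPSETH,
      ∃ (ε : ℝ) (k : ℕ), 0 < ε ∧ 4 ≤ k ∧
        ∃ (p : RAM.Prog) (C : ℝ) (c : ℕ), ∀ I : Reconf.Instance k,
          RAM.Decides p I.encode I.Answer
            (C * (I.n : ℝ) ^ ((k : ℝ) - 1 - ε) * ((I.len : ℝ) + 1) ^ c),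
      ∃ (ε : ℝ) (k₀ : ℕ), 0 < ε ∧ 4 ≤ k₀ ∧
        ∃ (p : RAM.Prog) (C : ℝ) (c : ℕ), ∀ k : ℕ, k₀ ≤ k → ∀ I : Reconf.Instance k,
          RAM.Decides p I.encode I.Answer
            (C * (I.n : ℝ) ^ ((1 - ε) * (k : ℝ)) * ((I.len : ℝ) + 1) ^ c)] := by
  tfae_have 1 → 3 := Reconf.exists_of_not_PPSETH
  tfae_have 3 → 2 := by
    rintro ⟨ε, k₀, hε, hk₀, p, C, c, h⟩
    obtain ⟨m, hm⟩ := exists_nat_gt (1 / ε)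
    have h1 : 1 < ε * (k₀ + m : ℕ) := by
      rw [div_lt_iff₀ hε] at hm
      have : (0 : ℝ) ≤ ε * k₀ := by positivity
      push_cast
      linarith
    -- For a fixed `k` with `ε * k > 1`, the saving `ε * k` exceeds the one token that the second
    -- statement gives away, and the rest is the new gain.
    refine ⟨ε * (k₀ + m : ℕ) - 1, k₀ + m, by linarith, by omega, p, C, c, fun I => ?_⟩
    have h2 : ((k₀ + m : ℕ) : ℝ) - 1 - (ε * (k₀ + m : ℕ) - 1) = (1 - ε) * (k₀ + m : ℕ) := by ring
    rw [h2]
    exact h _ (by omega) I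
  tfae_have 2 → 1 := by
    rintro ⟨ε, k, hε, hk, p, C, c, h⟩
    exact PathSat.not_PPSETH_of_reconf hε hk h
  tfae_finish
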